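/- **Setting.** Work in $\mathbb R^3$ and put $\lambda_q=2^q$ for $q\in\mathbb Z$. Fix a nonnegative radial function $\chi\in C_0^\infty(B(0,1))$ with $\chi(\xi)=1$ for $|\xi|\le 1/2$, and let $\varphi(\xi)=\chi(\xi/2)-\chi(\xi)$. With $\mathcal F^{-1}g(y)=(2\pi)^{-3}\int e^{iy\cdot\xi}g(\xi)\,d\xi$, $h=\mathcal F^{-1}\varphi$ and $\tilde h=\mathcal F^{-1}\chi$, the Littlewood–Paley operators are $$\Delta_q f(x)=\lambda_q^3\int_{\mathbb R^3} h(\lambda_q y)f(x-y)\,dy\quad(q\ge 0),\qquad \Delta_{-1}f(x)=\int_{\mathbb R^3}\tilde h(y)f(x-y)\,dy,$$ and for integers $-1\le Q_0<Q_1$ we put $S_{Q_0Q_1}=\sum_{Q_0\le q\le Q_1}\Delta_q$. For a vector field $u\in L^2(\mathbb R^3;\mathbb R^3)$ that is divergence free in the sense of distributions, the energy flux through the dyadic shells between $\lambda_{Q_0}$ and $\lambda_{Q_1}$ is $$\Pi_{Q_0Q_1}=\int_{\mathbb R^3}\operatorname{Tr}\big[S_{Q_0Q_1}(u\otimes u)\cdot\nabla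 S_{Q_0Q_1}u\big]\,dx .$$ Let $K(q)=\lambda_q^{2/3}$ for $q\le 0$ and $K(q)=\lambda_q^{-4/3}$ for $q>0$, let $d_q=\lambda_q^{1/3}\|\Delta_q u\|_{L^3}\in[0,\infty]$ for $q\ge -1$, and $$(K*d^2)(Q)=\sum_{q\ge -1}K(Q-q)\,d_q^2\in[0,\infty].$$ **Theorem.** There is a constant $C>0$, depending only on $\chi$, such that for every divergence-free vector field $u\in L^2(\mathbb R^3;\mathbb R^3)$ and all integers $-1\le Q_0<Q_1$ the integral defining $\Pi_{Q_0Q_1}$ converges absolutely and $$|\Pi_{Q_0Q_1}|\le C\,(K*d^2)^{3/2}(Q_0)+C\,(K*d^2)^{3/2}(Q_1),$$ where the right-hand side may be $+\infty$. -/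

import Mathlib

open MeasureTheory FourierTransform
open scoped ENNReal NNReal ContDiff

noncomputable section

namespace LittlewoodPaley

/-- Three-dimensional Euclidean space. -/
abbrev E3 : Type := EuclideanSpace ℝ (Fin 3)

/-- The dyadic wavenumber `λ_q = 2 ^ q`, for an integer `q`. -/
def lam (q : ℤ) : ℝ := (2 : ℝ) ^ q

/-- The cut-off functions from which a Littlewood-Paley decomposition is built: nonnegative radial
functions in `C_0^∞(B(0,1))` that are equal to `1` for `|ξ| ≤ 1/2`. -/
structure IsCutoff (χ : E3 → ℝ) : Prop where
  nonneg : ∀ ξ, 0 ≤ χ ξ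
  radial : ∀ ξ η, ‖ξ‖ = ‖η‖ → χ ξ = χ η
  smooth : ContDiff ℝ ∞ χ
  support_subset : tsupport χ ⊆ Metric.ball 0 1
  eq_one : ∀ ξ, ‖ξ‖ ≤ 1 / 2 → χ ξ = 1

/-- The annular symbol `φ(ξ) = χ(ξ / λ_1) - χ(ξ)`. -/
def annulus (χ : E3 → ℝ) (ξ : E3) : ℝ := χ ((lam 1)⁻¹ • ξ) - χ ξ

/-- The inverse Fourier transform
`y ↦ (2π)⁻³ ∫ exp(i y·ξ) g(ξ) dξ = ∫ exp(2πi y·ξ) g(2πξ) dξ`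
of a symbol `g`, as a real function.  For the symbols `χ` and `φ`, which are even, the inverse
Fourier transform is real, see `coe_kernel`. -/
def kernel (g : E3 → ℝ) (y : E3) : ℝ :=
  (𝓕⁻ (fun ξ : E3 => ((g ((2 * Real.pi) • ξ) : ℝ) : ℂ)) y).re

theorem coe_kernel (g : E3 → ℝ) (hg : ∀ ξ, g (-ξ) = g ξ) (y : E3) :
    ((kernel g y : ℝ) : ℂ) = 𝓕⁻ (fun ξ : E3 => ((g ((2 * Real.pi) • ξ) : ℝ) : ℂ)) y := by
  unfold kernel
  rw [← Complex.conj_eq_iff_re, Real.fourierInv_eq', ← integral_conj, ← integral_neg_eq_self]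
  congr 1
  ext ξ
  simp only [smul_eq_mul, map_mul, Complex.conj_ofReal, ← Complex.exp_conj, Complex.conj_I,
    inner_neg_left, smul_neg, hg]
  congr 2
  push_cast
  ring

theorem IsCutoff.even {χ : E3 → ℝ} (hχ : IsCutoff χ) (ξ : E3) : χ (-ξ) = χ ξ :=
  hχ.radial _ _ (norm_neg ξ)

theorem IsCutoff.annulus_even {χ : E3 → ℝ} (hχ : IsCutoff χ) (ξ : E3) :
    annulus χ (-ξ) = annulus χ ξ := by
  simp only [annulus, smul_neg, hχ.even]

section

variable {F : Type*} [NormedAddCommGroup F] [NormedSpace ℝ F]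

/-- The Littlewood-Paley operators, for scalar or vector-valued functions `f`:
`Δ_q f (x) = λ_q³ ∫ h(λ_q y) f(x - y) dy` for `q ≥ 0`, where `h = 𝓕⁻ φ`,
`Δ_{-1} f (x) = ∫ h̃(y) f(x - y) dy`, where `h̃ = 𝓕⁻ χ`, and `Δ_q = 0` for `q ≤ -2`. -/
def block (χ : E3 → ℝ) (q : ℤ) (f : E3 → F) (x : E3) : F :=
  if 0 ≤ q then lam q ^ 3 • ∫ y, kernel (annulus χ) (lam q • y) • f (x - y)
  else if q = -1 then ∫ y, kernel χ y • f (x - y)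
  else 0

/-- The shell operator `S_{Q₀Q₁} = ∑_{Q₀ ≤ q ≤ Q₁} Δ_q`. -/
def shell (χ : E3 → ℝ) (Q₀ Q₁ : ℤ) (f : E3 → F) (x : E3) : F :=
  ∑ q ∈ Finset.Icc Q₀ Q₁, block χ q f x

end

/-- The vector field `u` is divergence free in the sense of distributions. -/
def DivergenceFree (u : E3 → E3) : Prop :=
  ∀ ψ : E3 → ℝ, ContDiff ℝ ∞ ψ → HasCompactSupport ψ → ∫ x, fderiv ℝ ψ x (u x) = 0

/-- The matrix field `S_{Q₀Q₁}(u ⊗ u)`, where `(u ⊗ u)_{ij} = u_i u_j`. -/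
def shellTensor (χ : E3 → ℝ) (Q₀ Q₁ : ℤ) (u : E3 → E3) (x : E3) : Matrix (Fin 3) (Fin 3) ℝ :=
  Matrix.of fun i j => shell χ Q₀ Q₁ (fun z => u z i * u z j) x

/-- The matrix field `∇v`, where `(∇v)_{ij} = ∂_i v_j`. -/
def grad (v : E3 → E3) (x : E3) : Matrix (Fin 3) (Fin 3) ℝ :=
  Matrix.of fun i j => fderiv ℝ v x (EuclideanSpace.single i 1) j

/-- The flux density `Tr [S_{Q₀Q₁}(u ⊗ u) · ∇ S_{Q₀Q₁} u]`. -/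
def fluxDensity (χ : E3 → ℝ) (Q₀ Q₁ : ℤ) (u : E3 → E3) (x : E3) : ℝ :=
  (shellTensor χ Q₀ Q₁ u x * grad (shell χ Q₀ Q₁ u) x).trace

/-- The energy flux `Π_{Q₀Q₁}` of `u` through the dyadic shells between `λ_{Q₀}` and `λ_{Q₁}`. -/
def flux (χ : E3 → ℝ) (Q₀ Q₁ : ℤ) (u : E3 → E3) : ℝ :=
  ∫ x, fluxDensity χ Q₀ Q₁ u x

/-- The localization kernel: `K(q) = λ_q^{2/3}` for `q ≤ 0` and `K(q) = λ_q^{-4/3}` for `q > 0`. -/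
def locKernel (q : ℤ) : ℝ :=
  if q ≤ 0 then lam q ^ (2 / 3 : ℝ) else lam q ^ (-4 / 3 : ℝ)

/-- `d_q = λ_q^{1/3} ‖Δ_q u‖_{L³}`, with values in `[0, ∞]`; it is `0` for `q ≤ -2`. -/
def amp (χ : E3 → ℝ) (u : E3 → E3) (q : ℤ) : ℝ≥0∞ :=
  ENNReal.ofReal (lam q ^ (1 / 3 : ℝ)) * eLpNorm (block χ q u) 3 volume

/-- `(K * d²)(Q) = ∑_{q ≥ -1} K(Q - q) d_q²`, with values in `[0, ∞]`. -/
def locSum (χ : E3 → ℝ) (u : E3 → E3) (Q : ℤ) : ℝ≥0∞ :=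
  ∑' q : {q : ℤ // -1 ≤ q}, ENNReal.ofReal (locKernel (Q - q)) * amp χ u q ^ 2

end LittlewoodPaley

end

namespace LittlewoodPaley

/-! ### Averages in `L^p` -/

/-! Write P_s for the filter with symbol χ(ξ/λ_s) (`low`). Then P_s P_t = P_t for t < s, and Δ_q =
P_{q+1} − P_q for q ≥ 0 (`band`). The shell operator telescopes to P_{Q₁+1} − P_{Q₀} if Q₀ ≥ 0, and
to P_{Q₁+1} if Q₀ = −1.

For a kernel k of integral one, the Constantin–E–Titi identity k*(fg) = r(f,g) + (k*f)(k*g) − (f −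
k*f)(g − k*g), where r averages products of increments of f and g, splits the flux into three terms
(`conv_mul_eq`, `fluxForm_self_eq`). The middle one is a transport term and vanishes because k*u is
divergence free. If u − P_{Q+1}u has L³ norm at most W and ∇P_{Q+1}u at most W λ_Q, then Hölder in
L³ bounds the other two by a multiple of W³ λ_Q (`LowBounds.enorm_fluxForm_le`).

For Q₀ ≥ 0 the shell kernel has integral zero, so this does not apply directly. Expanding the flux
of P_R − P_Q bilinearly leaves cross terms. As filters are self-adjoint, both cross terms equal ∫
u⊗u : ∇P_Q u, which does not depend on R. So R may be replaced by Q+1, and polarization with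
2P_{Q+1} − P_Q writes everything through fluxes of kernels of integral one, at the scales R and Q
only (`fluxForm_low_sub_low`).

It remains to take W = c λ_Q^{-1/3} (K*d²)(Q)^{1/2} (`LowBounds.exists_scaleBounds`). The terms of
K*d² are λ_Q^{2/3}‖Δ_q u‖₃² for q ≥ Q and λ_Q^{-4/3} λ_q²‖Δ_q u‖₃² for q ≤ Q, so what is needed is
‖∑ f_q‖₃² ≤ C ∑ ‖f_q‖₃² for blocks f_q. The proof of this avoids singular integrals: blocks are
added from low to high frequency, |F + f|³ is expanded, and the linear term ∫ |F| F f is small since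
f oscillates faster than F (`LowBounds.square_function_range`). Fatou's lemma extends the estimate
to u − P_{Q+1}u (`LowBounds.square_function_tail`). -/

theorem rpow_lintegral_le {Y : Type*} [MeasurableSpace Y] (ν : Measure Y) [IsFiniteMeasure ν]
    {F : Y → ℝ≥0∞} (hF : Measurable F) {p : ℝ} (hp : 1 ≤ p) :
    (∫⁻ y, F y ∂ν) ^ p ≤ ν Set.univ ^ (p - 1) * ∫⁻ y, F y ^ p ∂ν := by
  have h := eLpNorm'_le_eLpNorm'_mul_rpow_measure_univ (μ := ν) one_pos hp
    hF.aestronglyMeasurable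
  have hp0 : 0 < p := by linarith
  have h2 := ENNReal.rpow_le_rpow h hp0.le
  simp only [eLpNorm', enorm_eq_self, ENNReal.rpow_one, one_div, inv_one] at h2
  rw [ENNReal.mul_rpow_of_nonneg _ _ hp0.le, ← ENNReal.rpow_mul, ← ENNReal.rpow_mul,
    inv_mul_cancel₀ hp0.ne', ENNReal.rpow_one, sub_mul, inv_mul_cancel₀ hp0.ne', one_mul,
    mul_comm] at h2
  exact h2

/-- The `L^p` norm of an average is at most the supremum of the `L^p` norms of its terms. -/
theorem eLpNorm_le_of_enorm_le_lintegral {X Y G : Type*} [MeasurableSpace X] [MeasurableSpace Y]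
    [NormedAddCommGroup G] {μ : Measure X} [SFinite μ] (ν : Measure Y) [IsFiniteMeasure ν]
    {g : X → G} {F : X → Y → ℝ≥0∞} (hF : Measurable (Function.uncurry F))
    (hg : ∀ x, ‖g x‖ₑ ≤ ∫⁻ y, F x y ∂ν) {p N : ℝ≥0∞} (hp : 1 ≤ p) (hp' : p ≠ ⊤)
    (hN : ∀ y, eLpNorm (fun x => F x y) p μ ≤ N) :
    eLpNorm g p μ ≤ ν Set.univ * N := by
  have hp0 : p ≠ 0 := (zero_lt_one.trans_le hp).ne'
  have hq : 1 ≤ p.toReal := by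
    rw [← ENNReal.toReal_one]; exact ENNReal.toReal_mono hp' hp
  have hq0 : 0 < p.toReal := by linarith
  rw [eLpNorm_eq_lintegral_rpow_enorm_toReal hp0 hp', one_div, ENNReal.rpow_inv_le_iff hq0]
  have hN' : ∀ y, ∫⁻ x, F x y ^ p.toReal ∂μ ≤ N ^ p.toReal := by
    intro y
    have := hN y
    rw [eLpNorm_eq_lintegral_rpow_enorm_toReal hp0 hp', one_div, ENNReal.rpow_inv_le_iff hq0] at this
    simpa only [enorm_eq_self] using this
  calc ∫⁻ x, ‖g x‖ₑ ^ p.toReal ∂μ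
      ≤ ∫⁻ x, (ν Set.univ ^ (p.toReal - 1) * ∫⁻ y, F x y ^ p.toReal ∂ν) ∂μ := by
        refine lintegral_mono fun x => (ENNReal.rpow_le_rpow (hg x) hq0.le).trans ?_
        exact rpow_lintegral_le ν (hF.comp measurable_prodMk_left) hq
    _ = ν Set.univ ^ (p.toReal - 1) * ∫⁻ x, ∫⁻ y, F x y ^ p.toReal ∂ν ∂μ := by
        rw [lintegral_const_mul]
        exact (hF.pow_const _).lintegral_prod_right'
    _ = ν Set.univ ^ (p.toReal - 1) * ∫⁻ y, ∫⁻ x, F x y ^ p.toReal ∂μ ∂ν := by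
        rw [lintegral_lintegral_swap]
        exact (hF.pow_const _).aemeasurable
    _ ≤ ν Set.univ ^ (p.toReal - 1) * ∫⁻ _, N ^ p.toReal ∂ν := by
        gcongr with y; exact hN' y
    _ = (ν Set.univ * N) ^ p.toReal := by
        rw [lintegral_const, ENNReal.mul_rpow_of_nonneg _ _ hq0.le, mul_comm (N ^ _), ← mul_assoc]
        congr 1
        -- The powers p − 1 and 1 of the total mass are merged by `ENNReal.rpow_add`, which needs a
        -- nonzero base.
        by_cases h0 : ν Set.univ = 0
        · simp [h0, hq0]
        · nth_rewrite 2 [← ENNReal.rpow_one (ν Set.univ)]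
          rw [← ENNReal.rpow_add _ _ h0 (measure_ne_top _ _)]
          congr 1; ring

theorem eLpNorm_comp_sub_right {G : Type*} [NormedAddCommGroup G] {f : E3 → G} {p : ℝ≥0∞}
    (hf : AEStronglyMeasurable f volume) (y : E3) :
    eLpNorm (fun x => f (x - y)) p volume = eLpNorm f p volume :=
  eLpNorm_comp_measurePreserving hf (measurePreserving_sub_right volume y)

theorem eLpNorm_comp_add_right {G : Type*} [NormedAddCommGroup G] {f : E3 → G} {p : ℝ≥0∞}
    (hf : AEStronglyMeasurable f volume) (y : E3) :
    eLpNorm (fun x => f (x + y)) p volume = eLpNorm f p volume :=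
  eLpNorm_comp_measurePreserving hf (measurePreserving_add_right volume y)

/-- Convolution of real functions. -/
noncomputable def conv (k f : E3 → ℝ) (x : E3) : ℝ := ∫ y, k y * f (x - y)

theorem enorm_conv_le (k f : E3 → ℝ) (x : E3) :
    ‖conv k f x‖ₑ ≤ ∫⁻ y, ‖k y‖ₑ * ‖f (x - y)‖ₑ := by
  refine (enorm_integral_le_lintegral_enorm _).trans_eq ?_
  simp only [enorm_mul]

theorem measurable_conv {k f : E3 → ℝ} (hk : Measurable k) (hf : Measurable f) :
    Measurable (conv k f) := by
  apply StronglyMeasurable.measurable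
  apply StronglyMeasurable.integral_prod_right (f := fun x y => k y * f (x - y))
  apply Measurable.stronglyMeasurable
  simp only [Function.uncurry_def]
  fun_prop

/-- The averaging measure is |k| dy, whose total mass is ‖k‖₁. -/
theorem eLpNorm_le_lintegral_mul {G : Type*} [NormedAddCommGroup G] {g : E3 → G} {k : E3 → ℝ}
    (hk : Measurable k) (hk1 : eLpNorm k 1 volume ≠ ⊤)
    {F : E3 → E3 → ℝ≥0∞} (hF : Measurable (Function.uncurry F))
    (hg : ∀ x, ‖g x‖ₑ ≤ ∫⁻ y, ‖k y‖ₑ * F x y) {p N : ℝ≥0∞} (hp : 1 ≤ p) (hp' : p ≠ ⊤)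
    (hN : ∀ y, eLpNorm (fun x => F x y) p volume ≤ N) :
    eLpNorm g p volume ≤ eLpNorm k 1 volume * N := by
  rw [eLpNorm_one_eq_lintegral_enorm] at *
  have hu : (volume.withDensity fun y => ‖k y‖ₑ) Set.univ = ∫⁻ y, ‖k y‖ₑ := by
    rw [withDensity_apply _ MeasurableSet.univ, Measure.restrict_univ]
  have : IsFiniteMeasure (volume.withDensity fun y => ‖k y‖ₑ) :=
    ⟨by rw [hu]; exact lt_top_iff_ne_top.2 hk1⟩
  rw [← hu]
  refine eLpNorm_le_of_enorm_le_lintegral _ hF (fun x => ?_) hp hp' hN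
  have hFx : Measurable (F x) := hF.comp measurable_prodMk_left
  rw [lintegral_withDensity_eq_lintegral_mul _ hk.enorm hFx]
  exact hg x

/-- Young's inequality `‖k * f‖_p ≤ ‖k‖_1 ‖f‖_p`. -/
theorem eLpNorm_conv_le {k f : E3 → ℝ} (hk : Measurable k) (hk1 : eLpNorm k 1 volume ≠ ⊤)
    (hf : Measurable f) {p : ℝ≥0∞} (hp : 1 ≤ p) (hp' : p ≠ ⊤) :
    eLpNorm (conv k f) p volume ≤ eLpNorm k 1 volume * eLpNorm f p volume := by
  refine eLpNorm_le_lintegral_mul hk hk1 (F := fun x y => ‖f (x - y)‖ₑ) ?_ (enorm_conv_le k f)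
    hp hp' fun y => ?_
  · exact (hf.comp (measurable_fst.sub measurable_snd)).enorm
  · rw [eLpNorm_enorm, eLpNorm_comp_sub_right hf.aestronglyMeasurable]

/-- Translates differ in `L^p` by at most the length of the translation times `‖∇f‖_p`. -/
theorem eLpNorm_translate_sub_le {f : E3 → ℝ} (hf : ContDiff ℝ 1 f) (y : E3) {p : ℝ≥0∞}
    (hp : 1 ≤ p) (hp' : p ≠ ⊤) :
    eLpNorm (fun x => f (x + y) - f x) p volume ≤ ‖y‖ₑ * eLpNorm (fderiv ℝ f) p volume := by
  have hc : Continuous (fderiv ℝ f) := hf.continuous_fderiv one_ne_zero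
  -- The increment is the average over t in (0,1] of the derivative at x + ty applied to y, and each
  -- such translate has the same L^p norm.
  have key := eLpNorm_le_of_enorm_le_lintegral (μ := (volume : Measure E3))
    (volume.restrict (Set.Ioc (0:ℝ) 1)) (g := fun x => f (x + y) - f x)
    (F := fun x t => ‖fderiv ℝ f (x + t • y) y‖ₑ) ?_ ?_ hp hp' (N := ‖y‖ₑ * eLpNorm (fderiv ℝ f) p volume) ?_
  · simpa using key
  · apply Measurable.enorm
    exact ((hc.comp (by fun_prop : Continuous fun z : E3 × ℝ => z.1 + z.2 • y)).clm_apply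
      continuous_const).measurable
  · intro x
    have hd : ∀ t : ℝ, HasDerivAt (fun t : ℝ => f (x + t • y)) (fderiv ℝ f (x + t • y) y) t := by
      intro t
      have h1 : HasDerivAt (fun t : ℝ => x + t • y) y t := by
        simpa using ((hasDerivAt_id t).smul_const y).const_add x
      exact ((hf.differentiable one_ne_zero).differentiableAt.hasFDerivAt).comp_hasDerivAt t h1
    have hi : ∫ t in (0:ℝ)..1, fderiv ℝ f (x + t • y) y = f (x + y) - f x := by
      rw [intervalIntegral.integral_eq_sub_of_hasDerivAt (fun t _ => hd t)]
      · simp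
      · apply Continuous.intervalIntegrable
        fun_prop
    rw [← hi, intervalIntegral.integral_of_le zero_le_one]
    exact enorm_integral_le_lintegral_enorm _
  · intro t
    rw [eLpNorm_enorm]
    calc eLpNorm (fun x => fderiv ℝ f (x + t • y) y) p volume
        ≤ ‖y‖ₑ * eLpNorm (fun x => fderiv ℝ f (x + t • y)) p volume := by
          have := eLpNorm_le_mul_eLpNorm_of_ae_le_mul (p := p) (μ := (volume : Measure E3))
            (f := fun x => fderiv ℝ f (x + t • y) y)
            (g := fun x => fderiv ℝ f (x + t • y)) (c := ‖y‖) (Filter.Eventually.of_forall fun x => by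
              rw [mul_comm]; exact ContinuousLinearMap.le_opNorm _ _)
          rwa [ofReal_norm] at this
      _ = ‖y‖ₑ * eLpNorm (fderiv ℝ f) p volume := by
          rw [eLpNorm_comp_add_right hc.aestronglyMeasurable (t • y)]

/-- Hölder's inequality for three functions in `L³`. -/
theorem lintegral_mul_mul_le {f g h : E3 → ℝ} (hf : Measurable f) (hg : Measurable g)
    (hh : Measurable h) :
    ∫⁻ x, ‖f x‖ₑ * ‖g x‖ₑ * ‖h x‖ₑ ≤
      eLpNorm f 3 volume * eLpNorm g 3 volume * eLpNorm h 3 volume := by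
  have key := ENNReal.lintegral_prod_norm_pow_le (μ := (volume : Measure E3)) Finset.univ
    (f := fun (i : Fin 3) x => ‖(![f, g, h] i) x‖ₑ ^ (3 : ℝ)) (p := fun _ => 1 / 3)
    (fun i _ => by fin_cases i <;> simp <;> fun_prop) (by simp) (by simp)
  have h3 : ∀ a : ℝ≥0∞, (a ^ (3:ℝ)) ^ (3⁻¹ : ℝ) = a := fun a => by
    rw [← ENNReal.rpow_mul]; norm_num
  simp only [Fin.prod_univ_three, one_div, h3, Matrix.cons_val_zero, Matrix.cons_val_one,
    Matrix.cons_val] at key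
  simpa only [eLpNorm_eq_lintegral_rpow_enorm_toReal (p := 3) (by norm_num) (by norm_num),
    ENNReal.toReal_ofNat, one_div] using key

end LittlewoodPaley

namespace LittlewoodPaley

/-! ### Convolution with Schwartz functions -/

open LineDeriv in
/-- The derivative of a Schwartz function in the direction `v`. -/
noncomputable def dir (v : E3) (k : SchwartzMap E3 ℝ) : SchwartzMap E3 ℝ := ∂_{v} k

theorem dir_apply (v : E3) (k : SchwartzMap E3 ℝ) (x : E3) : dir v k x = fderiv ℝ k x v :=
  SchwartzMap.lineDerivOp_apply_eq_fderiv v k x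

theorem measurable_schwartz (k : SchwartzMap E3 ℝ) : Measurable k := k.continuous.measurable

theorem memLp_comp_sub_left {f : E3 → ℝ} {p : ℝ≥0∞} (hf : MemLp f p volume) (x : E3) :
    MemLp (fun y => f (x - y)) p volume :=
  hf.comp_measurePreserving (Measure.measurePreserving_sub_left volume x)

theorem integrable_conv {f : E3 → ℝ} (hf : MemLp f 2 volume) {k : E3 → ℝ} (hk : MemLp k 2 volume)
    (x : E3) : Integrable (fun y => k y * f (x - y)) volume :=
  hk.integrable_mul (memLp_comp_sub_left hf x)

theorem integrable_conv_of_integrable {f : E3 → ℝ} (hf : Integrable f volume)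
    (k : SchwartzMap E3 ℝ) (x : E3) : Integrable (fun y => k y * f (x - y)) volume :=
  (k.memLp_top volume).integrable_mul (memLp_one_iff_integrable.2 hf |> fun h =>
    memLp_comp_sub_left h x)

theorem conv_eq_integral (k f : E3 → ℝ) (x : E3) : conv k f x = ∫ y, k (x - y) * f y := by
  rw [conv, ← integral_sub_left_eq_self _ volume x]
  simp

/-- Only boundedness matters, so ab ≤ a² + b² replaces the sharp Cauchy–Schwarz constant. -/
theorem exists_abs_conv_le {f : E3 → ℝ} (hf : MemLp f 2 volume) {k : E3 → ℝ}
    (hk : MemLp k 2 volume) : ∃ C, ∀ x, |conv k f x| ≤ C := by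
  refine ⟨(∫ y, ‖k y‖ ^ 2) + ∫ y, ‖f y‖ ^ 2, fun x => ?_⟩
  have h1 : Integrable (fun y => ‖k y‖ ^ 2) volume := by
    simpa using hk.integrable_norm_pow (by norm_num)
  have h2 : Integrable (fun y => ‖f (x - y)‖ ^ 2) volume := by
    simpa using (memLp_comp_sub_left hf x).integrable_norm_pow (by norm_num)
  have h3 : ∫ y, ‖f (x - y)‖ ^ 2 = ∫ y, ‖f y‖ ^ 2 :=
    integral_sub_left_eq_self (fun y => ‖f y‖ ^ 2) volume x
  rw [← h3, ← integral_add h1 h2, ← Real.norm_eq_abs]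
  refine norm_integral_le_of_norm_le (h1.add h2) (Filter.Eventually.of_forall fun y => ?_)
  simp only [norm_mul]
  nlinarith [sq_nonneg (‖k y‖ - ‖f (x - y)‖), sq_nonneg (‖k y‖ + ‖f (x - y)‖)]

theorem exists_norm_fderiv_le (k : SchwartzMap E3 ℝ) :
    ∃ C, 0 ≤ C ∧ ∀ x, (1 + ‖x‖) ^ 2 * ‖fderiv ℝ k x‖ ≤ C := by
  obtain ⟨C, hC⟩ : ∃ C, ∀ x, (1 + ‖x‖) ^ 2 * ‖fderiv ℝ k x‖ ≤ C := by
    refine ⟨2 ^ 2 * ((Finset.Iic (2, 1)).sup fun m => SchwartzMap.seminorm ℝ m.1 m.2) k,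
      fun x => ?_⟩
    rw [← norm_iteratedFDeriv_one]
    exact SchwartzMap.one_add_le_sup_seminorm_apply (𝕜 := ℝ) (m := (2, 1)) le_rfl le_rfl k x
  exact ⟨C, (by positivity : (0:ℝ) ≤ (1 + ‖(0:E3)‖) ^ 2 * ‖fderiv ℝ k 0‖).trans (hC 0), hC⟩

theorem hasFDerivAt_conv (k : SchwartzMap E3 ℝ) {f : E3 → ℝ} (hf : MemLp f 2 volume) (x₀ : E3) :
    Integrable (fun y => f y • fderiv ℝ k (x₀ - y)) volume ∧
    HasFDerivAt (conv k f) (∫ y, f y • fderiv ℝ k (x₀ - y)) x₀ := by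
  obtain ⟨C, hC0, hC⟩ := exists_norm_fderiv_le k
  have hkc : Continuous (fderiv ℝ k) := (k.smooth 1).continuous_fderiv one_ne_zero
  have hm : ∀ x, AEStronglyMeasurable (fun y => f y • fderiv ℝ k (x - y)) volume := fun x =>
    hf.1.smul (hkc.comp (continuous_const.sub continuous_id)).aestronglyMeasurable
  -- From ab ≤ a² + b² with a = |f(y)|. The weight 2 in the decay of ∇k becomes 4 after squaring,
  -- which exceeds the dimension 3. Moving x within the unit ball costs a factor 2 in 1 + |x − y|,
  -- hence 4 in its square.
  set bound : E3 → ℝ := fun y => (4 * C) ^ 2 * (1 + ‖y - x₀‖) ^ (-(4:ℝ)) + ‖f y‖ ^ 2 with hbd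
  have hbi : Integrable bound volume := by
    refine Integrable.add (Integrable.const_mul ?_ _) ?_
    · have : Integrable (fun y : E3 => (1 + ‖y‖) ^ (-(4:ℝ))) volume :=
        integrable_one_add_norm (by simp; norm_num)
      exact this.comp_sub_right x₀
    · simpa using hf.integrable_norm_pow (by norm_num)
  have hb : ∀ y, ∀ x ∈ Metric.ball x₀ 1, ‖f y • fderiv ℝ k (x - y)‖ ≤ bound y := by
    intro y x hx
    have h1 : 1 + ‖y - x₀‖ ≤ 2 * (1 + ‖x - y‖) := by
      have h2 : ‖y - x₀‖ ≤ ‖x - x₀‖ + ‖x - y‖ := by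
        calc ‖y - x₀‖ = ‖(x - x₀) - (x - y)‖ := by congr 1; abel
          _ ≤ _ := norm_sub_le _ _
      have h3 : ‖x - x₀‖ < 1 := by simpa [dist_eq_norm] using hx
      have := norm_nonneg (x - y)
      linarith
    set r := 1 + ‖y - x₀‖
    have hr : 0 < r := by positivity
    have h4 : r ^ 2 * ‖fderiv ℝ k (x - y)‖ ≤ 4 * C := by
      have := hC (x - y)
      have h5 : r ^ 2 ≤ 4 * (1 + ‖x - y‖) ^ 2 := by
        calc r ^ 2 ≤ (2 * (1 + ‖x - y‖)) ^ 2 := by gcongr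
          _ = _ := by ring
      calc _ ≤ 4 * (1 + ‖x - y‖) ^ 2 * ‖fderiv ℝ k (x - y)‖ := by gcongr
        _ ≤ _ := by linarith
    have h6 : ‖fderiv ℝ k (x - y)‖ ≤ 4 * C * (r ^ 2)⁻¹ := by
      rw [← div_eq_mul_inv, le_div_iff₀ (by positivity)]; linarith
    have h7 : r ^ (-(4:ℝ)) = (r ^ 2)⁻¹ ^ 2 := by
      rw [Real.rpow_neg hr.le, inv_pow, ← pow_mul]; norm_cast
    rw [norm_smul]
    simp only [hbd]
    change _ ≤ (4 * C) ^ 2 * r ^ (-(4:ℝ)) + _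
    rw [h7]
    have h8 : ‖f y‖ * ‖fderiv ℝ k (x - y)‖ ≤ ‖f y‖ * (4 * C * (r ^ 2)⁻¹) := by gcongr
    nlinarith [sq_nonneg (‖f y‖ - 4 * C * (r ^ 2)⁻¹), sq_nonneg (‖f y‖ + 4 * C * (r ^ 2)⁻¹)]
  refine ⟨hbi.mono' (hm x₀) (Filter.Eventually.of_forall fun y => hb y x₀ (by simp)), ?_⟩
  have heq : conv k f = fun x => ∫ y, k (x - y) * f y := funext fun x => conv_eq_integral k f x
  rw [heq]
  refine hasFDerivAt_integral_of_dominated_of_fderiv_le (Metric.ball_mem_nhds x₀ one_pos)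
    (Filter.Eventually.of_forall fun x => ?_) ?_ (hm x₀) (Filter.Eventually.of_forall hb) hbi
    (Filter.Eventually.of_forall fun y x _ => ?_)
  · exact (k.continuous.comp (continuous_const.sub continuous_id)).aestronglyMeasurable.mul hf.1
  · exact (memLp_comp_sub_left (k.memLp 2) x₀).integrable_mul hf
  · have h1 : HasFDerivAt (fun x => k (x - y)) (fderiv ℝ k (x - y)) x := by
      exact (k.differentiableAt (x := x - y)).hasFDerivAt.comp x
        ((hasFDerivAt_id x).sub_const y)
    exact h1.mul_const (f y)

theorem fderiv_conv_apply (k : SchwartzMap E3 ℝ) {f : E3 → ℝ} (hf : MemLp f 2 volume) (x v : E3) :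
    fderiv ℝ (conv k f) x v = conv (dir v k) f x := by
  obtain ⟨hi, hd⟩ := hasFDerivAt_conv k hf x
  rw [hd.fderiv, ContinuousLinearMap.integral_apply hi, conv_eq_integral]
  simp only [dir_apply, smul_eq_mul, smul_apply, mul_comm]

/-- A directional derivative of k * f is again a convolution of f with a Schwartz function, so the
induction runs over all kernels at once. -/
theorem contDiff_conv (k : SchwartzMap E3 ℝ) {f : E3 → ℝ} (hf : MemLp f 2 volume) :
    ContDiff ℝ ∞ (conv k f) := by
  rw [contDiff_infty]
  intro n
  induction n generalizing k with
  | zero =>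
    exact contDiff_zero.2 (continuous_iff_continuousAt.2 fun x =>
      (hasFDerivAt_conv k hf x).2.continuousAt)
  | succ n ih =>
    rw [Nat.cast_add, Nat.cast_one, contDiff_succ_iff_fderiv_apply]
    refine ⟨fun x => (hasFDerivAt_conv k hf x).2.differentiableAt, by simp, fun v => ?_⟩
    simp only [fderiv_conv_apply k hf]
    exact ih _

theorem eLpNorm_schwartz_ne_top (k : SchwartzMap E3 ℝ) (p : ℝ≥0∞) : eLpNorm k p volume ≠ ⊤ :=
  (k.memLp p volume).eLpNorm_ne_top

theorem memLp_conv (k : SchwartzMap E3 ℝ) {f : E3 → ℝ} (hm : Measurable f) {p : ℝ≥0∞}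
    (hp : 1 ≤ p) (hp' : p ≠ ⊤) (hf : MemLp f p volume) : MemLp (conv k f) p volume :=
  ⟨(measurable_conv (measurable_schwartz k) hm).aestronglyMeasurable,
    (eLpNorm_conv_le (measurable_schwartz k) (eLpNorm_schwartz_ne_top k 1) hm hp hp').trans_lt
      (ENNReal.mul_lt_top (eLpNorm_schwartz_ne_top k 1).lt_top hf.2)⟩

/-- Interpolation: |f|³ ≤ C |f|². The field u is only in L², but its filtered pieces are also
bounded, hence have finite L³ norms. -/
theorem memLp_three_of_bounded {f : E3 → ℝ} (hf : MemLp f 2 volume) {C : ℝ}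
    (hC : ∀ x, |f x| ≤ C) : MemLp f 3 volume := by
  have hC0 : 0 ≤ C := (abs_nonneg _).trans (hC 0)
  have h2 : Integrable (fun y => ‖f y‖ ^ 2) volume := by
    simpa using hf.integrable_norm_pow (by norm_num)
  rw [← integrable_norm_rpow_iff hf.1 (by norm_num) (by norm_num)]
  refine (h2.const_mul C).mono' ?_ (Filter.Eventually.of_forall fun x => ?_)
  · exact (hf.1.norm.aemeasurable.pow_const _).aestronglyMeasurable
  · have := hC x
    simp only [ENNReal.toReal_ofNat]
    rw [show (3:ℝ) = (3:ℕ) by norm_num, Real.rpow_natCast, norm_pow, norm_norm, pow_succ,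
      mul_comm]
    gcongr
    exact this

theorem memLp_three_conv (k : SchwartzMap E3 ℝ) {f : E3 → ℝ} (hm : Measurable f)
    (hf : MemLp f 2 volume) : MemLp (conv k f) 3 volume := by
  obtain ⟨C, hC⟩ := exists_abs_conv_le hf (k.memLp 2)
  exact memLp_three_of_bounded (memLp_conv k hm (by norm_num) (by norm_num) hf) hC

theorem conv_add_left {k l f : E3 → ℝ} (hk : MemLp k 2 volume) (hl : MemLp l 2 volume)
    (hf : MemLp f 2 volume) (x : E3) : conv (k + l) f x = conv k f x + conv l f x := by
  simp only [conv, Pi.add_apply, add_mul]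
  exact integral_add (integrable_conv hf hk x) (integrable_conv hf hl x)

theorem conv_smul_left (c : ℝ) (k f : E3 → ℝ) (x : E3) : conv (c • k) f x = c * conv k f x := by
  simp only [conv, Pi.smul_apply, smul_eq_mul, mul_assoc]
  exact integral_const_mul _ _

theorem conv_sub_left {k l f : E3 → ℝ} (hk : MemLp k 2 volume) (hl : MemLp l 2 volume)
    (hf : MemLp f 2 volume) (x : E3) : conv (k - l) f x = conv k f x - conv l f x := by
  simp only [conv, Pi.sub_apply, sub_mul]
  exact integral_sub (integrable_conv hf hk x) (integrable_conv hf hl x)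

theorem conv_sub_right {k f g : E3 → ℝ} (hk : MemLp k 2 volume) (hf : MemLp f 2 volume)
    (hg : MemLp g 2 volume) (x : E3) : conv k (f - g) x = conv k f x - conv k g x := by
  simp only [conv, Pi.sub_apply, mul_sub]
  exact integral_sub (integrable_conv hf hk x) (integrable_conv hg hk x)

theorem conv_assoc (k l : SchwartzMap E3 ℝ) {f : E3 → ℝ} (hm : Measurable f)
    (hf : MemLp f 2 volume) (x : E3) : conv k (conv l f) x = conv (conv k l) f x := by
  have hfa : MemLp (fun x => ‖f x‖) 2 volume := hf.norm
  have hl1 : eLpNorm (fun x => ‖l x‖) 1 volume ≠ ⊤ := by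
    rw [eLpNorm_norm]; exact eLpNorm_schwartz_ne_top l 1
  have hln : MemLp (fun x => ‖l x‖) 2 volume := (l.memLp 2 volume).norm
  have hkn : MemLp (fun x => ‖k x‖) 2 volume := (k.memLp 2 volume).norm
  have := MeasureTheory.convolution_assoc (ContinuousLinearMap.mul ℝ ℝ) (ContinuousLinearMap.mul ℝ ℝ)
    (ContinuousLinearMap.mul ℝ ℝ) (ContinuousLinearMap.mul ℝ ℝ) (f := k) (g := l) (k := f)
    (μ := volume) (ν := volume) (x₀ := x) (fun x y z => by simp [mul_assoc])
    (k.continuous.aestronglyMeasurable) (l.continuous.aestronglyMeasurable) hf.1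
    (Filter.Eventually.of_forall fun y => integrable_conv (l.memLp 2) (k.memLp 2) y)
    (Filter.Eventually.of_forall fun y => integrable_conv hfa hln y)
    -- Fubini needs absolute convergence of the triple integral: |l| * |f| lies in L² by Young, and
    -- pairs with |k|.
    (by
      have h2 : MemLp (conv (fun x => ‖l x‖) fun x => ‖f x‖) 2 volume := by
        refine ⟨(measurable_conv (measurable_schwartz l).norm hm.norm).aestronglyMeasurable, ?_⟩
        exact (eLpNorm_conv_le (measurable_schwartz l).norm hl1 hm.norm (by norm_num)
          (by norm_num)).trans_lt (ENNReal.mul_lt_top hl1.lt_top hfa.2)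
      exact integrable_conv h2 hkn x)
  exact this.symm

/-- Convolution with an even kernel is self-adjoint. -/
theorem integral_conv_mul (k : SchwartzMap E3 ℝ) (hk : ∀ x, k (-x) = k x) {f g : E3 → ℝ}
    (hf : Integrable f volume) (hgm : Measurable g) {C : ℝ}
    (hg : ∀ x, |g x| ≤ C) : ∫ x, conv k f x * g x = ∫ x, f x * conv k g x := by
  -- Here f is only integrable, as u_i u_j will be. Boundedness of g then makes the double integral
  -- absolutely convergent.
  have hi : Integrable (Function.uncurry fun x y => k (x - y) * f y * g x)
      (volume.prod volume) := by
    have h1 : Integrable (fun p : E3 × E3 => f p.2 * k (p.1 - p.2)) (volume.prod volume) := by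
      simpa using hf.convolution_integrand (ContinuousLinearMap.mul ℝ ℝ) k.integrable
    have h2 := h1.bdd_mul (f := fun p : E3 × E3 => g p.1) (c := C)
      (hgm.comp measurable_fst).aestronglyMeasurable (Filter.Eventually.of_forall fun p => hg p.1)
    refine h2.congr (Filter.Eventually.of_forall fun p => ?_)
    simp only [Function.uncurry]; ring
  calc ∫ x, conv k f x * g x = ∫ x, ∫ y, k (x - y) * f y * g x := by
        simp only [conv_eq_integral, integral_mul_const]
    _ = ∫ y, ∫ x, k (x - y) * f y * g x := integral_integral_swap hi
    _ = ∫ x, f x * conv k g x := by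
        congr 1; ext y
        rw [conv_eq_integral, ← integral_const_mul]
        congr 1; ext x
        rw [← hk (x - y), neg_sub]; ring

end LittlewoodPaley

namespace LittlewoodPaley

/-! ### Kernels of smooth even symbols -/

/-- Smooth, compactly supported, even symbols. -/
structure IsSymbol (g : E3 → ℝ) : Prop where
  smooth : ContDiff ℝ ∞ g
  compact : HasCompactSupport g
  even : ∀ ξ, g (-ξ) = g ξ

/-- The rescaled complex symbol as a Schwartz function. -/
noncomputable def IsSymbol.complexSymbol {g : E3 → ℝ} (hg : IsSymbol g) : SchwartzMap E3 ℂ :=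
  HasCompactSupport.toSchwartzMap (f := fun ξ => ((g ((2 * Real.pi) • ξ) : ℝ) : ℂ))
    ((hg.compact.comp_smul (c := 2 * Real.pi) (by positivity)).comp_left Complex.ofReal_zero)
    (Complex.ofRealCLM.contDiff.comp (hg.smooth.comp (contDiff_const_smul _)))

theorem IsSymbol.complexSymbol_apply {g : E3 → ℝ} (hg : IsSymbol g) (ξ : E3) :
    hg.complexSymbol ξ = ((g ((2 * Real.pi) • ξ) : ℝ) : ℂ) := rfl

theorem IsSymbol.coe_fourierInv {g : E3 → ℝ} (hg : IsSymbol g) (y : E3) :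
    (𝓕⁻ hg.complexSymbol : SchwartzMap E3 ℂ) y = ((kernel g y : ℝ) : ℂ) := by
  rw [coe_kernel g hg.even, SchwartzMap.fourierInv_coe]
  rfl

/-- The kernel of a symbol as a Schwartz function. -/
noncomputable def IsSymbol.schwartz {g : E3 → ℝ} (hg : IsSymbol g) : SchwartzMap E3 ℝ :=
  SchwartzMap.postcompCLM Complex.reCLM (𝓕⁻ hg.complexSymbol)

theorem IsSymbol.schwartz_apply {g : E3 → ℝ} (hg : IsSymbol g) (y : E3) :
    hg.schwartz y = kernel g y := by
  change ((𝓕⁻ hg.complexSymbol : SchwartzMap E3 ℂ) y).re = kernel g y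
  rw [hg.coe_fourierInv, Complex.ofReal_re]

theorem kernel_even {g : E3 → ℝ} (hg : ∀ ξ, g (-ξ) = g ξ) (y : E3) : kernel g (-y) = kernel g y := by
  unfold kernel
  rw [Real.fourierInv_eq', Real.fourierInv_eq', ← integral_neg_eq_self]
  simp [hg]

theorem integral_kernel {g : E3 → ℝ} (hg : IsSymbol g) : ∫ y, kernel g y = g 0 := by
  have h : 𝓕 (𝓕⁻ hg.complexSymbol) (0 : E3) = ((g 0 : ℝ) : ℂ) := by
    rw [FourierTransform.fourier_fourierInv_eq, hg.complexSymbol_apply, smul_zero]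
  rw [SchwartzMap.fourier_coe, Real.fourier_eq'] at h
  simp only [inner_zero_right, mul_zero, Complex.ofReal_zero, zero_mul, Complex.exp_zero, one_smul,
    hg.coe_fourierInv] at h
  rw [integral_complex_ofReal] at h
  exact_mod_cast h

/-- On the Fourier side convolution is the product g h, which equals h because g = 1 wherever h ≠ 0.
-/
theorem conv_kernel {g h : E3 → ℝ} (hg : IsSymbol g) (hh : IsSymbol h)
    (hgh : ∀ ξ, g ξ * h ξ = h ξ) (x : E3) : conv (kernel g) (kernel h) x = kernel h x := by
  have h1 := SchwartzMap.convolution_apply (ContinuousLinearMap.mul ℂ ℂ) (𝓕⁻ hg.complexSymbol)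
    (𝓕⁻ hh.complexSymbol) x
  have h2 : SchwartzMap.convolution (ContinuousLinearMap.mul ℂ ℂ) (𝓕⁻ hg.complexSymbol)
      (𝓕⁻ hh.complexSymbol) = 𝓕⁻ hh.complexSymbol := by
    rw [← FourierTransform.fourierInv_fourier_eq (F := SchwartzMap E3 ℂ)
      (SchwartzMap.convolution (ContinuousLinearMap.mul ℂ ℂ) _ _), SchwartzMap.fourier_convolution]
    congr 1
    ext ξ
    rw [SchwartzMap.pairing_apply_apply, FourierTransform.fourier_fourierInv_eq,
      FourierTransform.fourier_fourierInv_eq, hg.complexSymbol_apply, hh.complexSymbol_apply,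
      ContinuousLinearMap.mul_apply', ← Complex.ofReal_mul, hgh]
  rw [h2, hh.coe_fourierInv] at h1
  have h3 : convolution (𝓕⁻ hg.complexSymbol : SchwartzMap E3 ℂ)
      (𝓕⁻ hh.complexSymbol : SchwartzMap E3 ℂ) (ContinuousLinearMap.mul ℂ ℂ) volume x
      = ((conv (kernel g) (kernel h) x : ℝ) : ℂ) := by
    rw [conv, ← integral_complex_ofReal]
    simp only [convolution, hg.coe_fourierInv, hh.coe_fourierInv, ContinuousLinearMap.mul_apply',
      Complex.ofReal_mul]
  rw [h3] at h1
  exact_mod_cast h1.symm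

theorem kernel_sub {g h : E3 → ℝ} (hg : IsSymbol g) (hh : IsSymbol h) (x : E3) :
    kernel (g - h) x = kernel g x - kernel h x := by
  have hgh : IsSymbol (g - h) := ⟨hg.smooth.sub hh.smooth, hg.compact.sub hh.compact,
    fun ξ => by simp [hg.even, hh.even]⟩
  have h1 : hgh.complexSymbol = hg.complexSymbol - hh.complexSymbol := by
    ext ξ
    simp [IsSymbol.complexSymbol_apply]
  rw [← hgh.schwartz_apply, ← hg.schwartz_apply, ← hh.schwartz_apply]
  have h2 : 𝓕⁻ (hg.complexSymbol - hh.complexSymbol)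
      = 𝓕⁻ hg.complexSymbol - 𝓕⁻ hh.complexSymbol :=
    map_sub (FourierTransform.fourierInvCLM ℂ (SchwartzMap E3 ℂ)) _ _
  simp only [IsSymbol.schwartz, h1, h2, map_sub, sub_apply]

theorem kernel_comp_smul (g : E3 → ℝ) {r : ℝ} (hr : 0 < r) (y : E3) :
    kernel (fun ξ => g (r⁻¹ • ξ)) y = r ^ 3 * kernel g (r • y) := by
  unfold kernel
  rw [Real.fourierInv_eq', Real.fourierInv_eq']
  have h := Measure.integral_comp_smul (volume : Measure E3)
    (fun v : E3 => Complex.exp (((2 * Real.pi * inner ℝ v (r • y) : ℝ) : ℂ) * Complex.I) •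
      ((g ((2 * Real.pi) • v) : ℝ) : ℂ)) r⁻¹
  have h2 : ∀ v : E3, inner ℝ (r⁻¹ • v) (r • y) = (inner ℝ v y : ℝ) := fun v => by
    rw [inner_smul_left, inner_smul_right]; simp; field_simp
  simp only [h2, smul_comm _ r⁻¹, finrank_euclideanSpace, Fintype.card_fin] at h
  rw [h, Complex.real_smul, Complex.re_ofReal_mul, inv_pow, inv_inv, abs_of_pos (by positivity)]

theorem lintegral_comp_smul_lam {r : ℝ} (hr : 0 < r) {F : E3 → ℝ≥0∞} (hF : Measurable F) :
    ∫⁻ y, ENNReal.ofReal (r ^ 3) * F (r • y) = ∫⁻ y, F y := by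
  have hFr : Measurable fun y : E3 => F (r • y) := hF.comp (measurable_const_smul r)
  rw [lintegral_const_mul _ hFr]
  have h := lintegral_map (μ := (volume : Measure E3)) hF (measurable_const_smul r)
  have h0 : ENNReal.ofReal (r ^ 3) ≠ 0 := by simpa using by positivity
  rw [← h, Measure.map_addHaar_smul _ hr.ne', lintegral_smul_measure, finrank_euclideanSpace,
    Fintype.card_fin, abs_of_pos (by positivity), smul_eq_mul, ← mul_assoc,
    ← ENNReal.ofReal_mul (by positivity), mul_inv_cancel₀ (by positivity), ENNReal.ofReal_one,
    one_mul]

/-! ### Low-pass filters at dyadic frequencies. -/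

theorem lam_pos (q : ℤ) : 0 < lam q := by unfold lam; positivity

theorem lam_add (p q : ℤ) : lam (p + q) = lam p * lam q := by
  unfold lam; exact zpow_add₀ two_ne_zero p q

/-- The low-pass symbol `χ(ξ / λ_s)`. -/
noncomputable def lowSymbol (χ : E3 → ℝ) (s : ℤ) (ξ : E3) : ℝ := χ ((lam s)⁻¹ • ξ)

theorem IsCutoff.isSymbol {χ : E3 → ℝ} (hχ : IsCutoff χ) (s : ℤ) : IsSymbol (lowSymbol χ s) where
  smooth := hχ.smooth.comp (contDiff_const_smul _)
  compact := by
    have : HasCompactSupport χ :=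
      (isCompact_closedBall (0 : E3) 1).of_isClosed_subset (isClosed_tsupport χ)
        (hχ.support_subset.trans Metric.ball_subset_closedBall)
    exact this.comp_smul (inv_ne_zero (lam_pos s).ne')
  even ξ := by simp [lowSymbol, hχ.even]

/-- The kernel of the low-pass filter at frequency `λ_s`. -/
noncomputable def low {χ : E3 → ℝ} (hχ : IsCutoff χ) (s : ℤ) : SchwartzMap E3 ℝ :=
  (hχ.isSymbol s).schwartz

variable {χ : E3 → ℝ} (hχ : IsCutoff χ)

theorem low_apply (s : ℤ) (y : E3) : low hχ s y = kernel (lowSymbol χ s) y :=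
  (hχ.isSymbol s).schwartz_apply y

theorem coe_low (s : ℤ) : (low hχ s : E3 → ℝ) = kernel (lowSymbol χ s) :=
  funext (low_apply hχ s)

theorem lowSymbol_zero : lowSymbol χ 0 = χ := by
  ext ξ; simp [lowSymbol, lam]

theorem low_zero (y : E3) : low hχ 0 y = kernel χ y := by
  rw [low_apply, lowSymbol_zero]

theorem low_scale (s : ℤ) (y : E3) : low hχ s y = lam s ^ 3 * low hχ 0 (lam s • y) := by
  rw [low_apply, low_zero]
  exact kernel_comp_smul χ (lam_pos s) y

theorem low_even (s : ℤ) (y : E3) : low hχ s (-y) = low hχ s y := by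
  rw [low_apply, low_apply, kernel_even (hχ.isSymbol s).even]

theorem integral_low (s : ℤ) : ∫ y, low hχ s y = 1 := by
  rw [coe_low, integral_kernel (hχ.isSymbol s), lowSymbol, smul_zero]
  exact hχ.eq_one 0 (by simp)

theorem IsCutoff.eq_zero {χ : E3 → ℝ} (hχ : IsCutoff χ) {ξ : E3} (hξ : 1 ≤ ‖ξ‖) : χ ξ = 0 := by
  by_contra h
  have := hχ.support_subset (subset_tsupport χ h)
  simp at this
  linarith

/-- The symbol of P_t vanishes for |ξ| ≥ λ_t, and that of P_s is 1 for |ξ| ≤ λ_s/2, where λ_t ≤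
λ_s/2. No margin is lost, so t < s suffices. -/
theorem conv_low_low {s t : ℤ} (hts : t < s) (x : E3) :
    conv (low hχ s) (low hχ t) x = low hχ t x := by
  rw [coe_low, coe_low]
  refine conv_kernel (hχ.isSymbol s) (hχ.isSymbol t) (fun ξ => ?_) x
  simp only [lowSymbol]
  by_cases h : 1 ≤ ‖(lam t)⁻¹ • ξ‖
  · simp [hχ.eq_zero h]
  · rw [hχ.eq_one ((lam s)⁻¹ • ξ), one_mul]
    push Not at h
    rw [norm_smul, norm_inv, Real.norm_eq_abs, abs_of_pos (lam_pos _), inv_mul_lt_iff₀ (lam_pos _),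
      mul_one] at h
    rw [norm_smul, norm_inv, Real.norm_eq_abs, abs_of_pos (lam_pos _), inv_mul_le_iff₀ (lam_pos _)]
    have h2 : lam (t + 1) ≤ lam s := by
      unfold lam; exact zpow_le_zpow_right₀ one_le_two (by omega)
    rw [lam_add] at h2
    simp only [lam, zpow_one] at h2 h ⊢
    linarith

theorem fderiv_low (s : ℤ) (y : E3) :
    fderiv ℝ (low hχ s) y = lam s ^ 4 • fderiv ℝ (low hχ 0) (lam s • y) := by
  have h1 : (low hχ s : E3 → ℝ) = fun y => lam s ^ 3 • low hχ 0 (lam s • y) := by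
    ext y; rw [low_scale]; rfl
  rw [h1, fderiv_fun_const_smul, fderiv_comp_smul, smul_smul, ← pow_succ]
  exact ((low hχ 0).differentiable.comp (by fun_prop : Differentiable ℝ fun y : E3 => lam s • y)) y

/-- All the kernels are L¹-normalized dilates of the one at s = 0, so dimensionless moments do not
depend on s and a derivative costs exactly λ_s. The second moment serves the product of two
increments in the commutator. -/
theorem exists_low_bounds : ∃ M : ℝ≥0∞, M ≠ ⊤ ∧ ∀ s : ℤ,
    ∫⁻ y, ‖low hχ s y‖ₑ * (1 + ENNReal.ofReal (lam s) * ‖y‖ₑ) ^ 2 ≤ M ∧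
    ∀ v : E3, ‖v‖ = 1 → eLpNorm (dir v (low hχ s)) 1 volume ≤ M * ENNReal.ofReal (lam s) := by
  set A := ∫⁻ y, ‖low hχ 0 y‖ₑ * (1 + ‖y‖ₑ) ^ 2 with hA
  set B := ∫⁻ y, ‖fderiv ℝ (low hχ 0) y‖ₑ with hB
  have hAf : A ≠ ⊤ := by
    have h0 := (low hχ 0).integrable_pow_mul volume 0
    have h1 := (low hχ 0).integrable_pow_mul volume 1
    have h2 := (low hχ 0).integrable_pow_mul volume 2
    have h3 := ((h0.add (h1.const_mul 2)).add h2).2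
    rw [hasFiniteIntegral_iff_enorm] at h3
    refine ne_top_of_le_ne_top h3.ne (lintegral_mono fun y => ?_)
    rw [← ofReal_norm, ← ofReal_norm, ← ofReal_norm, ← ENNReal.ofReal_one,
      ← ENNReal.ofReal_add zero_le_one (norm_nonneg _), ← ENNReal.ofReal_pow (by positivity),
      ← ENNReal.ofReal_mul (norm_nonneg _)]
    refine ENNReal.ofReal_le_ofReal (le_trans (le_of_eq ?_) (Real.le_norm_self _))
    simp only [Pi.add_apply]
    ring
  have hBf : B ≠ ⊤ := by
    have h := (SchwartzMap.fderivCLM ℝ E3 ℝ (low hχ 0)).integrable (μ := volume)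
    have h2 := h.2
    rw [hasFiniteIntegral_iff_enorm] at h2
    simpa only [SchwartzMap.fderivCLM_apply] using h2.ne
  have hkm : Continuous (fderiv ℝ (low hχ 0)) :=
    ((low hχ 0).smooth 1).continuous_fderiv one_ne_zero
  refine ⟨A + B, by finiteness, fun s => ⟨?_, fun v hv => ?_⟩⟩
  · refine le_trans (le_of_eq ?_) le_self_add
    rw [hA, ← lintegral_comp_smul_lam (lam_pos s)
      (F := fun y => ‖low hχ 0 y‖ₑ * (1 + ‖y‖ₑ) ^ 2)]
    · congr 1; ext y
      rw [low_scale, enorm_mul, enorm_smul, Real.enorm_eq_ofReal (by have := lam_pos s; positivity),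
        Real.enorm_eq_ofReal (lam_pos s).le]
      ring
    · have := measurable_schwartz (low hχ 0)
      fun_prop
  · rw [eLpNorm_one_eq_lintegral_enorm]
    calc ∫⁻ x, ‖dir v (low hχ s) x‖ₑ
        ≤ ∫⁻ x, ENNReal.ofReal (lam s) *
            (ENNReal.ofReal (lam s ^ 3) * ‖fderiv ℝ (low hχ 0) (lam s • x)‖ₑ) := by
          refine lintegral_mono fun x => ?_
          rw [dir_apply, fderiv_low, ← ofReal_norm, ← ofReal_norm, ← ENNReal.ofReal_mul,
            ← ENNReal.ofReal_mul (lam_pos s).le]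
          · refine ENNReal.ofReal_le_ofReal ((ContinuousLinearMap.le_opNorm _ _).trans_eq ?_)
            rw [hv, norm_smul, Real.norm_of_nonneg (by have := lam_pos s; positivity)]
            ring
          · have := lam_pos s; positivity
      _ = ENNReal.ofReal (lam s) * B := by
          rw [lintegral_const_mul, lintegral_comp_smul_lam (lam_pos s) hkm.measurable.enorm]
          have : Measurable fun x : E3 => fderiv ℝ (low hχ 0) (lam s • x) :=
            hkm.measurable.comp (measurable_const_smul _)
          exact this.enorm.const_mul _
      _ ≤ _ := by
          rw [mul_comm]; gcongr; exact le_add_self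

/-! ### Littlewood-Paley blocks in terms of low-pass filters -/

/-- The kernel of the block `Δ_q`. -/
noncomputable def band (q : ℤ) : SchwartzMap E3 ℝ := low hχ (q + 1) - low hχ q

theorem annulus_kernel (q : ℤ) (y : E3) :
    lam q ^ 3 * kernel (annulus χ) (lam q • y) = band hχ q y := by
  have h1 : annulus χ = lowSymbol χ 1 - lowSymbol χ 0 := by
    ext ξ; simp [annulus, lowSymbol, lam]
  rw [h1, kernel_sub (hχ.isSymbol 1) (hχ.isSymbol 0), ← low_apply hχ,
    ← low_apply hχ, band, sub_apply, low_scale hχ (q + 1), low_scale hχ q, low_scale hχ 1, lam_add, smul_smul,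
    mul_comm (lam q) (lam 1)]
  ring

end LittlewoodPaley

namespace LittlewoodPaley

/-! ### A square function estimate in `L³` -/

/-- Induction on M_n ≤ 2 √T_n with T_n = ∑_{m<n} t_m. With r = √T_{n+1}, the recursion gives
M_{n+1}³ ≤ 8 r T_n + (6 + 1) r t_n ≤ 8 r³, which is why the constant 2 closes. -/
theorem le_two_mul_sqrt_of_cube_le {M a t : ℕ → ℝ} (hM : ∀ n, 0 ≤ M n)
    (hM0 : M 0 = 0) (hat : ∀ n, a n ^ 2 ≤ t n)
    (h : ∀ n, M (n + 1) ^ 3 ≤ M n ^ 3 + 3 * M n * t n + a n ^ 3) (n : ℕ) :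
    M n ≤ 2 * √(∑ m ∈ Finset.range n, t m) := by
  have ht : ∀ n, 0 ≤ t n := fun n => (sq_nonneg _).trans (hat n)
  induction n with
  | zero => simp [hM0]
  | succ n ih =>
    rw [Finset.sum_range_succ]
    set T := ∑ m ∈ Finset.range n, t m with hT
    have hT0 : 0 ≤ T := Finset.sum_nonneg fun m _ => ht m
    set s := √T
    set r := √(T + t n)
    have hs0 : 0 ≤ s := Real.sqrt_nonneg _
    have hs : s ^ 2 = T := Real.sq_sqrt hT0
    have hr : r ^ 2 = T + t n := Real.sq_sqrt (add_nonneg hT0 (ht n))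
    have hsr : s ≤ r := Real.sqrt_le_sqrt (by linarith [ht n])
    have har : a n ≤ r := Real.le_sqrt_of_sq_le (by linarith [hat n])
    have hr0 : 0 ≤ r := hs0.trans hsr
    refine le_of_pow_le_pow_left₀ (n := 3) (by norm_num) (by positivity) ((h n).trans ?_)
    have h1 : M n ^ 3 ≤ (2 * s) ^ 3 := pow_le_pow_left₀ (hM n) ih 3
    have h2 : M n * t n ≤ 2 * s * t n := mul_le_mul_of_nonneg_right ih (ht n)
    have h3 : a n ^ 3 ≤ r * t n := by
      rw [pow_succ, mul_comm]; exact mul_le_mul har (hat n) (sq_nonneg _) hr0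
    have h4 : s * t n ≤ r * t n := mul_le_mul_of_nonneg_right hsr (ht n)
    have h5 : s ^ 3 ≤ r * s ^ 2 := by
      rw [pow_succ, mul_comm]; exact mul_le_mul_of_nonneg_right hsr (sq_nonneg _)
    have h6 : (2 * r) ^ 3 = 8 * (r * s ^ 2) + 8 * (r * t n) := by
      rw [hs, ← mul_add, ← mul_add, ← hr]; ring
    nlinarith [mul_nonneg hr0 (ht n)]

theorem sum_geometric_le (n : ℕ) : ∑ m ∈ Finset.range n, (1 / 2 : ℝ) ^ (n - m) ≤ 1 := by
  have h : ∑ m ∈ Finset.range n, (1 / 2 : ℝ) ^ (n - m)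
      = ∑ m ∈ Finset.range n, (1 / 2) * (1 / 2 : ℝ) ^ m := by
    rw [← Finset.sum_range_reflect]
    refine Finset.sum_congr rfl fun m hm => ?_
    rw [Finset.mem_range] at hm
    rw [← pow_succ']
    congr 1; omega
  rw [h, ← Finset.mul_sum, geom_sum_eq (by norm_num)]
  have : (0:ℝ) < (1 / 2) ^ n := by positivity
  norm_num
  linarith

/-- Schur's test: after ab ≤ (a² + b²)/2, the row sums and the column sums of the matrix 2^{-(n-m)},
m < n, are both at most 1. -/
theorem sum_mul_geometric_le (a : ℕ → ℝ) (N : ℕ) :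
    ∑ n ∈ Finset.range N, a n * ∑ m ∈ Finset.range n, (1 / 2 : ℝ) ^ (n - m) * a m
      ≤ ∑ n ∈ Finset.range N, a n ^ 2 := by
  have h1 : ∀ n, a n * ∑ m ∈ Finset.range n, (1 / 2 : ℝ) ^ (n - m) * a m
      ≤ (1 / 2) * a n ^ 2 + (1 / 2) * ∑ m ∈ Finset.range n, (1 / 2 : ℝ) ^ (n - m) * a m ^ 2 := by
    intro n
    calc a n * ∑ m ∈ Finset.range n, (1 / 2 : ℝ) ^ (n - m) * a m
        = ∑ m ∈ Finset.range n, (1 / 2 : ℝ) ^ (n - m) * (a n * a m) := by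
          rw [Finset.mul_sum]; exact Finset.sum_congr rfl fun m _ => by ring
      _ ≤ ∑ m ∈ Finset.range n, (1 / 2 : ℝ) ^ (n - m) * ((a n ^ 2 + a m ^ 2) / 2) := by
          refine Finset.sum_le_sum fun m _ => mul_le_mul_of_nonneg_left ?_ (by positivity)
          nlinarith [sq_nonneg (a n - a m)]
      _ = (1 / 2) * a n ^ 2 * ∑ m ∈ Finset.range n, (1 / 2 : ℝ) ^ (n - m) +
          (1 / 2) * ∑ m ∈ Finset.range n, (1 / 2 : ℝ) ^ (n - m) * a m ^ 2 := by
          rw [Finset.mul_sum, Finset.mul_sum, ← Finset.sum_add_distrib]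
          exact Finset.sum_congr rfl fun m _ => by ring
      _ ≤ _ := by
          nlinarith [sum_geometric_le n, sq_nonneg (a n)]
  have h2 : ∑ n ∈ Finset.range N, ∑ m ∈ Finset.range n, (1 / 2 : ℝ) ^ (n - m) * a m ^ 2
      ≤ ∑ n ∈ Finset.range N, a n ^ 2 := by
    -- Exchange of the order of summation over m < n < N.
    rw [Finset.sum_sigma', Finset.sum_bij' (s := (Finset.range N).sigma fun n => Finset.range n)
      (t := (Finset.range N).sigma fun m => Finset.Ico (m + 1) N)
      (i := fun p _ => (⟨p.2, p.1⟩ : Σ _ : ℕ, ℕ)) (j := fun p _ => (⟨p.2, p.1⟩ : Σ _ : ℕ, ℕ))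
      (g := fun p => (1 / 2 : ℝ) ^ (p.2 - p.1) * a p.1 ^ 2)
      (by simp; omega) (by simp; omega) (by simp) (by simp) (by simp), Finset.sum_sigma]
    refine Finset.sum_le_sum fun m hm => ?_
    dsimp only
    rw [← Finset.sum_mul]
    refine mul_le_of_le_one_left (sq_nonneg _) ?_
    have h3 : ∑ n ∈ Finset.Ico (m + 1) N, (1 / 2 : ℝ) ^ (n - m)
        = ∑ j ∈ Finset.range (N - (m + 1)), (1 / 2) * (1 / 2 : ℝ) ^ j := by
      rw [Finset.sum_Ico_eq_sum_range]
      refine Finset.sum_congr rfl fun j _ => ?_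
      rw [← pow_succ']; congr 1; omega
    rw [h3, ← Finset.mul_sum, geom_sum_eq (by norm_num)]
    have : (0:ℝ) < (1 / 2) ^ (N - (m + 1)) := by positivity
    norm_num
    linarith
  calc _ ≤ ∑ n ∈ Finset.range N, ((1 / 2) * a n ^ 2 +
        (1 / 2) * ∑ m ∈ Finset.range n, (1 / 2 : ℝ) ^ (n - m) * a m ^ 2) :=
        Finset.sum_le_sum fun n _ => h1 n
    _ ≤ _ := by
        rw [Finset.sum_add_distrib, ← Finset.mul_sum, ← Finset.mul_sum]; linarith

/-- Expansion of |·|³ around a. The linear term must keep its sign, since it is the one in which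
cancellation is later used. -/
theorem abs_add_cube_le (a b : ℝ) :
    |a + b| ^ 3 ≤ |a| ^ 3 + 3 * (|a| * a * b) + 3 * (|a| * |b| * |b|) + |b| ^ 3 := by
  rcases abs_cases a with ⟨ha, ha'⟩ | ⟨ha, ha'⟩ <;> rcases abs_cases b with ⟨hb, hb'⟩ | ⟨hb, hb'⟩ <;>
    rcases abs_cases (a + b) with ⟨hc, hc'⟩ | ⟨hc, hc'⟩ <;> rw [ha, hb, hc] <;>
    nlinarith [mul_nonneg (sq_nonneg a) (sq_nonneg b), sq_nonneg (a + b), sq_nonneg (2 * a + 3 * b),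
      sq_nonneg b, sq_nonneg a, mul_nonneg (abs_nonneg a) (sq_nonneg (2 * a + 3 * b)),
      mul_nonneg (abs_nonneg a) (sq_nonneg b), mul_nonneg (abs_nonneg b) (sq_nonneg a),
      mul_nonneg (abs_nonneg b) (sq_nonneg (a + b)), mul_nonneg (abs_nonneg a) (sq_nonneg (a + b)),
      pow_nonneg (abs_nonneg b) 3, pow_nonneg (abs_nonneg a) 3, pow_nonneg (abs_nonneg (a + b)) 3]

theorem toReal_eLpNorm_cube {f : E3 → ℝ} (hf : MemLp f 3 volume) :
    (eLpNorm f 3 volume).toReal ^ 3 = ∫ x, |f x| ^ 3 := by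
  have h := hf.eLpNorm_eq_integral_rpow_norm (by norm_num) (by norm_num)
  have h0 : (0:ℝ) ≤ ∫ x, |f x| ^ 3 := integral_nonneg fun x => by positivity
  rw [h, ENNReal.toReal_ofReal (by positivity), ENNReal.toReal_ofNat]
  simp only [Real.norm_eq_abs, show ∀ x : ℝ, x ^ (3:ℝ) = x ^ 3 from fun x => by norm_cast]
  rw [← Real.rpow_natCast, ← Real.rpow_mul h0]
  norm_num

theorem integrable_mul_mul {f g h : E3 → ℝ} (hfm : Measurable f) (hgm : Measurable g)
    (hhm : Measurable h) (hf : MemLp f 3 volume) (hg : MemLp g 3 volume) (hh : MemLp h 3 volume) :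
    Integrable (fun x => f x * g x * h x) volume := by
  refine ⟨(by fun_prop : Measurable fun x => f x * g x * h x).aestronglyMeasurable, ?_⟩
  rw [hasFiniteIntegral_iff_enorm]
  simp only [enorm_mul]
  exact (lintegral_mul_mul_le hfm hgm hhm).trans_lt
    (ENNReal.mul_lt_top (ENNReal.mul_lt_top hf.2 hg.2) hh.2)

theorem abs_integral_mul_mul_le {f g h : E3 → ℝ} (hfm : Measurable f) (hgm : Measurable g)
    (hhm : Measurable h) (hf : MemLp f 3 volume) (hg : MemLp g 3 volume) (hh : MemLp h 3 volume) :
    |∫ x, f x * g x * h x| ≤ (eLpNorm f 3 volume).toReal * (eLpNorm g 3 volume).toReal *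
      (eLpNorm h 3 volume).toReal := by
  have h1 := (enorm_integral_le_lintegral_enorm (μ := volume) fun x => f x * g x * h x)
  simp only [enorm_mul] at h1
  have h2 := ENNReal.toReal_mono (by
    exact (ENNReal.mul_lt_top (ENNReal.mul_lt_top hf.2 hg.2) hh.2).ne)
    (h1.trans (lintegral_mul_mul_le hfm hgm hhm))
  simpa [ENNReal.toReal_mul] using h2

theorem toReal_eLpNorm_add_cube_le {F f : E3 → ℝ} (hFm : Measurable F) (hfm : Measurable f)
    (hF : MemLp F 3 volume) (hf : MemLp f 3 volume) :
    (eLpNorm (F + f) 3 volume).toReal ^ 3 ≤ (eLpNorm F 3 volume).toReal ^ 3 +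
      3 * |∫ x, |F x| * F x * f x| + 3 * ((eLpNorm F 3 volume).toReal *
      (eLpNorm f 3 volume).toReal ^ 2) + (eLpNorm f 3 volume).toReal ^ 3 := by
  have hFa : MemLp (fun x => |F x|) 3 volume := hF.norm
  have hfa : MemLp (fun x => |f x|) 3 volume := hf.norm
  have hFam : Measurable fun x => |F x| := hFm.norm
  have hfam : Measurable fun x => |f x| := hfm.norm
  have e1 : eLpNorm (fun x => |F x|) 3 volume = eLpNorm F 3 volume := eLpNorm_norm F
  have e2 : eLpNorm (fun x => |f x|) 3 volume = eLpNorm f 3 volume := eLpNorm_norm f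
  rw [toReal_eLpNorm_cube (hF.add hf), toReal_eLpNorm_cube hF, toReal_eLpNorm_cube hf]
  have i1 : Integrable (fun x => |F x| ^ 3) volume := by
    refine (integrable_mul_mul hFam hFam hFam hFa hFa hFa).congr
      (Filter.Eventually.of_forall fun x => by ring)
  have i2 : Integrable (fun x => |f x| ^ 3) volume := by
    refine (integrable_mul_mul hfam hfam hfam hfa hfa hfa).congr
      (Filter.Eventually.of_forall fun x => by ring)
  have i3 := integrable_mul_mul hFam hFm hfm hFa hF hf
  have i4 := integrable_mul_mul hFam hfam hfam hFa hfa hfa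
  have b4 := abs_integral_mul_mul_le hFam hfam hfam hFa hfa hfa
  rw [e1, e2] at b4
  have i0 : Integrable (fun x => |(F + f) x| ^ 3) volume := by
    have hm : Measurable fun x => |(F + f) x| := (hFm.add hfm).norm
    have hl : MemLp (fun x => |(F + f) x|) 3 volume := (hF.add hf).norm
    exact (integrable_mul_mul hm hm hm hl hl hl).congr
      (Filter.Eventually.of_forall fun x => by ring)
  have key := integral_mono i0 (((i1.add (i3.const_mul 3)).add (i4.const_mul 3)).add i2)
    fun x => abs_add_cube_le (F x) (f x)
  rw [integral_add' (by exact (i1.add (i3.const_mul 3)).add (i4.const_mul 3)) i2,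
    integral_add' (by exact i1.add (i3.const_mul 3)) (i4.const_mul 3),
    integral_add' i1 (i3.const_mul 3), integral_const_mul, integral_const_mul] at key
  have := le_abs_self (∫ x, |F x| * F x * f x)
  have := le_abs_self (∫ x, |F x| * |f x| * |f x|)
  nlinarith

theorem abs_abs_mul_self_sub_le (a b : ℝ) : |(|a| * a - |b| * b)| ≤ |a - b| * (|a| + |b|) := by
  have h1 : |a| * a - |b| * b = |a| * (a - b) + (|a| - |b|) * b := by ring
  rw [h1]
  refine (abs_add_le _ _).trans ?_
  rw [abs_mul, abs_mul, abs_abs]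
  nlinarith [abs_abs_sub_abs_le a b, abs_nonneg b, abs_nonneg a]

theorem memLp_two_sq_integrable {f : E3 → ℝ} (hf : MemLp f 2 volume) :
    Integrable (fun x => |f x| ^ 2) volume := by
  simpa using hf.integrable_norm_pow (by norm_num)

theorem eLpNorm_abs_add_abs_le {F : E3 → ℝ} (hFm : Measurable F) (y : E3) :
    eLpNorm (fun x => |F (x - y)| + |F x|) 3 volume ≤ 2 * eLpNorm F 3 volume := by
  have e1 : eLpNorm (fun x => |F (x - y)|) 3 volume = eLpNorm F 3 volume := by
    rw [← eLpNorm_comp_sub_right (f := F) hFm.aestronglyMeasurable y]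
    exact eLpNorm_norm fun x => F (x - y)
  have e2 : eLpNorm (fun x => |F x|) 3 volume = eLpNorm F 3 volume := eLpNorm_norm F
  have m1 : Measurable fun x => |F (x - y)| := (hFm.comp (measurable_sub_const y)).norm
  have m2 : Measurable fun x => |F x| := hFm.norm
  have h := eLpNorm_add_le (p := 3) m1.aestronglyMeasurable (μ := volume) m2.aestronglyMeasurable
    (by norm_num)
  rw [e1, e2, ← two_mul] at h
  exact h

/-- A function reproduced by a mean-zero kernel is almost orthogonal to a smooth one. -/
theorem enorm_integral_abs_mul_self_mul_le {F f : E3 → ℝ} (hF1 : ContDiff ℝ 1 F)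
    (hF : MemLp F 2 volume) (hfm : Measurable f) {C : ℝ} (hfC : ∀ x, |f x| ≤ C)
    (k : SchwartzMap E3 ℝ) (hk : ∀ x, k (-x) = k x) (hk0 : ∫ x, k x = 0)
    (hkf : ∀ x, conv k f x = f x) :
    ‖∫ x, |F x| * F x * f x‖ₑ ≤ 2 * (∫⁻ y, ‖k y‖ₑ * ‖y‖ₑ) * eLpNorm (fderiv ℝ F) 3 volume *
      eLpNorm F 3 volume * eLpNorm f 3 volume := by
  have hFm : Measurable F := hF1.continuous.measurable
  have hkm := measurable_schwartz k
  set G : E3 → ℝ := fun x => |F x| * F x with hG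
  have hGm : Measurable G := hFm.norm.mul hFm
  have hGi : Integrable G volume := by
    refine (memLp_two_sq_integrable hF).mono' hGm.aestronglyMeasurable
      (Filter.Eventually.of_forall fun x => ?_)
    simp only [hG, norm_mul, Real.norm_eq_abs, abs_abs]
    exact (sq _).symm.le
  -- Self-adjointness moves the reproducing kernel of f onto |F|F. As k has mean zero, only
  -- increments of |F|F then remain, and these cost a gradient of F.
  have h1 : ∫ x, |F x| * F x * f x = ∫ x, conv k G x * f x := by
    rw [integral_conv_mul k hk hGi hfm hfC]
    simp only [hkf, hG]
  have h2 : ∀ x, conv k G x = ∫ y, k y * (G (x - y) - G x) := fun x => by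
    simp only [mul_sub]
    rw [integral_sub (integrable_conv_of_integrable hGi k x) (k.integrable.mul_const _),
      integral_mul_const, hk0, zero_mul, sub_zero, conv]
  have hδ : ∀ y, eLpNorm (fun x => F (x - y) - F x) 3 volume
      ≤ ‖y‖ₑ * eLpNorm (fderiv ℝ F) 3 volume := fun y => by
    simpa [sub_eq_add_neg] using
      eLpNorm_translate_sub_le hF1 (-y) (p := 3) (by norm_num) (by norm_num)
  rw [h1]
  calc ‖∫ x, conv k G x * f x‖ₑ
      ≤ ∫⁻ x, ‖conv k G x * f x‖ₑ := enorm_integral_le_lintegral_enorm _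
    _ ≤ ∫⁻ x, ∫⁻ y, ‖k y‖ₑ * (‖F (x - y) - F x‖ₑ * ‖|F (x - y)| + |F x|‖ₑ * ‖f x‖ₑ) := by
        refine lintegral_mono fun x => ?_
        rw [enorm_mul, h2]
        refine (mul_le_mul_left (enorm_integral_le_lintegral_enorm _) _).trans ?_
        rw [← lintegral_mul_const _ (by fun_prop)]
        refine lintegral_mono fun y => ?_
        rw [enorm_mul, mul_assoc]
        gcongr
        rw [← enorm_mul]
        refine enorm_le_iff_norm_le.2 ?_
        simp only [Real.norm_eq_abs, abs_mul, hG]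
        refine (abs_abs_mul_self_sub_le _ _).trans ?_
        rw [abs_of_nonneg (by positivity : 0 ≤ |F (x - y)| + |F x|)]
    _ = ∫⁻ y, ‖k y‖ₑ * ∫⁻ x, ‖F (x - y) - F x‖ₑ * ‖|F (x - y)| + |F x|‖ₑ * ‖f x‖ₑ := by
        rw [lintegral_lintegral_swap]
        · refine lintegral_congr fun y => ?_
          rw [lintegral_const_mul]
          fun_prop
        · apply Measurable.aemeasurable
          simp only [Function.uncurry_def]
          fun_prop
    _ ≤ ∫⁻ y, ‖k y‖ₑ * ((‖y‖ₑ * eLpNorm (fderiv ℝ F) 3 volume) * (2 * eLpNorm F 3 volume) *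
          eLpNorm f 3 volume) := by
        refine lintegral_mono fun y => ?_
        dsimp only
        gcongr
        have hm1 : Measurable fun x => F (x - y) := hFm.comp (measurable_sub_const y)
        refine (lintegral_mul_mul_le (f := fun x => F (x - y) - F x)
          (g := fun x => |F (x - y)| + |F x|) (hm1.sub hFm) (hm1.norm.add hFm.norm) hfm).trans ?_
        gcongr
        · exact hδ y
        · exact eLpNorm_abs_add_abs_le hFm y
    _ = _ := by
        have : ∀ y : E3, ‖k y‖ₑ * ((‖y‖ₑ * eLpNorm (fderiv ℝ F) 3 volume) *
            (2 * eLpNorm F 3 volume) * eLpNorm f 3 volume) = (‖k y‖ₑ * ‖y‖ₑ) *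
            (2 * eLpNorm (fderiv ℝ F) 3 volume * eLpNorm F 3 volume * eLpNorm f 3 volume) :=
          fun y => by ring
        simp only [this]
        rw [lintegral_mul_const _ (by fun_prop)]
        ring

end LittlewoodPaley

namespace LittlewoodPaley

/-! ### Composition of low-pass filters -/

theorem conv_comm (k l : E3 → ℝ) : conv k l = conv l k := by
  ext x
  rw [conv_eq_integral, conv]
  simp only [mul_comm]

variable {χ : E3 → ℝ} (hχ : IsCutoff χ)

theorem conv_low_low_left {s t : ℤ} (hts : t < s) :
    conv (low hχ s) (low hχ t) = low hχ t := funext (conv_low_low hχ hts)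

theorem conv_low_low_right {s t : ℤ} (hts : t < s) :
    conv (low hχ t) (low hχ s) = low hχ t := by
  rw [conv_comm, conv_low_low_left hχ hts]

/-- Derivatives commute with filters, so the absorption rule survives when either filter is
differentiated. -/
theorem conv_dir_low_low {s t : ℤ} (v : E3) (hts : t < s) :
    conv (dir v (low hχ t)) (low hχ s) = dir v (low hχ t) := by
  ext x
  rw [← fderiv_conv_apply (low hχ t) ((low hχ s).memLp 2) x v, conv_low_low_right hχ hts, dir_apply]

theorem conv_low_dir_low {s t : ℤ} (v : E3) (hts : t < s) :
    conv (dir v (low hχ s)) (low hχ t) = dir v (low hχ t) := by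
  ext x
  rw [← fderiv_conv_apply (low hχ s) ((low hχ t).memLp 2) x v, conv_low_low_left hχ hts, dir_apply]

section

variable {f : E3 → ℝ} (hm : Measurable f) (hf : MemLp f 2 volume)
include hm hf

theorem low_conv_low_of_lt {s t : ℤ} (hts : t < s) :
    conv (low hχ s) (conv (low hχ t) f) = conv (low hχ t) f := by
  ext x; rw [conv_assoc _ _ hm hf, conv_low_low_left hχ hts]

theorem low_conv_low_of_gt {s t : ℤ} (hts : t < s) :
    conv (low hχ t) (conv (low hχ s) f) = conv (low hχ t) f := by
  ext x; rw [conv_assoc _ _ hm hf, conv_low_low_right hχ hts]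

theorem dir_low_conv_low_of_lt {s t : ℤ} (v : E3) (hts : t < s) :
    conv (dir v (low hχ s)) (conv (low hχ t) f) = conv (dir v (low hχ t)) f := by
  ext x; rw [conv_assoc _ _ hm hf, conv_low_dir_low hχ v hts]

theorem low_conv_dir_low_of_lt {s t : ℤ} (v : E3) (hts : t < s) :
    conv (low hχ s) (conv (dir v (low hχ t)) f) = conv (dir v (low hχ t)) f := by
  ext x; rw [conv_assoc _ _ hm hf, conv_comm (low hχ s), conv_dir_low_low hχ v hts]

theorem low_conv_dir_low_of_gt {s t : ℤ} (v : E3) (hts : t < s) :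
    conv (low hχ t) (conv (dir v (low hχ s)) f) = conv (dir v (low hχ t)) f := by
  ext x; rw [conv_assoc _ _ hm hf, conv_comm (low hχ t), conv_low_dir_low hχ v hts]

omit hm in
theorem conv_band (q : ℤ) :
    conv (band hχ q) f = conv (low hχ (q + 1)) f - conv (low hχ q) f := by
  ext x
  exact conv_sub_left ((low hχ (q + 1)).memLp 2) ((low hχ q).memLp 2) hf x

omit hf in
theorem measurable_conv_schwartz (k : SchwartzMap E3 ℝ) : Measurable (conv k f) :=
  measurable_conv (measurable_schwartz k) hm

theorem memLp_two_conv (k : SchwartzMap E3 ℝ) : MemLp (conv k f) 2 volume :=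
  memLp_conv k hm (by norm_num) (by norm_num) hf

theorem low_conv_band_of_lt {q s : ℤ} (hs : q + 1 < s) :
    conv (low hχ s) (conv (band hχ q) f) = conv (band hχ q) f := by
  ext x
  rw [conv_band hχ hf, conv_sub_right ((low hχ s).memLp 2) (memLp_two_conv hm hf _)
    (memLp_two_conv hm hf _), low_conv_low_of_lt hχ hm hf hs,
    low_conv_low_of_lt hχ hm hf (by omega : q < s), Pi.sub_apply]

theorem low_conv_band_of_gt {q s : ℤ} (hs : s < q) (x : E3) :
    conv (low hχ s) (conv (band hχ q) f) x = 0 := by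
  rw [conv_band hχ hf, conv_sub_right ((low hχ s).memLp 2) (memLp_two_conv hm hf _)
    (memLp_two_conv hm hf _), low_conv_low_of_gt hχ hm hf hs,
    low_conv_low_of_gt hχ hm hf (by omega : s < q + 1), sub_self]

end

/-! ### Bernstein's inequality and moments -/

/-- The standard basis vectors. -/
noncomputable def stdv (i : Fin 3) : E3 := EuclideanSpace.single i 1

theorem norm_stdv (i : Fin 3) : ‖stdv i‖ = 1 := by simp [stdv]

theorem norm_clm_le_sum (L : E3 →L[ℝ] ℝ) : ‖L‖ ≤ ∑ i, ‖L (stdv i)‖ := by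
  refine L.opNorm_le_bound (Finset.sum_nonneg fun i _ => norm_nonneg _) fun x => ?_
  have hx : x = ∑ i, x i • stdv i := by
    ext j; fin_cases j <;> simp [stdv, Fin.sum_univ_three]
  have h1 : L x = ∑ i, x i * L (stdv i) := by
    conv_lhs => rw [hx]
    simp
  rw [h1, Finset.sum_mul]
  refine (norm_sum_le _ _).trans (Finset.sum_le_sum fun i _ => ?_)
  rw [norm_mul, mul_comm]
  gcongr
  exact PiLp.norm_apply_le x i

theorem eLpNorm_fderiv_le_sum {F : E3 → ℝ} (hF : ContDiff ℝ 1 F) :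
    eLpNorm (fderiv ℝ F) 3 volume
      ≤ ∑ i, eLpNorm (fun x => fderiv ℝ F x (stdv i)) 3 volume := by
  have hc : Continuous (fderiv ℝ F) := hF.continuous_fderiv one_ne_zero
  have hn : ∀ i, eLpNorm (fun x => ‖fderiv ℝ F x (stdv i)‖) 3 volume
      = eLpNorm (fun x => fderiv ℝ F x (stdv i)) 3 volume := fun i =>
    eLpNorm_norm fun x => fderiv ℝ F x (stdv i)
  calc eLpNorm (fderiv ℝ F) 3 volume
      ≤ eLpNorm (∑ i, fun x => ‖fderiv ℝ F x (stdv i)‖) 3 volume := by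
        refine eLpNorm_mono fun x => ?_
        rw [Finset.sum_apply, Real.norm_of_nonneg (Finset.sum_nonneg fun i _ => norm_nonneg _)]
        exact norm_clm_le_sum _
    _ ≤ ∑ i, eLpNorm (fun x => ‖fderiv ℝ F x (stdv i)‖) 3 volume := by
        refine eLpNorm_sum_le (fun i _ => ?_) (by norm_num)
        have : Continuous fun x => fderiv ℝ F x (stdv i) := hc.clm_apply continuous_const
        exact this.norm.aestronglyMeasurable
    _ = _ := Finset.sum_congr rfl fun i _ => hn i

/-- `M` bounds the kernels of the low-pass filters, uniformly in the frequency. -/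
structure LowBounds (M : ℝ≥0∞) : Prop where
  ne_top : M ≠ ⊤
  moment : ∀ s : ℤ, ∫⁻ y, ‖low hχ s y‖ₑ * (1 + ENNReal.ofReal (lam s) * ‖y‖ₑ) ^ 2 ≤ M
  deriv_norm : ∀ (s : ℤ) (i : Fin 3),
    eLpNorm (dir (stdv i) (low hχ s)) 1 volume ≤ M * ENNReal.ofReal (lam s)

theorem exists_lowBounds : ∃ M, LowBounds hχ M := by
  obtain ⟨M, hM, h⟩ := exists_low_bounds hχ
  exact ⟨M, hM, fun s => (h s).1, fun s i => (h s).2 _ (norm_stdv i)⟩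

variable {hχ} {M : ℝ≥0∞} (hM : LowBounds hχ M)
include hM

theorem LowBounds.norm_one (s : ℤ) : eLpNorm (low hχ s) 1 volume ≤ M := by
  rw [eLpNorm_one_eq_lintegral_enorm]
  refine (lintegral_mono fun y => ?_).trans (hM.moment s)
  exact le_mul_of_one_le_right' (one_le_pow_of_one_le' le_self_add 2)

theorem LowBounds.first_moment (s : ℤ) :
    ∫⁻ y, ‖low hχ s y‖ₑ * ‖y‖ₑ ≤ M * ENNReal.ofReal (lam s)⁻¹ := by
  have h0 : ENNReal.ofReal (lam s) ≠ 0 := by simpa using lam_pos s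
  rw [ENNReal.ofReal_inv_of_pos (lam_pos s), ← div_eq_mul_inv,
    ENNReal.le_div_iff_mul_le (Or.inl h0) (Or.inl ENNReal.ofReal_ne_top),
    ← lintegral_mul_const _ (by have := measurable_schwartz (low hχ s); fun_prop)]
  refine (lintegral_mono fun y => ?_).trans (hM.moment s)
  rw [mul_assoc]
  gcongr
  rw [mul_comm, sq]
  exact le_add_self.trans (le_mul_of_one_le_right' le_self_add)

theorem LowBounds.eLpNorm_low_conv_le (s : ℤ) {f : E3 → ℝ} (hm : Measurable f) {p : ℝ≥0∞}
    (hp : 1 ≤ p) (hp' : p ≠ ⊤) :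
    eLpNorm (conv (low hχ s) f) p volume ≤ M * eLpNorm f p volume :=
  (eLpNorm_conv_le (measurable_schwartz _) (eLpNorm_schwartz_ne_top _ 1) hm hp hp').trans
    (mul_le_mul_left (hM.norm_one s) _)

/-- Bernstein's inequality. -/
theorem LowBounds.eLpNorm_dir_low_conv_le (s : ℤ) (i : Fin 3) {f : E3 → ℝ} (hm : Measurable f) :
    eLpNorm (conv (dir (stdv i) (low hχ s)) f) 3 volume
      ≤ M * ENNReal.ofReal (lam s) * eLpNorm f 3 volume :=
  (eLpNorm_conv_le (measurable_schwartz _) (eLpNorm_schwartz_ne_top _ 1) hm (by norm_num)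
    (by norm_num)).trans (mul_le_mul_left (hM.deriv_norm s i) _)

/-- The block at q is reproduced by P_{q+2}, so its derivative falls on that kernel; the 4 is
λ_{q+2}/λ_q. -/
theorem LowBounds.eLpNorm_fderiv_band_le (q : ℤ) {f : E3 → ℝ} (hm : Measurable f)
    (hf : MemLp f 2 volume) (i : Fin 3) :
    eLpNorm (fun x => fderiv ℝ (conv (band hχ q) f) x (stdv i)) 3 volume
      ≤ 4 * M * ENNReal.ofReal (lam q) * eLpNorm (conv (band hχ q) f) 3 volume := by
  have hl : ENNReal.ofReal (lam (q + 2)) = 4 * ENNReal.ofReal (lam q) := by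
    rw [lam_add, mul_comm, ENNReal.ofReal_mul (lam_pos 2).le]
    congr 1
    simp only [lam]; norm_num
  have h := hM.eLpNorm_dir_low_conv_le (q + 2) i (measurable_conv_schwartz hm (band hχ q))
  rw [hl] at h
  have e : (fun x => fderiv ℝ (conv (band hχ q) f) x (stdv i))
      = conv (dir (stdv i) (low hχ (q + 2))) (conv (band hχ q) f) := by
    ext x
    rw [← fderiv_conv_apply _ (memLp_two_conv hm hf _),
      low_conv_band_of_lt hχ hm hf (by omega : q + 1 < q + 2)]
  rw [e]
  refine h.trans_eq (by ring)

/-! ### The square function estimate -/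

theorem LowBounds.moment_sub_le (q : ℤ) :
    ∫⁻ y, ‖(low hχ (q + 2) - low hχ (q - 1)) y‖ₑ * ‖y‖ₑ ≤ 3 * M * ENNReal.ofReal (lam q)⁻¹ := by
  have m1 := measurable_schwartz (low hχ (q + 2))
  have m2 := measurable_schwartz (low hχ (q - 1))
  calc ∫⁻ y, ‖(low hχ (q + 2) - low hχ (q - 1)) y‖ₑ * ‖y‖ₑ
      ≤ ∫⁻ y, (‖low hχ (q + 2) y‖ₑ * ‖y‖ₑ + ‖low hχ (q - 1) y‖ₑ * ‖y‖ₑ) := by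
        refine lintegral_mono fun y => ?_
        rw [← add_mul]
        gcongr
        exact enorm_sub_le
    _ ≤ M * ENNReal.ofReal (lam (q + 2))⁻¹ + M * ENNReal.ofReal (lam (q - 1))⁻¹ := by
        rw [lintegral_add_left (by fun_prop)]
        exact add_le_add (hM.first_moment _) (hM.first_moment _)
    _ ≤ 3 * M * ENNReal.ofReal (lam q)⁻¹ := by
        have hq := lam_pos q
        rw [← mul_add, mul_comm 3 M, mul_assoc, ← ENNReal.ofReal_add
          (inv_nonneg.2 (lam_pos _).le) (inv_nonneg.2 (lam_pos _).le)]
        gcongr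
        rw [show (3 : ℝ≥0∞) = ENNReal.ofReal 3 by simp, ← ENNReal.ofReal_mul (by norm_num)]
        refine ENNReal.ofReal_le_ofReal ?_
        rw [lam_add, sub_eq_add_neg, lam_add, mul_inv, mul_inv]
        -- The two first moments contribute 1/4 and 2, and 9/4 ≤ 3.
        have h1 : (lam 2)⁻¹ = 1 / 4 := by simp only [lam]; norm_num
        have h2 : (lam (-1))⁻¹ = 2 := by simp only [lam]; norm_num
        rw [h1, h2]
        have := inv_pos.2 hq
        linarith

/-- The kernel of P_{q+2} − P_{q−1} has mean zero and reproduces the block at q: P_{q+2} fixes the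
block and P_{q−1} kills it. The factor λ_q^{-1} from its first moment meets the factors λ_m from the
gradients of the lower blocks. Here 12 = 3 · 4, from three partial derivatives and Bernstein. -/
theorem LowBounds.enorm_integral_partial_sum_le {g : E3 → ℝ} (hm : Measurable g)
    (hg : MemLp g 2 volume) (a : ℤ) (n : ℕ) {F : E3 → ℝ}
    (hF : F = ∑ m ∈ Finset.range n, conv (band hχ (a + m)) g) :
    ‖∫ x, |F x| * F x * conv (band hχ (a + n)) g x‖ₑ ≤
      2 * (3 * M * ENNReal.ofReal (lam (a + n))⁻¹) *
      (∑ m ∈ Finset.range n, 12 * M * ENNReal.ofReal (lam (a + m)) *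
        eLpNorm (conv (band hχ (a + m)) g) 3 volume) * eLpNorm F 3 volume *
      eLpNorm (conv (band hχ (a + n)) g) 3 volume := by
  set q : ℤ := a + n
  have hc : ∀ m : ℕ, ContDiff ℝ 1 (conv (band hχ (a + m)) g) := fun m =>
    (contDiff_conv _ hg).of_le (by exact_mod_cast le_top)
  have hF1 : ContDiff ℝ 1 F := by
    have : F = fun x => ∑ m ∈ Finset.range n, conv (band hχ (a + m)) g x := by
      ext x; rw [hF, Finset.sum_apply]
    rw [this]
    exact ContDiff.sum fun m _ => hc m
  have hF2 : MemLp F 2 volume := by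
    rw [hF]; exact memLp_finsetSum' _ fun m _ => memLp_two_conv hm hg _
  obtain ⟨C, hC⟩ := exists_abs_conv_le hg ((band hχ q).memLp 2)
  have h1 := enorm_integral_abs_mul_self_mul_le hF1 hF2
    (measurable_conv_schwartz hm (band hχ q)) hC (low hχ (q + 2) - low hχ (q - 1))
    (fun x => by simp only [sub_apply, low_even])
    (by
      simp only [sub_apply]
      rw [integral_sub (low hχ (q + 2)).integrable (low hχ (q - 1)).integrable, integral_low,
        integral_low, sub_self])
    (fun x => by
      have := conv_sub_left ((low hχ (q + 2)).memLp 2) ((low hχ (q - 1)).memLp 2)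
        (memLp_two_conv hm hg (band hχ q)) x
      rw [low_conv_band_of_lt hχ hm hg (by omega), low_conv_band_of_gt hχ hm hg (by omega),
        sub_zero] at this
      exact this)
  refine h1.trans ?_
  gcongr
  · exact hM.moment_sub_le q
  · have hd : fderiv ℝ F = ∑ m ∈ Finset.range n, fderiv ℝ (conv (band hχ (a + m)) g) := by
      ext1 x
      rw [hF, Finset.sum_apply, fderiv_sum fun m _ => ((hc m).differentiable one_ne_zero) x]
    rw [hd]
    refine (eLpNorm_sum_le (fun m _ =>
      ((hc m).continuous_fderiv one_ne_zero).aestronglyMeasurable) (by norm_num)).trans ?_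
    refine Finset.sum_le_sum fun m _ => (eLpNorm_fderiv_le_sum (hc m)).trans ?_
    refine (Finset.sum_le_sum fun i _ => hM.eLpNorm_fderiv_band_le (a + m) hm hg i).trans_eq ?_
    rw [Finset.sum_const, Finset.card_univ, Fintype.card_fin, nsmul_eq_mul]
    push_cast
    ring

omit hM in
theorem lam_inv_mul_lam (a : ℤ) {m n : ℕ} (hmn : m ≤ n) :
    (lam (a + n))⁻¹ * lam (a + m) = (1 / 2 : ℝ) ^ (n - m) := by
  have h : lam (a + n) = lam (a + m) * 2 ^ (n - m) := by
    rw [show a + (n:ℤ) = a + m + ((n - m : ℕ) : ℤ) by omega, lam_add]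
    simp [lam]
  have := lam_pos (a + m)
  rw [h, one_div, inv_pow]
  field_simp

theorem LowBounds.square_function_range {g : E3 → ℝ} (hm : Measurable g) (hg : MemLp g 2 volume)
    (a : ℤ) (N : ℕ) :
    eLpNorm (∑ m ∈ Finset.range N, conv (band hχ (a + m)) g) 3 volume ^ 2 ≤
      ENNReal.ofReal (4 * (1 + 72 * M.toReal ^ 2)) *
      ∑ m ∈ Finset.range N, eLpNorm (conv (band hχ (a + m)) g) 3 volume ^ 2 := by
  set f : ℕ → E3 → ℝ := fun m => conv (band hχ (a + m)) g with hf
  have hf3 : ∀ m, MemLp (f m) 3 volume := fun m => memLp_three_conv _ hm hg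
  have hfm : ∀ m, Measurable (f m) := fun m => measurable_conv_schwartz hm _
  set A : ℕ → ℝ := fun m => (eLpNorm (f m) 3 volume).toReal with hA
  set B : ℕ → ℝ := fun n => (eLpNorm (∑ m ∈ Finset.range n, f m) 3 volume).toReal with hB
  set σ : ℕ → ℝ := fun n => ∑ m ∈ Finset.range n, (1 / 2 : ℝ) ^ (n - m) * A m with hσ
  have hF3 : ∀ n, MemLp (∑ m ∈ Finset.range n, f m) 3 volume := fun n =>
    memLp_finsetSum' _ fun m _ => hf3 m
  have hA0 : ∀ n, 0 ≤ A n := fun n => ENNReal.toReal_nonneg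
  have hσ0 : ∀ n, 0 ≤ σ n := fun n => Finset.sum_nonneg fun m _ => by
    have := hA0 m; positivity
  have hFm : ∀ n, Measurable (∑ m ∈ Finset.range n, f m) := fun n => by
    rw [Finset.sum_fn]
    exact Finset.measurable_sum _ fun m _ => hfm m
  -- Here λ_{a+m}/λ_{a+n} = 2^{-(n-m)} turns the gradient sum into σ, and 72 = 2 · 3 · 12 collects
  -- the constants. The factor B n in the linear term gives the form required by
  -- `le_two_mul_sqrt_of_cube_le`.
  have key : ∀ n, B (n + 1) ^ 3 ≤ B n ^ 3 +
      3 * B n * (A n ^ 2 + 72 * M.toReal ^ 2 * (A n * σ n)) + A n ^ 3 := by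
    intro n
    have h1 := toReal_eLpNorm_add_cube_le (hFm n) (hfm n)
      (hF3 n) (hf3 n)
    rw [← Finset.sum_range_succ] at h1
    have h2 := hM.enorm_integral_partial_sum_le hm hg a n (F := ∑ m ∈ Finset.range n, f m) rfl
    have h3 := ENNReal.toReal_mono (by
      have h4 : ∀ m, eLpNorm (f m) 3 volume ≠ ⊤ := fun m => (hf3 m).2.ne
      have h5 := (hF3 n).2.ne
      have h6 := hM.ne_top
      refine ENNReal.mul_ne_top (ENNReal.mul_ne_top (ENNReal.mul_ne_top ?_ ?_) h5) (h4 n)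
      · finiteness
      · refine ENNReal.sum_ne_top.2 fun m _ => ?_
        have := h4 m
        simp only [hf] at this
        finiteness) h2
    rw [toReal_enorm, Real.norm_eq_abs] at h3
    have h7 : |∫ x, |(∑ m ∈ Finset.range n, f m) x| * (∑ m ∈ Finset.range n, f m) x * f n x|
        ≤ 72 * M.toReal ^ 2 * (A n * σ n) * B n := by
      refine h3.trans_eq ?_
      rw [ENNReal.toReal_mul, ENNReal.toReal_mul, ENNReal.toReal_mul, ENNReal.toReal_mul,
        ENNReal.toReal_mul, ENNReal.toReal_mul, ENNReal.toReal_sum, ENNReal.toReal_ofReal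
        (inv_nonneg.2 (lam_pos _).le), hσ]
      · simp only [ENNReal.toReal_mul, ENNReal.toReal_ofReal (lam_pos _).le, ENNReal.toReal_ofNat]
        have h8 : ∀ m ∈ Finset.range n, (1 / 2 : ℝ) ^ (n - m) * A m
            = (lam (a + n))⁻¹ * (lam (a + m) * A m) := fun m hm => by
          rw [← lam_inv_mul_lam a (Finset.mem_range.1 hm).le]; ring
        rw [Finset.sum_congr rfl h8, ← Finset.mul_sum]
        have h9 : ∑ m ∈ Finset.range n, 12 * M.toReal * lam (a + m) *
            (eLpNorm (conv (band hχ (a + m)) g) 3 volume).toReal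
            = 12 * M.toReal * ∑ m ∈ Finset.range n, lam (a + m) * A m := by
          rw [Finset.mul_sum]
          exact Finset.sum_congr rfl fun m _ => by simp only [hA, hf]; ring
        rw [h9]
        change _ * B n * A n = _
        ring
      · intro m _
        have := (hf3 m).2.ne
        have := hM.ne_top
        simp only [hf] at *
        finiteness
    change B (n + 1) ^ 3 ≤ B n ^ 3 + 3 * _ + 3 * (B n * A n ^ 2) + A n ^ 3 at h1
    linarith
  have hmain := le_two_mul_sqrt_of_cube_le (M := B) (a := A) (fun n => ENNReal.toReal_nonneg)
    (by simp [hB]) (fun n => by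
      have := mul_nonneg (hA0 n) (hσ0 n)
      have := mul_nonneg (sq_nonneg M.toReal) this
      show A n ^ 2 ≤ A n ^ 2 + 72 * M.toReal ^ 2 * (A n * σ n)
      linarith) key N
  have hsum : ∑ m ∈ Finset.range N, (A m ^ 2 + 72 * M.toReal ^ 2 * (A m * σ m))
      ≤ (1 + 72 * M.toReal ^ 2) * ∑ m ∈ Finset.range N, A m ^ 2 := by
    rw [Finset.sum_add_distrib, ← Finset.mul_sum, add_mul, one_mul]
    refine add_le_add_right (mul_le_mul_of_nonneg_left ?_ (by positivity)) _
    exact sum_mul_geometric_le A N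
  have hfin : B N ^ 2 ≤ 4 * (1 + 72 * M.toReal ^ 2) * ∑ m ∈ Finset.range N, A m ^ 2 := by
    have hT : 0 ≤ ∑ m ∈ Finset.range N, (A m ^ 2 + 72 * M.toReal ^ 2 * (A m * σ m)) :=
      Finset.sum_nonneg fun m _ => by
        have := mul_nonneg (hA0 m) (hσ0 m)
        positivity
    calc B N ^ 2 ≤ (2 * √(∑ m ∈ Finset.range N, (A m ^ 2 + 72 * M.toReal ^ 2 * (A m * σ m)))) ^ 2 :=
          pow_le_pow_left₀ ENNReal.toReal_nonneg hmain 2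
      _ = 4 * ∑ m ∈ Finset.range N, (A m ^ 2 + 72 * M.toReal ^ 2 * (A m * σ m)) := by
          rw [mul_pow, Real.sq_sqrt hT]; norm_num
      _ ≤ _ := by linarith
  have e1 : eLpNorm (∑ m ∈ Finset.range N, f m) 3 volume ^ 2 = ENNReal.ofReal (B N ^ 2) := by
    rw [ENNReal.ofReal_pow ENNReal.toReal_nonneg, ENNReal.ofReal_toReal (hF3 N).2.ne]
  have e2 : ∑ m ∈ Finset.range N, eLpNorm (f m) 3 volume ^ 2
      = ENNReal.ofReal (∑ m ∈ Finset.range N, A m ^ 2) := by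
    rw [ENNReal.ofReal_sum_of_nonneg fun m _ => sq_nonneg _]
    refine Finset.sum_congr rfl fun m _ => ?_
    rw [ENNReal.ofReal_pow ENNReal.toReal_nonneg, ENNReal.ofReal_toReal (hf3 m).2.ne]
  rw [e1, e2, ← ENNReal.ofReal_mul (by positivity)]
  exact ENNReal.ofReal_le_ofReal hfin

end LittlewoodPaley

namespace LittlewoodPaley

/-! ### Low-pass filters approximate the identity -/

variable {χ : E3 → ℝ} {hχ : IsCutoff χ} {M : ℝ≥0∞} (hM : LowBounds hχ M)

theorem sum_conv_band {g : E3 → ℝ} (hg : MemLp g 2 volume) (a : ℤ) (N : ℕ) :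
    ∑ m ∈ Finset.range N, conv (band hχ (a + m)) g
      = conv (low hχ (a + N)) g - conv (low hχ a) g := by
  induction N with
  | zero => simp
  | succ n ih =>
    rw [Finset.sum_range_succ, ih, conv_band hχ hg]
    push_cast
    rw [add_assoc]
    abel

theorem conv_low_sub_eq (s : ℤ) {ψ : E3 → ℝ} (hψ : MemLp ψ 2 volume) (x : E3) :
    conv (low hχ s) ψ x - ψ x = ∫ y, low hχ s y * (ψ (x - y) - ψ x) := by
  simp only [mul_sub]
  rw [integral_sub (integrable_conv hψ ((low hχ s).memLp 2) x)
    ((low hχ s).integrable.mul_const _), integral_mul_const, integral_low, one_mul, conv]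

include hM

/-- Average the difference quotients of ψ, each bounded in L² by ‖∇ψ‖₂, against the weight |y|
|k(y)|, whose mass is at most M/λ_s. -/
theorem LowBounds.eLpNorm_conv_low_sub_le (s : ℤ) {ψ : E3 → ℝ} (hψ : ContDiff ℝ 1 ψ)
    (hψ2 : MemLp ψ 2 volume) :
    eLpNorm (conv (low hχ s) ψ - ψ) 2 volume
      ≤ M * ENNReal.ofReal (lam s)⁻¹ * eLpNorm (fderiv ℝ ψ) 2 volume := by
  have hm := measurable_schwartz (low hχ s)
  have hk1 : eLpNorm (fun y => low hχ s y * ‖y‖) 1 volume ≤ M * ENNReal.ofReal (lam s)⁻¹ := by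
    rw [eLpNorm_one_eq_lintegral_enorm]
    simpa only [enorm_mul, enorm_norm] using hM.first_moment s
  refine (eLpNorm_le_lintegral_mul (g := conv (low hχ s) ψ - ψ)
    (k := fun y => low hχ s y * ‖y‖) (hm.mul measurable_norm)
    (ne_top_of_le_ne_top (by have := hM.ne_top; finiteness) hk1)
    (F := fun x y => ‖‖y‖⁻¹ * (ψ (x - y) - ψ x)‖ₑ) ?_ ?_ (p := 2) (by norm_num) (by norm_num)
    (N := eLpNorm (fderiv ℝ ψ) 2 volume) ?_).trans (mul_le_mul_left hk1 _)
  · have := hψ.continuous.measurable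
    exact ((measurable_snd.norm.inv).mul ((this.comp (measurable_fst.sub measurable_snd)).sub
      (this.comp measurable_fst))).enorm
  · intro x
    rw [Pi.sub_apply, conv_low_sub_eq s hψ2]
    refine (enorm_integral_le_lintegral_enorm _).trans_eq (lintegral_congr fun y => ?_)
    rw [← enorm_mul]
    congr 1
    -- At y = 0 the difference quotient is 0 by the convention 0⁻¹ = 0, and so is the increment.
    rcases eq_or_ne y 0 with rfl | hy
    · simp
    · have := norm_ne_zero_iff.2 hy
      field_simp
  · intro y
    rw [eLpNorm_enorm]
    have h1 := eLpNorm_const_smul (‖y‖⁻¹) (fun x => ψ (x - y) - ψ x) 2 (volume : Measure E3)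
    have h2 : eLpNorm (fun x => ψ (x - y) - ψ x) 2 volume
        ≤ ‖y‖ₑ * eLpNorm (fderiv ℝ ψ) 2 volume := by
      simpa [sub_eq_add_neg] using
        eLpNorm_translate_sub_le hψ (-y) (p := 2) (by norm_num) (by norm_num)
    refine h1.trans_le ((mul_le_mul_right h2 _).trans ?_)
    rw [← mul_assoc]
    refine mul_le_of_le_one_left' ?_
    rw [← enorm_norm y, ← enorm_mul]
    rcases eq_or_ne y 0 with rfl | hy
    · simp
    · rw [inv_mul_cancel₀ (norm_ne_zero_iff.2 hy)]
      simp

/-- Density of smooth compactly supported ψ: the error is at most (M + 1)‖g − ψ‖₂ plus a rate of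
order 1/λ_s for ψ. -/
theorem LowBounds.tendsto_conv_low {g : E3 → ℝ} (hm : Measurable g) (hg : MemLp g 2 volume)
    (a : ℤ) : Filter.Tendsto (fun n : ℕ => eLpNorm (conv (low hχ (a + n)) g - g) 2 volume)
      Filter.atTop (nhds 0) := by
  have hMt := hM.ne_top
  rw [ENNReal.tendsto_nhds_zero]
  intro ε hε
  -- The minimum with 1 gives a finite radius for the approximation even when ε = ∞.
  have hε' : min (ε / (2 * (M + 1))) 1 ≠ 0 := by
    refine (lt_min (pos_iff_ne_zero.2 ?_) one_pos).ne'
    exact ENNReal.div_ne_zero.2 ⟨hε.ne', by finiteness⟩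
  obtain ⟨ψ, hψc, hψs, hψ⟩ : ∃ ψ : E3 → ℝ, MemLp ψ 2 volume ∧ ContDiff ℝ 1 ψ ∧
      eLpNorm (g - ψ) 2 volume ≤ ε / (2 * (M + 1)) ∧ eLpNorm (fderiv ℝ ψ) 2 volume ≠ ⊤ := by
    have h1 : min (ε / (2 * (M + 1))) 1 ≠ ⊤ := ne_top_of_le_ne_top ENNReal.one_ne_top (min_le_right _ _)
    obtain ⟨ψ, hψc, hψs, hψ⟩ := hg.exist_eLpNorm_sub_le (by norm_num) (by norm_num)
      (ENNReal.toReal_pos hε' h1)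
    rw [ENNReal.ofReal_toReal h1] at hψ
    refine ⟨ψ, hψs.continuous.memLp_of_hasCompactSupport hψc, hψs.of_le (by exact_mod_cast le_top),
      hψ.trans (min_le_left _ _), ?_⟩
    exact ((hψs.continuous_fderiv (by simp)).memLp_of_hasCompactSupport
      (hψc.fderiv (𝕜 := ℝ))).eLpNorm_ne_top
  obtain ⟨hψ, hψd⟩ := hψ
  have hlim : Filter.Tendsto (fun n : ℕ => M * ENNReal.ofReal (lam (a + n))⁻¹ *
      eLpNorm (fderiv ℝ ψ) 2 volume) Filter.atTop (nhds 0) := by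
    have h1 : Filter.Tendsto (fun n : ℕ => (lam a)⁻¹ * (1 / 2 : ℝ) ^ n) Filter.atTop (nhds 0) := by
      simpa using (tendsto_pow_atTop_nhds_zero_of_lt_one (r := (1 / 2 : ℝ)) (by norm_num)
        (by norm_num)).const_mul (lam a)⁻¹
    have h2 := ENNReal.tendsto_ofReal h1
    have h3 := ENNReal.Tendsto.mul_const (ENNReal.Tendsto.const_mul h2 (Or.inr hMt))
      (Or.inr hψd)
    simp only [ENNReal.ofReal_zero, mul_zero, zero_mul] at h3
    refine h3.congr fun n => ?_
    rw [lam_add, mul_inv]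
    congr 4
    simp [lam]
  have hε2 : 0 < ε / 2 := ENNReal.half_pos hε.ne'
  filter_upwards [(ENNReal.tendsto_nhds_zero.1 hlim) (ε / 2) hε2] with n hn
  have hψm : Measurable ψ := hψs.continuous.measurable
  have e : conv (low hχ (a + n)) g - g
      = conv (low hχ (a + n)) (g - ψ) + (conv (low hχ (a + n)) ψ - ψ) - (g - ψ) := by
    ext x
    simp only [Pi.sub_apply, Pi.add_apply,
      conv_sub_right ((low hχ (a + n)).memLp 2) hg hψc]
    ring
  have m1 := (measurable_conv_schwartz (hm.sub hψm) (low hχ (a + n))).aestronglyMeasurable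
    (μ := volume)
  have m2 := ((measurable_conv_schwartz hψm (low hχ (a + n))).sub hψm).aestronglyMeasurable
    (μ := volume)
  have m3 := (hm.sub hψm).aestronglyMeasurable (μ := volume)
  calc eLpNorm (conv (low hχ (a + n)) g - g) 2 volume
      ≤ (eLpNorm (conv (low hχ (a + n)) (g - ψ)) 2 volume +
        eLpNorm (conv (low hχ (a + n)) ψ - ψ) 2 volume) + eLpNorm (g - ψ) 2 volume := by
        rw [e]
        exact (eLpNorm_sub_le (m1.add m2) m3 (by norm_num)).trans
          (add_le_add_left (eLpNorm_add_le m1 m2 (by norm_num)) _)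
    _ ≤ (M * eLpNorm (g - ψ) 2 volume + ε / 2) + eLpNorm (g - ψ) 2 volume := by
        gcongr
        · exact hM.eLpNorm_low_conv_le _ (hm.sub hψm) (by norm_num) (by norm_num)
        · exact (hM.eLpNorm_conv_low_sub_le _ hψs hψc).trans hn
    _ = (M + 1) * eLpNorm (g - ψ) 2 volume + ε / 2 := by ring
    _ ≤ (M + 1) * (ε / (2 * (M + 1))) + ε / 2 := by gcongr
    _ = ε := by
        rw [mul_comm 2, ENNReal.div_eq_inv_mul, ENNReal.mul_inv (Or.inl (by simp))
          (Or.inl (by finiteness)), ← mul_assoc, ← mul_assoc, ENNReal.mul_inv_cancel (by simp)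
          (by finiteness), one_mul, ← ENNReal.div_eq_inv_mul, ENNReal.add_halves]

/-- The high-frequency part of the square function estimate. -/
theorem LowBounds.square_function_tail {g : E3 → ℝ} (hm : Measurable g) (hg : MemLp g 2 volume)
    (a : ℤ) :
    eLpNorm (g - conv (low hχ a) g) 3 volume ^ 2 ≤
      ENNReal.ofReal (4 * (1 + 72 * M.toReal ^ 2)) *
      ∑' m : ℕ, eLpNorm (conv (band hχ (a + m)) g) 3 volume ^ 2 := by
  set K := ENNReal.ofReal (4 * (1 + 72 * M.toReal ^ 2)) *
      ∑' m : ℕ, eLpNorm (conv (band hχ (a + m)) g) 3 volume ^ 2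
  have hb : ∀ N : ℕ, eLpNorm (conv (low hχ (a + N)) g - conv (low hχ a) g) 3 volume
      ≤ K ^ (1 / 2 : ℝ) := by
    intro N
    have h := hM.square_function_range hm hg a N
    rw [sum_conv_band hg] at h
    rw [one_div, ENNReal.le_rpow_inv_iff (by norm_num), show (2:ℝ) = (2:ℕ) by norm_num,
      ENNReal.rpow_natCast]
    exact h.trans (mul_le_mul_right (ENNReal.sum_le_tsum _) _)
  have hms : ∀ n : ℕ, AEStronglyMeasurable (conv (low hχ (a + n)) g) volume := fun n =>
    (measurable_conv_schwartz hm _).aestronglyMeasurable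
  -- It is not known that g lies in L³. Convergence in L² gives a subsequence converging almost
  -- everywhere, and Fatou carries the uniform L³ bound to the limit, also when that bound is
  -- infinite.
  obtain ⟨ns, -, hns⟩ := (tendstoInMeasure_of_tendsto_eLpNorm (p := 2) (by norm_num) hms
    hm.aestronglyMeasurable (hM.tendsto_conv_low hm hg a)).exists_seq_tendsto_ae
  have hle := Lp.eLpNorm_lim_le_liminf_eLpNorm (p := 3)
    (f := fun n : ℕ => conv (low hχ (a + ns n)) g - conv (low hχ a) g)
    (fun n => (hms (ns n)).sub (measurable_conv_schwartz hm _).aestronglyMeasurable)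
    (g - conv (low hχ a) g) (by
      filter_upwards [hns] with x hx
      exact hx.sub_const _)
  have h2 : eLpNorm (g - conv (low hχ a) g) 3 volume ≤ K ^ (1 / 2 : ℝ) := by
    refine hle.trans (Filter.liminf_le_of_frequently_le' ?_)
    exact Filter.Frequently.of_forall fun n => hb (ns n)
  rw [one_div, ENNReal.le_rpow_inv_iff (by norm_num), show (2:ℝ) = (2:ℕ) by norm_num,
      ENNReal.rpow_natCast] at h2
  exact h2

end LittlewoodPaley

namespace LittlewoodPaley

/-! ### Blocks and shells as convolutions -/

section Blocks

variable {χ : E3 → ℝ} (hχ : IsCutoff χ)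

/-- The kernel of `Δ_q`. -/
noncomputable def blockKernel (q : ℤ) : SchwartzMap E3 ℝ :=
  if 0 ≤ q then band hχ q else if q = -1 then low hχ 0 else 0

theorem block_eq_integral {F : Type*} [NormedAddCommGroup F] [NormedSpace ℝ F] (q : ℤ)
    (f : E3 → F) (x : E3) : block χ q f x = ∫ y, blockKernel hχ q y • f (x - y) := by
  unfold block blockKernel
  split_ifs
  · rw [← integral_smul]
    simp only [smul_smul, annulus_kernel hχ]
  · simp only [low_zero]
  · simp

theorem shell_eq_integral {F : Type*} [NormedAddCommGroup F] [NormedSpace ℝ F] (Q₀ Q₁ : ℤ)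
    {f : E3 → F} (x : E3)
    (hf : ∀ k : SchwartzMap E3 ℝ, Integrable (fun y => k y • f (x - y)) volume) :
    shell χ Q₀ Q₁ f x = ∫ y, (∑ q ∈ Finset.Icc Q₀ Q₁, blockKernel hχ q) y • f (x - y) := by
  simp only [shell, block_eq_integral hχ, sum_apply, Finset.sum_smul]
  rw [integral_finsetSum _ fun q _ => hf _]

theorem sum_blockKernel {Q₀ Q₁ : ℤ} (h0 : 0 ≤ Q₀) (h : Q₀ ≤ Q₁) :
    ∑ q ∈ Finset.Icc Q₀ Q₁, blockKernel hχ q = low hχ (Q₁ + 1) - low hχ Q₀ := by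
  induction Q₁, h using Int.leInduction with
  | base => simp [blockKernel, h0, band]
  | succ n hn ih =>
    have : Finset.Icc Q₀ (n + 1) = insert (n + 1) (Finset.Icc Q₀ n) := by
      ext; simp; omega
    rw [this, Finset.sum_insert (by simp), ih, blockKernel, if_pos (by omega), band]
    abel

/-- Starting at −1 the telescoping sum has no lower endpoint, as Δ_{-1} is P_0 itself. The resulting
kernel has integral one, unlike the one for Q₀ ≥ 0. -/
theorem sum_blockKernel_neg_one {Q₁ : ℤ} (h : -1 ≤ Q₁) :
    ∑ q ∈ Finset.Icc (-1) Q₁, blockKernel hχ q = low hχ (Q₁ + 1) := by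
  induction Q₁, h using Int.leInduction with
  | base => simp [blockKernel]
  | succ n hn ih =>
    have : Finset.Icc (-1) (n + 1) = insert (n + 1) (Finset.Icc (-1) n) := by
      ext; simp; omega
    rw [this, Finset.sum_insert (by simp), ih, blockKernel, if_pos (by omega), band]
    abel

theorem integrable_smul_of_memLp {F : Type*} [NormedAddCommGroup F] [NormedSpace ℝ F]
    {u : E3 → F} (hu : MemLp u 2 volume) (k : SchwartzMap E3 ℝ) (x : E3) :
    Integrable (fun y => k y • u (x - y)) volume := by
  rw [← memLp_one_iff_integrable]
  exact (hu.comp_measurePreserving (Measure.measurePreserving_sub_left volume x)).smul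
    (k.memLp 2 volume) (p := 2) (q := 2)

theorem integral_smul_apply {u : E3 → E3} (hu : MemLp u 2 volume) (k : SchwartzMap E3 ℝ) (x : E3)
    (j : Fin 3) : (∫ y, k y • u (x - y)) j = conv k (fun z => u z j) x := by
  have h := (EuclideanSpace.proj j : E3 →L[ℝ] ℝ).integral_comp_comm
    (integrable_smul_of_memLp hu k x)
  simpa [conv] using h.symm

theorem memLp_component {u : E3 → E3} {p : ℝ≥0∞} (hu : MemLp u p volume) (j : Fin 3) :
    MemLp (fun z => u z j) p volume :=
  hu.of_le (((EuclideanSpace.proj j : E3 →L[ℝ] ℝ).continuous).comp_aestronglyMeasurable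
    hu.1) (Filter.Eventually.of_forall fun x => PiLp.norm_apply_le (u x) j)

theorem measurable_component {u : E3 → E3} (hu : Measurable u) (j : Fin 3) :
    Measurable fun z => u z j :=
  (EuclideanSpace.proj j : E3 →L[ℝ] ℝ).continuous.measurable.comp hu

theorem eLpNorm_component_le {u : E3 → E3} (hu : MemLp u 2 volume) (q : ℤ) (j : Fin 3) :
    eLpNorm (conv (blockKernel hχ q) fun z => u z j) 3 volume
      ≤ eLpNorm (block χ q u) 3 volume := by
  refine eLpNorm_mono fun x => ?_
  rw [← integral_smul_apply hu, block_eq_integral hχ]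
  exact PiLp.norm_apply_le _ j

end Blocks

/-! ### Consequences for the localized sum -/

theorem lam_sub (p q : ℤ) : lam (p - q) = lam p / lam q := by
  unfold lam; exact zpow_sub₀ two_ne_zero p q

/-- Here K(Q − q) λ_q^{2/3} loses its dependence on q: above Q the localized sum is a plain sum of
squares. -/
theorem locKernel_mul_of_ge {Q q : ℤ} (h : Q ≤ q) :
    locKernel (Q - q) * (lam q ^ (1 / 3 : ℝ)) ^ 2 = lam Q ^ (2 / 3 : ℝ) := by
  have hQ := lam_pos Q
  have hq := lam_pos q
  rw [locKernel, if_pos (by omega), lam_sub, Real.div_rpow hQ.le hq.le, ← Real.rpow_natCast,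
    ← Real.rpow_mul hq.le]
  norm_num
  have : 0 < lam q ^ (2 / 3 : ℝ) := by positivity
  field_simp

/-- Below Q the weight is λ_q², that of a gradient. At q = Q the two forms agree. -/
theorem locKernel_mul_of_le {Q q : ℤ} (h : q ≤ Q) :
    locKernel (Q - q) * (lam q ^ (1 / 3 : ℝ)) ^ 2 = lam Q ^ (-4 / 3 : ℝ) * lam q ^ 2 := by
  have hQ := lam_pos Q
  have hq := lam_pos q
  rcases h.eq_or_lt with rfl | h
  · rw [locKernel_mul_of_ge le_rfl, ← Real.rpow_natCast (lam q), ← Real.rpow_add hq]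
    norm_num
  · rw [locKernel, if_neg (by omega), lam_sub, Real.div_rpow hQ.le hq.le, ← Real.rpow_natCast,
      ← Real.rpow_mul hq.le, ← Real.rpow_natCast (lam q), div_mul_eq_mul_div, mul_div_assoc,
      ← Real.rpow_sub hq]
    norm_num

theorem locKernel_nonneg (q : ℤ) : 0 ≤ locKernel q := by
  unfold locKernel
  have := lam_pos q
  split_ifs <;> positivity

theorem tsum_le_locSum (χ : E3 → ℝ) (u : E3 → E3) (Q : ℤ) {a : ℤ} (ha : -1 ≤ a) :
    ∑' m : ℕ, ENNReal.ofReal (locKernel (Q - (a + m)) * (lam (a + m) ^ (1 / 3 : ℝ)) ^ 2) *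
      eLpNorm (block χ (a + m) u) 3 volume ^ 2 ≤ locSum χ u Q := by
  have hinj : Function.Injective fun m : ℕ => (⟨a + m, by omega⟩ : {q : ℤ // -1 ≤ q}) := by
    intro m n h
    simpa using h
  refine le_trans (le_of_eq ?_) (ENNReal.tsum_comp_le_tsum_of_injective hinj
    fun q : {q : ℤ // -1 ≤ q} => ENNReal.ofReal (locKernel (Q - q)) * amp χ u q ^ 2)
  refine tsum_congr fun m => ?_
  have := lam_pos (a + m)
  rw [amp, mul_pow, ← mul_assoc, ENNReal.ofReal_mul (locKernel_nonneg _),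
    ENNReal.ofReal_pow (by positivity)]

section Scale

variable {χ : E3 → ℝ} {hχ : IsCutoff χ} {M : ℝ≥0∞} (hM : LowBounds hχ M)
  {u : E3 → E3} (hm : Measurable u) (hu : MemLp u 2 volume)
include hu

theorem tsum_band_le_locSum (j : Fin 3) {Q a : ℤ} (ha : 0 ≤ a) (hQa : Q ≤ a) :
    ENNReal.ofReal (lam Q ^ (2 / 3 : ℝ)) *
      ∑' m : ℕ, eLpNorm (conv (band hχ (a + m)) fun z => u z j) 3 volume ^ 2
      ≤ locSum χ u Q := by
  refine le_trans ?_ (tsum_le_locSum χ u Q (by omega : -1 ≤ a))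
  rw [← ENNReal.tsum_mul_left]
  refine ENNReal.tsum_le_tsum fun m => ?_
  rw [locKernel_mul_of_ge (by omega)]
  have h := eLpNorm_component_le hχ hu (a + m) j
  rw [blockKernel, if_pos (by omega)] at h
  gcongr

theorem sum_band_le_locSum (j : Fin 3) {Q : ℤ} {n : ℕ} (hn : Q + 1 = n) :
    ENNReal.ofReal (lam Q ^ (-4 / 3 : ℝ)) *
      ((ENNReal.ofReal (lam (-1)) * eLpNorm (conv (low hχ 0) fun z => u z j) 3 volume) ^ 2 +
      ∑ m ∈ Finset.range n, (ENNReal.ofReal (lam m) *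
        eLpNorm (conv (band hχ m) fun z => u z j) 3 volume) ^ 2) ≤ locSum χ u Q := by
  have hc : 0 ≤ lam Q ^ (-4 / 3 : ℝ) := by have := lam_pos Q; positivity
  refine le_trans ?_ (tsum_le_locSum χ u Q (le_refl (-1)))
  refine le_trans ?_ (ENNReal.sum_le_tsum (Finset.range (n + 1)))
  rw [Finset.sum_range_succ', mul_add, add_comm, Finset.mul_sum]
  refine add_le_add (Finset.sum_le_sum fun m hmn => ?_) ?_
  · rw [Finset.mem_range] at hmn
    have e : (-1 : ℤ) + ((m + 1 : ℕ) : ℤ) = m := by push_cast; ring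
    have h := eLpNorm_component_le hχ hu (m : ℤ) j
    rw [blockKernel, if_pos (by omega)] at h
    rw [e, locKernel_mul_of_le (by omega), ENNReal.ofReal_mul hc, ENNReal.ofReal_pow (lam_pos _).le,
      mul_pow, mul_assoc]
    gcongr
  · have h := eLpNorm_component_le hχ hu (-1) j
    rw [blockKernel, if_neg (by omega), if_pos rfl] at h
    have e : (-1 : ℤ) + ((0 : ℕ) : ℤ) = -1 := by simp
    rw [e, locKernel_mul_of_le (by omega), ENNReal.ofReal_mul hc, ENNReal.ofReal_pow (lam_pos _).le,
      mul_pow, mul_assoc]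
    gcongr

include hM hm

/-- The square function estimate is applied to a derivative of u rather than to u: ∂_i P_{Q+1}u is
P_0 plus the blocks 0, …, Q of ∂_i u, and Bernstein gives each its factor λ_m. -/
theorem LowBounds.gradient_low_le (i j : Fin 3) {Q : ℤ} {n : ℕ} (hn : Q + 1 = n) :
    eLpNorm (conv (dir (stdv i) (low hχ (Q + 1))) fun z => u z j) 3 volume ^ 2 ≤
      32 * M ^ 2 * (1 + ENNReal.ofReal (4 * (1 + 72 * M.toReal ^ 2))) *
      ((ENNReal.ofReal (lam (-1)) * eLpNorm (conv (low hχ 0) fun z => u z j) 3 volume) ^ 2 +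
      ∑ m ∈ Finset.range n, (ENNReal.ofReal (lam m) *
        eLpNorm (conv (band hχ m) fun z => u z j) 3 volume) ^ 2) := by
  set f : E3 → ℝ := fun z => u z j
  have hfm : Measurable f := measurable_component hm j
  have hf : MemLp f 2 volume := memLp_component hu j
  -- Since ∂_i u need not be a function, it is replaced by ∂_i P_{Q+2}u, which lies in L² and has
  -- the same image under P_s for all s ≤ Q + 1.
  set g : E3 → ℝ := conv (dir (stdv i) (low hχ (Q + 2))) f with hg
  have hgm : Measurable g := measurable_conv_schwartz hfm _
  have hg2 : MemLp g 2 volume := memLp_two_conv hfm hf _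
  have hlow : ∀ s : ℤ, s < Q + 2 → conv (low hχ s) g = conv (dir (stdv i) (low hχ s)) f :=
    fun s hs => low_conv_dir_low_of_gt hχ hfm hf _ hs
  have hband : ∀ m ∈ Finset.range n, conv (band hχ (0 + m)) g
      = fun x => fderiv ℝ (conv (band hχ m) f) x (stdv i) := by
    intro m hmn
    rw [Finset.mem_range] at hmn
    ext x
    rw [zero_add, conv_band hχ hg2, hlow _ (by omega), hlow _ (by omega), Pi.sub_apply,
      conv_band hχ hf, fderiv_sub ((contDiff_conv _ hf).differentiable (by simp) x)
        ((contDiff_conv _ hf).differentiable (by simp) x), sub_apply, fderiv_conv_apply _ hf,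
      fderiv_conv_apply _ hf]
  have hsq := hM.square_function_range hgm hg2 0 n
  have hsum := sum_conv_band (hχ := hχ) hg2 0 n
  rw [zero_add, ← hn] at hsum
  have e : conv (dir (stdv i) (low hχ (Q + 1))) f
      = conv (low hχ 0) g + ∑ m ∈ Finset.range n, conv (band hχ (0 + m)) g := by
    rw [hsum, hlow (Q + 1) (by omega)]; abel
  have h0 : eLpNorm (conv (low hχ 0) g) 3 volume
      ≤ 4 * M * (ENNReal.ofReal (lam (-1)) * eLpNorm (conv (low hχ 0) f) 3 volume) := by
    rw [hlow 0 (by omega), ← dir_low_conv_low_of_lt hχ hfm hf (stdv i) (by omega : (0:ℤ) < 1)]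
    refine (hM.eLpNorm_dir_low_conv_le 1 i (measurable_conv_schwartz hfm _)).trans_eq ?_
    have : lam 1 = 4 * lam (-1) := by simp only [lam]; norm_num
    rw [this, ENNReal.ofReal_mul (by norm_num), ENNReal.ofReal_ofNat]
    ring
  have h1 : ∀ m ∈ Finset.range n, eLpNorm (conv (band hχ (0 + m)) g) 3 volume
      ≤ 4 * M * (ENNReal.ofReal (lam m) * eLpNorm (conv (band hχ m) f) 3 volume) := by
    intro m hmn
    rw [hband m hmn]
    exact (hM.eLpNorm_fderiv_band_le m hfm hf i).trans_eq (by ring)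
  set K := ENNReal.ofReal (4 * (1 + 72 * M.toReal ^ 2))
  set A := ENNReal.ofReal (lam (-1)) * eLpNorm (conv (low hχ 0) f) 3 volume
  set B := ∑ m ∈ Finset.range n, (ENNReal.ofReal (lam m) *
        eLpNorm (conv (band hχ m) f) 3 volume) ^ 2 with hB
  have hsm : Measurable (∑ m ∈ Finset.range n, conv (band hχ (0 + m)) g) := by
    rw [Finset.sum_fn]
    exact Finset.measurable_sum _ fun m _ => measurable_conv_schwartz hgm _
  have h2 : eLpNorm (∑ m ∈ Finset.range n, conv (band hχ (0 + m)) g) 3 volume ^ 2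
      ≤ K * (16 * M ^ 2 * B) := by
    refine hsq.trans ?_
    gcongr
    rw [hB, Finset.mul_sum]
    refine Finset.sum_le_sum fun m hmn => (pow_le_pow_left' (h1 m hmn) 2).trans_eq ?_
    ring
  have h3 : ∀ a b : ℝ≥0∞, (a + b) ^ 2 ≤ 2 * (a ^ 2 + b ^ 2) := by
    intro a b
    have := ENNReal.rpow_add_le_mul_rpow_add_rpow a b (p := 2) (by norm_num)
    norm_num at this
    exact this
  calc _ ≤ (eLpNorm (conv (low hχ 0) g) 3 volume +
        eLpNorm (∑ m ∈ Finset.range n, conv (band hχ (0 + m)) g) 3 volume) ^ 2 := by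
        rw [e]
        gcongr
        exact eLpNorm_add_le (measurable_conv_schwartz hgm _).aestronglyMeasurable
          hsm.aestronglyMeasurable (by norm_num)
    _ ≤ 2 * (eLpNorm (conv (low hχ 0) g) 3 volume ^ 2 +
        eLpNorm (∑ m ∈ Finset.range n, conv (band hχ (0 + m)) g) 3 volume ^ 2) := h3 _ _
    _ ≤ 2 * ((4 * M * A) ^ 2 + K * (16 * M ^ 2 * B)) := by gcongr
    _ = 32 * M ^ 2 * (A ^ 2 + K * B) := by ring
    _ ≤ 32 * M ^ 2 * ((1 + K) * A ^ 2 + (1 + K) * B) := by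
        gcongr
        · exact le_mul_of_one_le_left' le_self_add
        · exact le_add_self
    _ = _ := by ring

end Scale

end LittlewoodPaley

namespace LittlewoodPaley

/-! ### Normalized bounds at a dyadic scale -/

theorem le_mul_rpow_of_sq_le {a c X : ℝ≥0∞} {s : ℝ} (hs : 0 < s)
    (h : ENNReal.ofReal (s ^ 2) * a ^ 2 ≤ c ^ 2 * X) :
    a ≤ c * ENNReal.ofReal s⁻¹ * X ^ (1 / 2 : ℝ) := by
  have h0 : ENNReal.ofReal s ≠ 0 := by simpa using hs
  have h1 : a ^ 2 ≤ (c * ENNReal.ofReal s⁻¹ * X ^ (1 / 2 : ℝ)) ^ 2 := by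
    have hX : (X ^ (1 / 2 : ℝ)) ^ 2 = X := by
      rw [← ENNReal.rpow_natCast, ← ENNReal.rpow_mul]; norm_num
    rw [mul_pow, mul_pow, hX, ENNReal.ofReal_inv_of_pos hs]
    calc a ^ 2 = (ENNReal.ofReal s)⁻¹ ^ 2 * (ENNReal.ofReal (s ^ 2) * a ^ 2) := by
          rw [ENNReal.ofReal_pow hs.le, ← mul_assoc, ← mul_pow,
            ENNReal.inv_mul_cancel h0 ENNReal.ofReal_ne_top, one_pow, one_mul]
      _ ≤ (ENNReal.ofReal s)⁻¹ ^ 2 * (c ^ 2 * X) := by gcongr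
      _ = _ := by ring
  by_contra hlt
  push Not at hlt
  exact absurd h1 (not_le.2 (ENNReal.pow_lt_pow_left two_ne_zero hlt))

/-- Bounds, at the scale `λ_Q`, for the high-frequency part of `u`, for the gradient of its
low-frequency part and for its block `Δ_Q u`. -/
structure ScaleBounds {χ : E3 → ℝ} (hχ : IsCutoff χ) (u : E3 → E3) (Q : ℤ) (W : ℝ≥0∞) : Prop where
  high : ∀ j, eLpNorm ((fun z => u z j) - conv (low hχ (Q + 1)) fun z => u z j) 3 volume ≤ W
  grad : ∀ i j, eLpNorm (conv (dir (stdv i) (low hχ (Q + 1))) fun z => u z j) 3 volume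
    ≤ W * ENNReal.ofReal (lam Q)
  band : 0 ≤ Q → ∀ j, eLpNorm (conv (band hχ Q) fun z => u z j) 3 volume ≤ W
  grad_band : 0 ≤ Q → ∀ i j, eLpNorm (conv (dir (stdv i) (LittlewoodPaley.band hχ Q))
    fun z => u z j) 3 volume ≤ W * ENNReal.ofReal (lam Q)

theorem LowBounds.exists_scaleBounds {χ : E3 → ℝ} {hχ : IsCutoff χ} {M : ℝ≥0∞}
    (hM : LowBounds hχ M) : ∃ c : ℝ≥0∞, c ≠ ⊤ ∧ ∀ u : E3 → E3, Measurable u → MemLp u 2 volume →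
      ∀ Q : ℤ, -1 ≤ Q → ScaleBounds hχ u Q
        (c * ENNReal.ofReal (lam Q ^ (-1 / 3 : ℝ)) * locSum χ u Q ^ (1 / 2 : ℝ)) := by
  set K := ENNReal.ofReal (4 * (1 + 72 * M.toReal ^ 2)) with hK
  set L := 32 * M ^ 2 * (1 + K) with hL
  -- Chosen so that b² dominates both squared constants K and L. The final factor 1 + 4M leaves room
  -- for Bernstein in the gradient of Δ_Q u.
  set b := 1 + K + L with hb
  have hMt := hM.ne_top
  have hb1 : 1 ≤ b := le_self_add.trans le_self_add
  have hbb : b ≤ b ^ 2 := le_self_pow hb1 two_ne_zero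
  have hKb : K ≤ b ^ 2 := (le_add_self.trans le_self_add).trans hbb
  have hLb : L ≤ b ^ 2 := le_add_self.trans hbb
  refine ⟨(1 + 4 * M) * b, by finiteness, fun u hm hu Q hQ => ?_⟩
  have hq := lam_pos Q
  set s := lam Q ^ (1 / 3 : ℝ) with hs
  have hs0 : 0 < s := by positivity
  have hs2 : s ^ 2 = lam Q ^ (2 / 3 : ℝ) := by
    rw [hs, ← Real.rpow_natCast, ← Real.rpow_mul hq.le]; norm_num
  have hsi : s⁻¹ = lam Q ^ (-1 / 3 : ℝ) := by
    rw [hs, ← Real.rpow_neg hq.le]; norm_num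
  set r := lam Q ^ (-2 / 3 : ℝ) with hr
  have hr0 : 0 < r := by positivity
  have hr2 : r ^ 2 = lam Q ^ (-4 / 3 : ℝ) := by
    rw [hr, ← Real.rpow_natCast, ← Real.rpow_mul hq.le]; norm_num
  have hri : r⁻¹ = lam Q ^ (-1 / 3 : ℝ) * lam Q := by
    nth_rewrite 2 [← Real.rpow_one (lam Q)]
    rw [hr, ← Real.rpow_neg hq.le, ← Real.rpow_add hq]; norm_num
  set X := locSum χ u Q
  set W := b * ENNReal.ofReal (lam Q ^ (-1 / 3 : ℝ)) * X ^ (1 / 2 : ℝ) with hW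
  have hWc : (1 + 4 * M) * b * ENNReal.ofReal (lam Q ^ (-1 / 3 : ℝ)) * X ^ (1 / 2 : ℝ)
      = (1 + 4 * M) * W := by rw [hW]; ring
  rw [hWc]
  have hWW : W ≤ (1 + 4 * M) * W := le_mul_of_one_le_left' le_self_add
  have hband : 0 ≤ Q → ∀ j, eLpNorm (conv (band hχ Q) fun z => u z j) 3 volume ≤ W := by
    intro hQ0 j
    rw [hW, ← hsi]
    refine le_mul_rpow_of_sq_le hs0 ?_
    rw [hs2]
    have h := tsum_band_le_locSum (hχ := hχ) hu j hQ0 le_rfl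
    refine le_trans ?_ (h.trans (le_mul_of_one_le_left' (one_le_pow_of_one_le' hb1 2)))
    gcongr
    refine le_trans (le_of_eq ?_) (ENNReal.le_tsum 0)
    simp
  refine ⟨fun j => ?_, fun i j => ?_, fun hQ0 j => (hband hQ0 j).trans hWW, fun hQ0 i j => ?_⟩
  · refine le_trans ?_ hWW
    rw [hW, ← hsi]
    refine le_mul_rpow_of_sq_le hs0 ?_
    rw [hs2]
    have h1 := hM.square_function_tail (measurable_component hm j) (memLp_component hu j) (Q + 1)
    have h2 := tsum_band_le_locSum (hχ := hχ) hu j (by omega : 0 ≤ Q + 1) (by omega : Q ≤ Q + 1)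
    calc _ ≤ ENNReal.ofReal (lam Q ^ (2 / 3 : ℝ)) * (K * _) := mul_le_mul_right h1 _
      _ = K * (ENNReal.ofReal (lam Q ^ (2 / 3 : ℝ)) * _) := by ring
      _ ≤ b ^ 2 * X := mul_le_mul' hKb h2
  · refine le_trans ?_ (mul_le_mul_left hWW _)
    have e : W * ENNReal.ofReal (lam Q) = b * ENNReal.ofReal r⁻¹ * X ^ (1 / 2 : ℝ) := by
      rw [hW, hri, ENNReal.ofReal_mul (by positivity)]; ring
    rw [e]
    refine le_mul_rpow_of_sq_le hr0 ?_
    rw [hr2]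
    obtain ⟨n, hn⟩ := Int.eq_ofNat_of_zero_le (by omega : 0 ≤ Q + 1)
    have h1 := hM.gradient_low_le hm hu i j hn
    have h2 := sum_band_le_locSum (hχ := hχ) hu j hn
    calc _ ≤ ENNReal.ofReal (lam Q ^ (-4 / 3 : ℝ)) * (L * _) := mul_le_mul_right h1 _
      _ = L * (ENNReal.ofReal (lam Q ^ (-4 / 3 : ℝ)) * _) := by ring
      _ ≤ b ^ 2 * X := mul_le_mul' hLb h2
  · have h := hM.eLpNorm_fderiv_band_le Q (measurable_component hm j) (memLp_component hu j) i
    simp only [fderiv_conv_apply _ (memLp_component hu j)] at h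
    calc _ ≤ 4 * M * ENNReal.ofReal (lam Q) * W := h.trans (mul_le_mul_right (hband hQ0 j) _)
      _ = (4 * M) * W * ENNReal.ofReal (lam Q) := by ring
      _ ≤ _ := by gcongr; exact le_add_self

/-! ### Divergence-free fields -/

/-- Test functions with ψ and ∇ψ in L² are reached by cutting off with χ(x/(n+1)). The commutator
term carries the factor 1/(n+1) and is dominated by |ψ||u|, so dominated convergence applies. The
frequency cutoff χ doubles as a spatial one. -/
theorem integral_fderiv_apply_eq_zero {χ : E3 → ℝ} (hχ : IsCutoff χ) {u : E3 → E3}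
    (hu : MemLp u 2 volume) (hdiv : DivergenceFree u) {ψ : E3 → ℝ} (hψ : ContDiff ℝ ∞ ψ)
    (hψ2 : MemLp ψ 2 volume) (hψd : MemLp (fderiv ℝ ψ) 2 volume) :
    ∫ x, fderiv ℝ ψ x (u x) = 0 := by
  have hs : HasCompactSupport χ := by
    have := (hχ.isSymbol 0).compact
    rwa [lowSymbol_zero] at this
  have hsd : HasCompactSupport (fderiv ℝ χ) := hs.fderiv (𝕜 := ℝ)
  have hcd : Continuous (fderiv ℝ χ) := hχ.smooth.continuous_fderiv (by simp)
  obtain ⟨B, hB⟩ := hχ.smooth.continuous.bounded_above_of_compact_support hs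
  obtain ⟨D, hD⟩ := hcd.bounded_above_of_compact_support hsd
  have hB0 : 0 ≤ B := (norm_nonneg _).trans (hB 0)
  have hD0 : 0 ≤ D := (norm_nonneg _).trans (hD 0)
  set r : ℕ → ℝ := fun n => ((n : ℝ) + 1)⁻¹ with hr
  have hr0 : ∀ n, 0 < r n := fun n => by simp only [hr]; positivity
  have hr1 : ∀ n, r n ≤ 1 := fun n => inv_le_one_of_one_le₀ (by simp)
  have hrl : Filter.Tendsto r Filter.atTop (nhds 0) :=
    tendsto_one_div_add_atTop_nhds_zero_nat.congr fun n => by simp [hr]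
  have hη : ∀ n x, HasFDerivAt (fun x => χ (r n • x)) (r n • fderiv ℝ χ (r n • x)) x := by
    intro n x
    have h1 : DifferentiableAt ℝ (fun x => χ (r n • x)) x :=
      (hχ.smooth.differentiable (by simp)).comp (by fun_prop : Differentiable ℝ fun x : E3 => r n • x) x
    have := h1.hasFDerivAt
    rwa [fderiv_comp_smul] at this
  have hfd : ∀ n x, fderiv ℝ (fun x => χ (r n • x) * ψ x) x (u x)
      = χ (r n • x) * fderiv ℝ ψ x (u x) + r n * (ψ x * fderiv ℝ χ (r n • x) (u x)) := by
    intro n x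
    rw [((hη n x).fun_mul (hψ.differentiable (by simp) x).hasFDerivAt).fderiv]
    simp only [add_apply, smul_apply, smul_eq_mul]
    ring
  have hzero : ∀ n, ∫ x, fderiv ℝ (fun x => χ (r n • x) * ψ x) x (u x) = 0 := by
    intro n
    refine hdiv _ ((hχ.smooth.comp (contDiff_const_smul _)).mul hψ) ?_
    exact (hs.comp_smul (hr0 n).ne').mul_right
  have h2 : Integrable (fun x => ‖fderiv ℝ ψ x‖ * ‖u x‖) volume :=
    hψd.norm.integrable_mul hu.norm
  have h3 : Integrable (fun x => ‖ψ x‖ * ‖u x‖) volume := hψ2.norm.integrable_mul hu.norm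
  have hcψ : Continuous (fderiv ℝ ψ) := hψ.continuous_fderiv (by simp)
  have hlim := tendsto_integral_of_dominated_convergence (μ := volume)
    (F := fun n x => fderiv ℝ (fun x => χ (r n • x) * ψ x) x (u x))
    (f := fun x => fderiv ℝ ψ x (u x))
    (bound := fun x => B * (‖fderiv ℝ ψ x‖ * ‖u x‖) + D * (‖ψ x‖ * ‖u x‖))
    (fun n => by
      simp only [hfd]
      have c1 : Continuous fun x : E3 => χ (r n • x) :=
        hχ.smooth.continuous.comp (continuous_const_smul _)
      have c2 : Continuous fun x : E3 => fderiv ℝ χ (r n • x) :=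
        hcd.comp (continuous_const_smul _)
      have a1 : AEStronglyMeasurable (fun x => fderiv ℝ ψ x (u x)) volume :=
        isBoundedBilinearMap_apply.continuous.comp_aestronglyMeasurable
          (hcψ.aestronglyMeasurable.prodMk hu.1)
      have a2 : AEStronglyMeasurable (fun x => fderiv ℝ χ (r n • x) (u x)) volume :=
        isBoundedBilinearMap_apply.continuous.comp_aestronglyMeasurable
          (c2.aestronglyMeasurable.prodMk hu.1)
      exact (c1.aestronglyMeasurable.mul a1).add
        ((hψ.continuous.aestronglyMeasurable.mul a2).const_mul _))
    ((h2.const_mul B).add (h3.const_mul D))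
    (fun n => Filter.Eventually.of_forall fun x => by
      rw [hfd]
      refine (norm_add_le _ _).trans (add_le_add ?_ ?_)
      · rw [norm_mul]
        exact mul_le_mul (hB _) (ContinuousLinearMap.le_opNorm _ _) (norm_nonneg _) hB0
      · rw [norm_mul, norm_mul, Real.norm_of_nonneg (hr0 n).le]
        have h4 : ‖fderiv ℝ χ (r n • x) (u x)‖ ≤ D * ‖u x‖ :=
          (ContinuousLinearMap.le_opNorm _ _).trans (by gcongr; exact hD _)
        calc r n * (‖ψ x‖ * ‖fderiv ℝ χ (r n • x) (u x)‖)
            ≤ 1 * (‖ψ x‖ * (D * ‖u x‖)) := by gcongr; exact hr1 n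
          _ = _ := by ring)
    (Filter.Eventually.of_forall fun x => by
      simp only [hfd]
      have t0 : Filter.Tendsto (fun n => r n • x) Filter.atTop (nhds 0) := by
        simpa using hrl.smul_const x
      have t1 : Filter.Tendsto (fun n => χ (r n • x)) Filter.atTop (nhds 1) := by
        have := (hχ.smooth.continuous.tendsto 0).comp t0
        rwa [hχ.eq_one 0 (by simp)] at this
      have t2 : Filter.Tendsto (fun n => fderiv ℝ χ (r n • x) (u x)) Filter.atTop
          (nhds (fderiv ℝ χ 0 (u x))) :=
        ((hcd.clm_apply continuous_const).tendsto 0).comp t0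
      simpa using (t1.mul_const (fderiv ℝ ψ x (u x))).add (hrl.mul (t2.const_mul (ψ x))))
  simp only [hzero] at hlim
  exact (tendsto_nhds_unique hlim tendsto_const_nhds).symm ▸ rfl

/-- Test the weak divergence condition with ψ(y) = k(x − y): filtered fields are divergence free
pointwise. -/
theorem sum_conv_dir_eq_zero {χ : E3 → ℝ} (hχ : IsCutoff χ) {u : E3 → E3}
    (hu : MemLp u 2 volume) (hdiv : DivergenceFree u) (k : SchwartzMap E3 ℝ) (x : E3) :
    ∑ j, conv (dir (stdv j) k) (fun z => u z j) x = 0 := by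
  have hd : ∀ y, fderiv ℝ (fun y => k (x - y)) y = -fderiv ℝ k (x - y) := fun y => by
    have h1 := (k.differentiableAt (x := x - y)).hasFDerivAt.comp y
      ((hasFDerivAt_id y).const_sub x)
    rw [ContinuousLinearMap.comp_neg, ContinuousLinearMap.comp_id] at h1
    exact h1.fderiv
  have hkc : Continuous (fderiv ℝ k) := (k.smooth 1).continuous_fderiv one_ne_zero
  have h := integral_fderiv_apply_eq_zero hχ hu hdiv (ψ := fun y => k (x - y))
    ((k.smooth ⊤).comp (contDiff_const.sub contDiff_id)) (memLp_comp_sub_left (k.memLp 2) x) (by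
      have h1 := ((SchwartzMap.fderivCLM ℝ E3 ℝ k).memLp 2 volume).comp_measurePreserving
        (Measure.measurePreserving_sub_left volume x)
      refine h1.neg.congr_norm ?_ (Filter.Eventually.of_forall fun y => ?_)
      · have : fderiv ℝ (fun y => k (x - y)) = fun y => -fderiv ℝ k (x - y) := funext hd
        rw [this]
        exact (hkc.comp (continuous_const.sub continuous_id)).neg.aestronglyMeasurable
      · rw [hd]; rfl)
  have he : ∀ y, fderiv ℝ (fun y => k (x - y)) y (u y) = -∑ j, dir (stdv j) k (x - y) * u y j := by
    intro y
    have hx : u y = ∑ i, u y i • stdv i := by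
      ext j; fin_cases j <;> simp [stdv, Fin.sum_univ_three]
    rw [hd, neg_apply]
    congr 1
    conv_lhs => rw [hx]
    simp only [map_sum, map_smul, dir_apply, smul_eq_mul, mul_comm]
  simp only [he, integral_neg, neg_eq_zero] at h
  have hi : ∀ j ∈ Finset.univ, Integrable (fun y => dir (stdv j) k (x - y) * u y j) volume :=
    fun j _ => (memLp_comp_sub_left ((dir (stdv j) k).memLp 2) x).integrable_mul
      (memLp_component hu j)
  rw [integral_finsetSum _ hi] at h
  simpa only [conv_eq_integral] using h

end LittlewoodPaley

namespace LittlewoodPaley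

/-! ### The trilinear estimate -/

theorem integrable_mul_conv {φ f : E3 → ℝ} (hφ : Integrable φ volume) (hf : MemLp f 2 volume)
    (m : SchwartzMap E3 ℝ) : Integrable (fun x => φ x * conv m f x) volume := by
  obtain ⟨C, hC⟩ := exists_abs_conv_le hf (m.memLp 2)
  exact hφ.mul_bdd (c := C) (contDiff_conv m hf).continuous.aestronglyMeasurable
    (Filter.Eventually.of_forall hC)

/-- The Constantin–E–Titi identity: expand the product of increments under the integral. The
integral one of k is what produces the term f g, absorbed by (f − k*f)(g − k*g). -/
theorem conv_mul_eq {f g : E3 → ℝ} (hf : MemLp f 2 volume) (hg : MemLp g 2 volume)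
    (k : SchwartzMap E3 ℝ) (hk : ∫ y, k y = 1) (x : E3) :
    conv k (fun z => f z * g z) x = (∫ y, k y * ((f (x - y) - f x) * (g (x - y) - g x))) +
      conv k f x * conv k g x - (f x - conv k f x) * (g x - conv k g x) := by
  have hfg : Integrable (fun z => f z * g z) volume := hf.integrable_mul hg
  have i1 := integrable_conv_of_integrable hfg k x
  have i2 := (integrable_conv hg (k.memLp 2) x).const_mul (f x)
  have i3 := (integrable_conv hf (k.memLp 2) x).const_mul (g x)
  have i4 := (k.integrable (μ := volume)).mul_const (f x * g x)
  have e : ∀ y, k y * ((f (x - y) - f x) * (g (x - y) - g x)) =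
      ((k y * (f (x - y) * g (x - y)) - f x * (k y * g (x - y))) - g x * (k y * f (x - y))) +
        k y * (f x * g x) := fun y => by ring
  simp only [e]
  have j1 : Integrable (fun y => k y * (f (x - y) * g (x - y)) - f x * (k y * g (x - y))) volume :=
    i1.sub i2
  have j2 : Integrable (fun y => k y * (f (x - y) * g (x - y)) - f x * (k y * g (x - y)) -
      g x * (k y * f (x - y))) volume := j1.sub i3
  rw [integral_add j2 i4, integral_sub j1 i3, integral_sub i1 i2,
    integral_const_mul, integral_const_mul, integral_mul_const, hk]
  simp only [conv]
  ring

theorem lintegral_remainder_le {f g h : E3 → ℝ} (hf : Measurable f) (hg : Measurable g)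
    (hh : Measurable h) (k : SchwartzMap E3 ℝ) {W Λ : ℝ≥0∞}
    (hfW : ∀ y, eLpNorm (fun x => f (x - y) - f x) 3 volume ≤ W * (1 + Λ * ‖y‖ₑ))
    (hgW : ∀ y, eLpNorm (fun x => g (x - y) - g x) 3 volume ≤ W * (1 + Λ * ‖y‖ₑ)) :
    ∫⁻ x, ‖(∫ y, k y * ((f (x - y) - f x) * (g (x - y) - g x))) * h x‖ₑ ≤
      (∫⁻ y, ‖k y‖ₑ * (1 + Λ * ‖y‖ₑ) ^ 2) * (W ^ 2 * eLpNorm h 3 volume) := by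
  have hkm := measurable_schwartz k
  calc ∫⁻ x, ‖(∫ y, k y * ((f (x - y) - f x) * (g (x - y) - g x))) * h x‖ₑ
      ≤ ∫⁻ x, ∫⁻ y, ‖k y‖ₑ * (‖f (x - y) - f x‖ₑ * ‖g (x - y) - g x‖ₑ * ‖h x‖ₑ) := by
        refine lintegral_mono fun x => ?_
        rw [enorm_mul]
        refine (mul_le_mul_left (enorm_integral_le_lintegral_enorm _) _).trans_eq ?_
        rw [← lintegral_mul_const _ (by fun_prop)]
        refine lintegral_congr fun y => ?_
        rw [enorm_mul, enorm_mul]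
        ring
    _ = ∫⁻ y, ‖k y‖ₑ * ∫⁻ x, ‖f (x - y) - f x‖ₑ * ‖g (x - y) - g x‖ₑ * ‖h x‖ₑ := by
        rw [lintegral_lintegral_swap]
        · refine lintegral_congr fun y => ?_
          rw [lintegral_const_mul]
          fun_prop
        · apply Measurable.aemeasurable
          simp only [Function.uncurry_def]
          fun_prop
    _ ≤ ∫⁻ y, (‖k y‖ₑ * (1 + Λ * ‖y‖ₑ) ^ 2) * (W ^ 2 * eLpNorm h 3 volume) := by
        refine lintegral_mono fun y => ?_
        have h1 : Measurable fun x => f (x - y) - f x := (hf.comp (measurable_sub_const y)).sub hf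
        have h2 : Measurable fun x => g (x - y) - g x := (hg.comp (measurable_sub_const y)).sub hg
        have h3 := (lintegral_mul_mul_le h1 h2 hh).trans
          (mul_le_mul_left (mul_le_mul' (hfW y) (hgW y)) _)
        refine (mul_le_mul_right h3 _).trans_eq ?_
        ring
    _ = _ := by
        rw [lintegral_mul_const _ (by fun_prop)]

/-- The flux `∑_{ij} ∫ k * (u_i u_j) · ∂_j l * u_i` with two different filters. -/
noncomputable def fluxForm (u : E3 → E3) (k l : SchwartzMap E3 ℝ) : ℝ :=
  ∑ i, ∑ j, ∫ x, conv k (fun z => u z i * u z j) x *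
    conv (dir (stdv j) l) (fun z => u z i) x

variable {χ : E3 → ℝ} {hχ : IsCutoff χ} {u : E3 → E3}

section

variable (hm : Measurable u) (hu : MemLp u 2 volume)
include hm hu

omit hm in
theorem integrable_tensor (i j : Fin 3) : Integrable (fun z => u z i * u z j) volume :=
  (memLp_component hu i).integrable_mul (memLp_component hu j)

theorem integrable_conv_tensor (k : SchwartzMap E3 ℝ) (i j : Fin 3) :
    Integrable (conv k fun z => u z i * u z j) volume :=
  memLp_one_iff_integrable.1 (memLp_conv k
    ((measurable_component hm i).mul (measurable_component hm j)) le_rfl (by norm_num)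
    (memLp_one_iff_integrable.2 (integrable_tensor hu i j)))

/-- With v = k*u this is ∑_j ∫ v_j ∂_j(v_i²)/2; integrating by parts gives −½ ∫ (div v) v_i² = 0. -/
theorem sum_integral_transport_eq_zero (hχ : IsCutoff χ) (hdiv : DivergenceFree u)
    (k : SchwartzMap E3 ℝ) (i : Fin 3) :
    ∑ j, ∫ x, conv k (fun z => u z i) x * conv k (fun z => u z j) x *
      conv (dir (stdv j) k) (fun z => u z i) x = 0 := by
  set v : Fin 3 → E3 → ℝ := fun j => conv k fun z => u z j with hv
  have hv2 : ∀ j, MemLp (v j) 2 volume := fun j =>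
    memLp_two_conv (measurable_component hm j) (memLp_component hu j) k
  have hvd : ∀ j, Differentiable ℝ (v j) := fun j =>
    (contDiff_conv k (memLp_component hu j)).differentiable (by simp)
  have hvv : Integrable (fun x => v i x ^ 2) volume :=
    ((hv2 i).integrable_mul (hv2 i)).congr (Filter.Eventually.of_forall fun x => by
      simp only [Pi.mul_apply, sq])
  have hfd : ∀ x w, fderiv ℝ (fun x => v i x ^ 2) x w = 2 * (v i x * fderiv ℝ (v i) x w) := by
    intro x w
    have h1 := ((hvd i x).hasFDerivAt.pow 2).fderiv
    rw [h1]
    simp only [smul_apply, smul_eq_mul]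
    norm_num
    ring
  have hI : ∀ j, Integrable (fun x => v i x * v j x * fderiv ℝ (v i) x (stdv j)) volume := by
    intro j
    simp only [hv, fderiv_conv_apply k (memLp_component hu i)]
    exact integrable_mul_conv ((hv2 i).integrable_mul (hv2 j)) (memLp_component hu i) _
  have hJ : ∀ j, Integrable (fun x => fderiv ℝ (v j) x (stdv j) * v i x ^ 2) volume := by
    intro j
    simp only [hv, fderiv_conv_apply k (memLp_component hu j)]
    refine (integrable_mul_conv hvv (memLp_component hu j) (dir (stdv j) k)).congr
      (Filter.Eventually.of_forall fun x => mul_comm _ _)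
  have hparts : ∀ j, ∫ x, v i x * v j x * fderiv ℝ (v i) x (stdv j)
      = -(1 / 2) * ∫ x, fderiv ℝ (v j) x (stdv j) * v i x ^ 2 := by
    intro j
    have h := integral_mul_fderiv_eq_neg_fderiv_mul_of_integrable (μ := (volume : Measure E3))
      (f := v j) (g := fun x => v i x ^ 2) (v := stdv j) (hJ j) (by
        refine ((hI j).const_mul 2).congr (Filter.Eventually.of_forall fun x => ?_)
        dsimp only
        rw [hfd]; ring) (by
        refine (integrable_mul_conv hvv (memLp_component hu j) k).congr
          (Filter.Eventually.of_forall fun x => mul_comm _ _))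
      (fun x _ => hvd j x) (fun x _ => ((hvd i).pow 2) x)
    have e : ∀ x, v j x * fderiv ℝ (fun x => v i x ^ 2) x (stdv j)
        = 2 * (v i x * v j x * fderiv ℝ (v i) x (stdv j)) := fun x => by rw [hfd]; ring
    simp only [e] at h
    rw [integral_const_mul] at h
    linarith
  have hmain : ∑ j, ∫ x, v i x * v j x * fderiv ℝ (v i) x (stdv j) = 0 := by
    simp only [hparts]
    rw [← Finset.mul_sum, ← integral_finsetSum _ fun j _ => hJ j]
    have : ∀ x, ∑ j, fderiv ℝ (v j) x (stdv j) * v i x ^ 2 = 0 := fun x => by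
      rw [← Finset.sum_mul]
      have := sum_conv_dir_eq_zero hχ hu hdiv k x
      simp only [hv, fderiv_conv_apply k (memLp_component hu _), this, zero_mul]
    simp [this]
  simpa only [hv, fderiv_conv_apply k (memLp_component hu _)] using hmain

theorem fluxForm_self_eq (hχ : IsCutoff χ) (hdiv : DivergenceFree u) (k : SchwartzMap E3 ℝ)
    (hk : ∫ y, k y = 1) :
    fluxForm u k k = ∑ i, ∑ j,
      ((∫ x, (∫ y, k y * ((u (x - y) i - u x i) * (u (x - y) j - u x j))) *
        conv (dir (stdv j) k) (fun z => u z i) x) -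
      ∫ x, (u x i - conv k (fun z => u z i) x) * (u x j - conv k (fun z => u z j) x) *
        conv (dir (stdv j) k) (fun z => u z i) x) := by
  have hv2 : ∀ j, MemLp (conv k fun z => u z j) 2 volume := fun j =>
    memLp_two_conv (measurable_component hm j) (memLp_component hu j) k
  have hterm : ∀ i j, ∫ x, conv k (fun z => u z i * u z j) x *
      conv (dir (stdv j) k) (fun z => u z i) x =
      ((∫ x, (∫ y, k y * ((u (x - y) i - u x i) * (u (x - y) j - u x j))) *
        conv (dir (stdv j) k) (fun z => u z i) x) -
      ∫ x, (u x i - conv k (fun z => u z i) x) * (u x j - conv k (fun z => u z j) x) *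
        conv (dir (stdv j) k) (fun z => u z i) x) +
      ∫ x, conv k (fun z => u z i) x * conv k (fun z => u z j) x *
        conv (dir (stdv j) k) (fun z => u z i) x := by
    intro i j
    have hi := memLp_component hu i
    have I1 := integrable_mul_conv (integrable_conv_tensor hm hu k i j) hi (dir (stdv j) k)
    have I2 := integrable_mul_conv ((hv2 i).integrable_mul (hv2 j)) hi (dir (stdv j) k)
    have I3 := integrable_mul_conv ((hi.sub (hv2 i)).integrable_mul
      ((memLp_component hu j).sub (hv2 j))) hi (dir (stdv j) k)
    simp only [Pi.mul_apply, Pi.sub_apply] at I2 I3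
    have e : ∀ x, (∫ y, k y * ((u (x - y) i - u x i) * (u (x - y) j - u x j))) *
        conv (dir (stdv j) k) (fun z => u z i) x =
        (conv k (fun z => u z i * u z j) x * conv (dir (stdv j) k) (fun z => u z i) x -
        conv k (fun z => u z i) x * conv k (fun z => u z j) x *
          conv (dir (stdv j) k) (fun z => u z i) x) +
        (u x i - conv k (fun z => u z i) x) * (u x j - conv k (fun z => u z j) x) *
          conv (dir (stdv j) k) (fun z => u z i) x := fun x => by
      rw [conv_mul_eq hi (memLp_component hu j) k hk x]; ring
    simp only [e]
    have J : Integrable (fun x => conv k (fun z => u z i * u z j) x *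
        conv (dir (stdv j) k) (fun z => u z i) x -
        conv k (fun z => u z i) x * conv k (fun z => u z j) x *
          conv (dir (stdv j) k) (fun z => u z i) x) volume := I1.sub I2
    rw [integral_add J I3, integral_sub I1 I2]
    ring
  rw [fluxForm]
  simp only [hterm, Finset.sum_add_distrib, sum_integral_transport_eq_zero hm hu hχ hdiv k,
    add_zero]

end

/-- Split u_i at frequency λ_{Q+1}: the high part and its translate contribute 2W, the low part |y|
times its gradient, hence three terms W λ_Q. -/
theorem ScaleBounds.eLpNorm_translate_le {Q : ℤ} {W : ℝ≥0∞} (hS : ScaleBounds hχ u Q W)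
    (hm : Measurable u) (hu : MemLp u 2 volume) (i : Fin 3) (y : E3) :
    eLpNorm (fun x => u (x - y) i - u x i) 3 volume
      ≤ 3 * W * (1 + ENNReal.ofReal (lam Q) * ‖y‖ₑ) := by
  set f : E3 → ℝ := fun z => u z i
  have hfm : Measurable f := measurable_component hm i
  have hf : MemLp f 2 volume := memLp_component hu i
  set z := conv (low hχ (Q + 1)) f with hz
  have hzm : Measurable z := measurable_conv_schwartz hfm _
  have hz1 : ContDiff ℝ 1 z := (contDiff_conv _ hf).of_le (by exact_mod_cast le_top)
  have hw : eLpNorm (f - z) 3 volume ≤ W := hS.high i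
  have hwm : Measurable (f - z) := hfm.sub hzm
  have h1 : eLpNorm (fun x => z (x - y) - z x) 3 volume
      ≤ ‖y‖ₑ * (3 * (W * ENNReal.ofReal (lam Q))) := by
    have h2 : eLpNorm (fun x => z (x - y) - z x) 3 volume
        ≤ ‖y‖ₑ * eLpNorm (fderiv ℝ z) 3 volume := by
      simpa [sub_eq_add_neg] using
        eLpNorm_translate_sub_le hz1 (-y) (p := 3) (by norm_num) (by norm_num)
    refine h2.trans (mul_le_mul_right ((eLpNorm_fderiv_le_sum hz1).trans ?_) _)
    simp only [hz, fderiv_conv_apply _ hf]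
    refine (Finset.sum_le_sum fun l _ => hS.grad l i).trans_eq ?_
    simp
  have m1 : Measurable fun x => z (x - y) - z x := (hzm.comp (measurable_sub_const y)).sub hzm
  have m2 : Measurable fun x => (f - z) (x - y) := hwm.comp (measurable_sub_const y)
  have e : (fun x => u (x - y) i - u x i)
      = ((fun x => z (x - y) - z x) + fun x => (f - z) (x - y)) - (f - z) := by
    ext x
    simp only [Pi.sub_apply, Pi.add_apply, f]
    ring
  rw [e]
  calc _ ≤ (eLpNorm (fun x => z (x - y) - z x) 3 volume +
        eLpNorm (fun x => (f - z) (x - y)) 3 volume) + eLpNorm (f - z) 3 volume :=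
        (eLpNorm_sub_le (m1.add m2).aestronglyMeasurable hwm.aestronglyMeasurable
          (by norm_num)).trans (add_le_add_left (eLpNorm_add_le m1.aestronglyMeasurable
            m2.aestronglyMeasurable (by norm_num)) _)
    _ ≤ (‖y‖ₑ * (3 * (W * ENNReal.ofReal (lam Q))) + W) + W := by
        rw [eLpNorm_comp_sub_right hwm.aestronglyMeasurable y]
        gcongr
    _ = 2 * W + 3 * W * (ENNReal.ofReal (lam Q) * ‖y‖ₑ) := by ring
    _ ≤ 3 * W + 3 * W * (ENNReal.ofReal (lam Q) * ‖y‖ₑ) := by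
        gcongr
        norm_num
    _ = _ := by ring

/-- The flux through a filter at scale `λ_Q` with kernel of integral one. -/
theorem LowBounds.enorm_fluxForm_le {M : ℝ≥0∞} (hM : LowBounds hχ M) (hm : Measurable u)
    (hu : MemLp u 2 volume) (hdiv : DivergenceFree u) {Q : ℤ} {W : ℝ≥0∞}
    (hS : ScaleBounds hχ u Q W) {α : ℝ} (hα : |α| ≤ 1) (hαQ : α = 0 ∨ 0 ≤ Q) :
    ‖fluxForm u (low hχ (Q + 1) + α • band hχ Q) (low hχ (Q + 1) + α • band hχ Q)‖ₑ
      ≤ (486 * M + 72) * (W ^ 3 * ENNReal.ofReal (lam Q)) := by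
  set k := low hχ (Q + 1) + α • band hχ Q with hk
  set Λ := ENNReal.ofReal (lam Q) with hΛ
  have hαe : ‖α‖ₑ ≤ 1 := by
    rw [← ofReal_norm, Real.norm_eq_abs]; exact ENNReal.ofReal_le_one.2 hα
  have hcoe : ∀ m n : SchwartzMap E3 ℝ, ∀ i, conv (m + α • n : SchwartzMap E3 ℝ)
      (fun z => u z i) = conv m (fun z => u z i) + α • conv n (fun z => u z i) := by
    intro m n i
    ext x
    have h1 := conv_add_left (m.memLp 2 volume) ((α • n).memLp 2 volume) (memLp_component hu i) x
    have h2 := conv_smul_left α n (fun z => u z i) x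
    simp only [Pi.add_apply, Pi.smul_apply, smul_eq_mul]
    rw [← h2]
    exact h1
  have hk1 : ∫ y, k y = 1 := by
    simp only [hk, band, add_apply, smul_apply, sub_apply, smul_eq_mul]
    have J : Integrable (fun y => low hχ (Q + 1) y - low hχ Q y) volume :=
      (low hχ (Q + 1)).integrable.sub (low hχ Q).integrable
    rw [integral_add (low hχ (Q + 1)).integrable (J.const_mul α), integral_const_mul, integral_sub (low hχ (Q + 1)).integrable (low hχ Q).integrable]
    simp [integral_low]
  have hv : ∀ i, conv k (fun z => u z i) = conv (low hχ (Q + 1)) (fun z => u z i) +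
      α • conv (band hχ Q) (fun z => u z i) := hcoe _ _
  have hdk : ∀ j, dir (stdv j) k = dir (stdv j) (low hχ (Q + 1)) + α • dir (stdv j) (band hχ Q) := by
    intro j
    simp only [dir, hk]
    rw [LineDeriv.lineDerivOp_add, LineDeriv.lineDerivOp_smul]
  have hmc : ∀ i, Measurable fun z => u z i := measurable_component hm
  have hcm : ∀ (m : SchwartzMap E3 ℝ) i, Measurable (conv m fun z => u z i) := fun m i =>
    measurable_conv_schwartz (hmc i) m
  have hband : ∀ i, eLpNorm (α • conv (band hχ Q) fun z => u z i) 3 volume ≤ W := by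
    intro i
    rw [eLpNorm_const_smul]
    -- `ScaleBounds` controls the band at Q only for Q ≥ 0; for α = 0 it does not occur in the
    -- kernel.
    rcases hαQ with rfl | hQ
    · simp
    · exact (mul_le_of_le_one_left' hαe).trans (hS.band hQ i)
  have hgband : ∀ i j, eLpNorm (α • conv (dir (stdv j) (band hχ Q)) fun z => u z i) 3 volume
      ≤ W * Λ := by
    intro i j
    rw [eLpNorm_const_smul]
    rcases hαQ with rfl | hQ
    · simp
    · exact (mul_le_of_le_one_left' hαe).trans (hS.grad_band hQ j i)
  have hw : ∀ i, eLpNorm (fun x => u x i - conv k (fun z => u z i) x) 3 volume ≤ 2 * W := by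
    intro i
    have e : (fun x => u x i - conv k (fun z => u z i) x) = ((fun z => u z i) -
        conv (low hχ (Q + 1)) fun z => u z i) - α • conv (band hχ Q) fun z => u z i := by
      ext x
      rw [hv]
      simp only [Pi.sub_apply, Pi.add_apply]
      ring
    rw [e, two_mul]
    exact (eLpNorm_sub_le ((hmc i).sub (hcm _ i)).aestronglyMeasurable
      ((hcm _ i).const_smul α).aestronglyMeasurable (by norm_num)).trans
      (add_le_add (hS.high i) (hband i))
  have hg : ∀ i j, eLpNorm (conv (dir (stdv j) k) fun z => u z i) 3 volume ≤ 2 * (W * Λ) := by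
    intro i j
    rw [hdk, hcoe, two_mul]
    exact (eLpNorm_add_le (hcm _ i).aestronglyMeasurable
      ((hcm _ i).const_smul α).aestronglyMeasurable (by norm_num)).trans
      (add_le_add (hS.grad j i) (hgband i j))
  -- The kernel is (1 + α) `low hχ (Q + 1)` − α `low hχ Q`, with coefficients at most 2 and 1 in
  -- absolute value.
  have hmom : ∫⁻ y, ‖k y‖ₑ * (1 + Λ * ‖y‖ₑ) ^ 2 ≤ 3 * M := by
    have m1 := measurable_schwartz (low hχ (Q + 1))
    have m2 := measurable_schwartz (low hχ Q)
    have hl : Λ ≤ ENNReal.ofReal (lam (Q + 1)) := by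
      refine ENNReal.ofReal_le_ofReal ?_
      unfold lam; exact zpow_le_zpow_right₀ one_le_two (by omega)
    calc ∫⁻ y, ‖k y‖ₑ * (1 + Λ * ‖y‖ₑ) ^ 2
        ≤ ∫⁻ y, (2 * (‖low hχ (Q + 1) y‖ₑ * (1 + ENNReal.ofReal (lam (Q + 1)) * ‖y‖ₑ) ^ 2) +
          ‖low hχ Q y‖ₑ * (1 + Λ * ‖y‖ₑ) ^ 2) := by
          refine lintegral_mono fun y => ?_
          have h1 : ‖k y‖ₑ ≤ 2 * ‖low hχ (Q + 1) y‖ₑ + ‖low hχ Q y‖ₑ := by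
            calc ‖k y‖ₑ ≤ ‖low hχ (Q + 1) y‖ₑ + ‖α‖ₑ * ‖low hχ (Q + 1) y - low hχ Q y‖ₑ := by
                  rw [← enorm_mul]; exact enorm_add_le _ _
              _ ≤ ‖low hχ (Q + 1) y‖ₑ + 1 * (‖low hχ (Q + 1) y‖ₑ + ‖low hχ Q y‖ₑ) := by
                  gcongr
                  exact enorm_sub_le
              _ = _ := by ring
          calc _ ≤ (2 * ‖low hχ (Q + 1) y‖ₑ + ‖low hχ Q y‖ₑ) * (1 + Λ * ‖y‖ₑ) ^ 2 := by gcongr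
            _ = 2 * (‖low hχ (Q + 1) y‖ₑ * (1 + Λ * ‖y‖ₑ) ^ 2) +
                ‖low hχ Q y‖ₑ * (1 + Λ * ‖y‖ₑ) ^ 2 := by ring
            _ ≤ _ := by gcongr
      _ ≤ 2 * M + M := by
          rw [lintegral_add_left (by fun_prop), lintegral_const_mul _ (by fun_prop)]
          gcongr
          · exact hM.moment (Q + 1)
          · exact hM.moment Q
      _ = 3 * M := by ring
  rw [fluxForm_self_eq hm hu hχ hdiv k hk1]
  -- Increments of size 3W give 3 · 3² · 2 = 54, the product of high parts 2³ = 8. Summing over the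
  -- nine pairs (i, j) yields 486 and 72.
  have hterm : ∀ i j, ‖(∫ x, (∫ y, k y * ((u (x - y) i - u x i) * (u (x - y) j - u x j))) *
        conv (dir (stdv j) k) (fun z => u z i) x) -
      ∫ x, (u x i - conv k (fun z => u z i) x) * (u x j - conv k (fun z => u z j) x) *
        conv (dir (stdv j) k) (fun z => u z i) x‖ₑ ≤ (54 * M + 8) * (W ^ 3 * Λ) := by
    intro i j
    have h1 : ‖∫ x, (∫ y, k y * ((u (x - y) i - u x i) * (u (x - y) j - u x j))) *
        conv (dir (stdv j) k) (fun z => u z i) x‖ₑ ≤ 3 * M * ((3 * W) ^ 2 * (2 * (W * Λ))) :=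
      (enorm_integral_le_lintegral_enorm _).trans ((lintegral_remainder_le (hmc i) (hmc j)
        (hcm _ i) k (hS.eLpNorm_translate_le hm hu i) (hS.eLpNorm_translate_le hm hu j)).trans
          (mul_le_mul' hmom (mul_le_mul_right (hg i j) _)))
    have h2 : ‖∫ x, (u x i - conv k (fun z => u z i) x) * (u x j - conv k (fun z => u z j) x) *
        conv (dir (stdv j) k) (fun z => u z i) x‖ₑ ≤ 2 * W * (2 * W) * (2 * (W * Λ)) := by
      refine (enorm_integral_le_lintegral_enorm _).trans ?_
      simp only [enorm_mul]
      exact (lintegral_mul_mul_le ((hmc i).sub (hcm _ i)) ((hmc j).sub (hcm _ j)) (hcm _ i)).trans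
        (mul_le_mul' (mul_le_mul' (hw i) (hw j)) (hg i j))
    refine enorm_sub_le.trans ((add_le_add h1 h2).trans_eq ?_)
    ring
  calc _ ≤ ∑ i : Fin 3, ∑ j : Fin 3, (54 * M + 8) * (W ^ 3 * Λ) :=
        (enorm_sum_le _ _).trans (Finset.sum_le_sum fun i _ => (enorm_sum_le _ _).trans
          (Finset.sum_le_sum fun j _ => hterm i j))
    _ = _ := by
        simp only [Finset.sum_const, Finset.card_univ, Fintype.card_fin, nsmul_eq_mul]
        push_cast
        ring

end LittlewoodPaley

namespace LittlewoodPaley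

/-! ### Reduction of the energy flux to filters of integral one -/

section Flux

variable {χ : E3 → ℝ} (hχ : IsCutoff χ) {u : E3 → E3} (hm : Measurable u) (hu : MemLp u 2 volume)

theorem conv_sub_left_of_integrable {f : E3 → ℝ} (hf : Integrable f volume)
    (k l : SchwartzMap E3 ℝ) (x : E3) :
    conv (k - l : SchwartzMap E3 ℝ) f x = conv k f x - conv l f x := by
  simp only [conv, sub_apply, sub_mul]
  exact integral_sub (integrable_conv_of_integrable hf k x) (integrable_conv_of_integrable hf l x)

include hu

theorem fderiv_filter_apply (k : SchwartzMap E3 ℝ) (x w : E3) (i : Fin 3) :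
    fderiv ℝ (fun z => ∫ y, k y • u (z - y)) x w i = conv (dir w k) (fun z => u z i) x := by
  have hc : ∀ i, (fun z => (∫ y, k y • u (z - y)) i) = conv k fun z => u z i := fun i =>
    funext fun z => integral_smul_apply hu k z i
  have hd : DifferentiableAt ℝ (fun z => ∫ y, k y • u (z - y)) x := by
    rw [differentiableAt_euclidean]
    intro i
    rw [hc]
    exact (contDiff_conv k (memLp_component hu i)).differentiable (by simp) x
  have h := ((EuclideanSpace.proj i : E3 →L[ℝ] ℝ).hasFDerivAt.comp x hd.hasFDerivAt).fderiv
  have e : (EuclideanSpace.proj i : E3 →L[ℝ] ℝ) ∘ (fun z => ∫ y, k y • u (z - y))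
      = conv k fun z => u z i := hc i
  rw [e] at h
  rw [← fderiv_conv_apply k (memLp_component hu i), h]
  rfl

theorem fluxDensity_eq (Q₀ Q₁ : ℤ) (x : E3) :
    fluxDensity χ Q₀ Q₁ u x = ∑ i, ∑ j,
      conv (∑ q ∈ Finset.Icc Q₀ Q₁, blockKernel hχ q : SchwartzMap E3 ℝ)
        (fun z => u z i * u z j) x *
      conv (dir (stdv j) (∑ q ∈ Finset.Icc Q₀ Q₁, blockKernel hχ q)) (fun z => u z i) x := by
  have e : shell χ Q₀ Q₁ u = fun x =>
      ∫ y, (∑ q ∈ Finset.Icc Q₀ Q₁, blockKernel hχ q) y • u (x - y) := funext fun x =>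
    shell_eq_integral hχ Q₀ Q₁ x fun k => integrable_smul_of_memLp hu k x
  have e' : ∀ i j, shell χ Q₀ Q₁ (fun z => u z i * u z j) x =
      conv (∑ q ∈ Finset.Icc Q₀ Q₁, blockKernel hχ q : SchwartzMap E3 ℝ)
        (fun z => u z i * u z j) x := fun i j =>
    shell_eq_integral hχ Q₀ Q₁ x fun k =>
      integrable_conv_of_integrable (integrable_tensor hu i j) k x
  simp only [fluxDensity, Matrix.trace, Matrix.diag_apply, Matrix.mul_apply, shellTensor, grad,
    Matrix.of_apply, e', e, fderiv_filter_apply hu, stdv]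

include hm

theorem integrable_fluxForm_term (k l : SchwartzMap E3 ℝ) (i j : Fin 3) :
    Integrable (fun x => conv k (fun z => u z i * u z j) x *
      conv (dir (stdv j) l) (fun z => u z i) x) volume :=
  integrable_mul_conv (integrable_conv_tensor hm hu k i j) (memLp_component hu i) _

include hχ in
theorem integrable_fluxDensity (Q₀ Q₁ : ℤ) : Integrable (fluxDensity χ Q₀ Q₁ u) volume := by
  rw [funext (fluxDensity_eq hχ hu Q₀ Q₁)]
  exact integrable_finsetSum _ fun i _ => integrable_finsetSum _ fun j _ =>
    integrable_fluxForm_term hm hu _ _ i j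

theorem flux_eq_fluxForm (Q₀ Q₁ : ℤ) :
    flux χ Q₀ Q₁ u = fluxForm u (∑ q ∈ Finset.Icc Q₀ Q₁, blockKernel hχ q)
      (∑ q ∈ Finset.Icc Q₀ Q₁, blockKernel hχ q) := by
  simp only [flux, fluxDensity_eq hχ hu, fluxForm]
  rw [integral_finsetSum _ fun i _ => integrable_finsetSum _ fun j _ =>
    integrable_fluxForm_term hm hu _ _ i j]
  exact Finset.sum_congr rfl fun i _ => integral_finsetSum _ fun j _ =>
    integrable_fluxForm_term hm hu _ _ i j

theorem fluxForm_sub_left (k k' l : SchwartzMap E3 ℝ) :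
    fluxForm u (k - k') l = fluxForm u k l - fluxForm u k' l := by
  simp only [fluxForm, ← Finset.sum_sub_distrib]
  refine Finset.sum_congr rfl fun i _ => Finset.sum_congr rfl fun j _ => ?_
  rw [← integral_sub (integrable_fluxForm_term hm hu k l i j)
    (integrable_fluxForm_term hm hu k' l i j)]
  simp only [conv_sub_left_of_integrable (integrable_tensor hu i j), sub_mul]

theorem fluxForm_sub_right (k l l' : SchwartzMap E3 ℝ) :
    fluxForm u k (l - l') = fluxForm u k l - fluxForm u k l' := by
  simp only [fluxForm, ← Finset.sum_sub_distrib]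
  refine Finset.sum_congr rfl fun i _ => Finset.sum_congr rfl fun j _ => ?_
  rw [← integral_sub (integrable_fluxForm_term hm hu k l i j)
    (integrable_fluxForm_term hm hu k l' i j)]
  refine integral_congr_ae (Filter.Eventually.of_forall fun x => ?_)
  have e : dir (stdv j) (l - l') = dir (stdv j) l - dir (stdv j) l' := by
    simp only [dir, sub_eq_add_neg, LineDeriv.lineDerivOp_add, LineDeriv.lineDerivOp_neg]
  have h := conv_sub_left ((dir (stdv j) l).memLp 2 volume) ((dir (stdv j) l').memLp 2 volume)
    (memLp_component hu i) x
  dsimp only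
  rw [e, ← mul_sub, ← h]
  rfl

/-- Moving the outer filter onto ∇(l*u) leaves the composition of the two filters, which is the
lower one in either order. The mixed flux therefore forgets both the upper filter and the order. -/
theorem fluxForm_low_eq {s t : ℤ} (k : SchwartzMap E3 ℝ) (l : SchwartzMap E3 ℝ)
    (hkl : (k = low hχ s ∧ l = low hχ t) ∨ (k = low hχ t ∧ l = low hχ s)) (hts : t < s) :
    fluxForm u k l = ∑ i, ∑ j, ∫ x, u x i * u x j *
      conv (dir (stdv j) (low hχ t)) (fun z => u z i) x := by
  refine Finset.sum_congr rfl fun i _ => Finset.sum_congr rfl fun j _ => ?_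
  have hi := memLp_component hu i
  have him := measurable_component hm i
  obtain ⟨C, hC⟩ := exists_abs_conv_le hi ((dir (stdv j) l).memLp 2 volume)
  have hke : ∀ x, k (-x) = k x := by
    rcases hkl with ⟨rfl, _⟩ | ⟨rfl, _⟩ <;> exact low_even hχ _
  rw [integral_conv_mul k hke (integrable_tensor hu i j) (measurable_conv_schwartz him _) hC]
  rcases hkl with ⟨rfl, rfl⟩ | ⟨rfl, rfl⟩
  · rw [low_conv_dir_low_of_lt hχ him hi _ hts]
  · rw [low_conv_dir_low_of_gt hχ him hi _ hts]

theorem fluxForm_low_right {s t : ℤ} (hts : t < s) :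
    fluxForm u (low hχ t) (low hχ s) = fluxForm u (low hχ s) (low hχ t) := by
  rw [fluxForm_low_eq hχ hm hu _ _ (Or.inl ⟨rfl, rfl⟩) hts,
    fluxForm_low_eq hχ hm hu _ _ (Or.inr ⟨rfl, rfl⟩) hts]

theorem fluxForm_low_left {s s' t : ℤ} (h : t < s) (h' : t < s') :
    fluxForm u (low hχ s) (low hχ t) = fluxForm u (low hχ s') (low hχ t) := by
  rw [fluxForm_low_eq hχ hm hu _ _ (Or.inl ⟨rfl, rfl⟩) h,
    fluxForm_low_eq hχ hm hu _ _ (Or.inl ⟨rfl, rfl⟩) h']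

/-- Let Φ(A) be the flux of a filter A and m the mixed flux of P_{Q+1} and P_Q. The left side is
Φ(P_R) − 2m + Φ(P_Q), and Φ(2P_{Q+1} − P_Q) = 4Φ(P_{Q+1}) − 4m + Φ(P_Q); eliminating m gives the
coefficients. All filters on the right have kernels of integral one. -/
theorem fluxForm_low_sub_low {Q R : ℤ} (h : Q < R) :
    fluxForm u (low hχ R - low hχ Q) (low hχ R - low hχ Q) =
      fluxForm u (low hχ R) (low hχ R) - 2 * fluxForm u (low hχ (Q + 1)) (low hχ (Q + 1)) +
      1 / 2 * fluxForm u (low hχ (Q + 1) + band hχ Q) (low hχ (Q + 1) + band hχ Q) +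
      1 / 2 * fluxForm u (low hχ Q) (low hχ Q) := by
  have e : low hχ (Q + 1) + band hχ Q = low hχ (Q + 1) - (low hχ Q - low hχ (Q + 1)) := by
    rw [band]; abel
  rw [e]
  simp only [fluxForm_sub_left hm hu, fluxForm_sub_right hm hu]
  rw [fluxForm_low_right hχ hm hu h, fluxForm_low_right hχ hm hu (lt_add_one Q),
    fluxForm_low_left hχ hm hu h (lt_add_one Q)]
  ring

theorem LowBounds.enorm_flux_le {hχ : IsCutoff χ} {M : ℝ≥0∞} (hM : LowBounds hχ M)
    (hdiv : DivergenceFree u) {Q₀ Q₁ : ℤ} (h0 : -1 ≤ Q₀) (h : Q₀ < Q₁) {W₀ W₁ : ℝ≥0∞}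
    (h₀ : ScaleBounds hχ u Q₀ W₀) (h₁ : ScaleBounds hχ u Q₁ W₁) :
    ‖flux χ Q₀ Q₁ u‖ₑ ≤ 3 * (486 * M + 72) * (W₀ ^ 3 * ENNReal.ofReal (lam Q₀)) +
      3 * (486 * M + 72) * (W₁ ^ 3 * ENNReal.ofReal (lam Q₁)) := by
  set K := 486 * M + 72 with hK
  set B₀ := W₀ ^ 3 * ENNReal.ofReal (lam Q₀) with hB₀
  set B₁ := W₁ ^ 3 * ENNReal.ofReal (lam Q₁) with hB₁
  have hP : ‖fluxForm u (low hχ (Q₁ + 1)) (low hχ (Q₁ + 1))‖ₑ ≤ K * B₁ := by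
    simpa using hM.enorm_fluxForm_le hm hu hdiv h₁ (α := 0) (by simp) (Or.inl rfl)
  rw [flux_eq_fluxForm hχ hm hu]
  rcases h0.eq_or_lt with rfl | h0
  · rw [sum_blockKernel_neg_one hχ h.le]
    calc _ ≤ K * B₁ := hP
      _ ≤ 3 * K * B₁ := by
        gcongr
        exact le_mul_of_one_le_left' (by norm_num)
      _ ≤ _ := le_add_self
  have h0' : 0 ≤ Q₀ := by omega
  have hα := fun (α : ℝ) (hα : |α| ≤ 1) => hM.enorm_fluxForm_le hm hu hdiv h₀ hα (Or.inr h0')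
  have hL : ‖fluxForm u (low hχ (Q₀ + 1)) (low hχ (Q₀ + 1))‖ₑ ≤ K * B₀ := by
    simpa using hα 0 (by simp)
  have hL2 : ‖fluxForm u (low hχ (Q₀ + 1) + band hχ Q₀) (low hχ (Q₀ + 1) + band hχ Q₀)‖ₑ
      ≤ K * B₀ := by
    simpa using hα 1 (by simp)
  -- The three filters needed at scale Q₀ are P_{Q₀+1} + α Δ_{Q₀} with α = 0, 1, −1.
  have hN : ‖fluxForm u (low hχ Q₀) (low hχ Q₀)‖ₑ ≤ K * B₀ := by
    have e : low hχ (Q₀ + 1) + (-1 : ℝ) • band hχ Q₀ = low hχ Q₀ := by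
      rw [band, neg_one_smul]; abel
    have := hα (-1) (by simp)
    rwa [e] at this
  rw [sum_blockKernel hχ h0' h.le, fluxForm_low_sub_low hχ hm hu (by omega : Q₀ < Q₁ + 1)]
  have h2 : ‖(2 : ℝ)‖ₑ = 2 := by rw [← ofReal_norm]; norm_num
  have hhalf : ‖(1 / 2 : ℝ)‖ₑ = 2⁻¹ := by
    rw [one_div, enorm_inv two_ne_zero, h2]
  calc _ ≤ ‖fluxForm u (low hχ (Q₁ + 1)) (low hχ (Q₁ + 1))‖ₑ +
        ‖(2 : ℝ)‖ₑ * ‖fluxForm u (low hχ (Q₀ + 1)) (low hχ (Q₀ + 1))‖ₑ +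
        ‖(1 / 2 : ℝ)‖ₑ *
          ‖fluxForm u (low hχ (Q₀ + 1) + band hχ Q₀) (low hχ (Q₀ + 1) + band hχ Q₀)‖ₑ +
        ‖(1 / 2 : ℝ)‖ₑ * ‖fluxForm u (low hχ Q₀) (low hχ Q₀)‖ₑ := by
        simp only [← enorm_mul]
        exact (enorm_add_le _ _).trans (add_le_add_left ((enorm_add_le _ _).trans
          (add_le_add_left enorm_sub_le _)) _)
    _ ≤ K * B₁ + 2 * (K * B₀) + 2⁻¹ * (K * B₀) + 2⁻¹ * (K * B₀) := by
        rw [h2, hhalf]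
        gcongr
    _ = K * B₁ + (2 + (2⁻¹ + 2⁻¹)) * (K * B₀) := by ring
    _ = 1 * (K * B₁) + 3 * (K * B₀) := by rw [ENNReal.inv_two_add_inv_two]; norm_num
    _ ≤ 3 * (K * B₁) + 3 * (K * B₀) := by
        gcongr
        norm_num
    _ = _ := by ring

end Flux

/-! ### Representatives -/

section Congr

variable {χ : E3 → ℝ}

theorem block_congr_ae {F : Type*} [NormedAddCommGroup F] [NormedSpace ℝ F] {f g : E3 → F}
    (h : f =ᵐ[volume] g) (q : ℤ) : block χ q f = block χ q g := by
  ext x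
  have hx : (fun y => f (x - y)) =ᵐ[volume] fun y => g (x - y) :=
    (quasiMeasurePreserving_sub_left volume x).ae_eq_comp h
  have hk : ∀ k : E3 → ℝ, ∫ y, k y • f (x - y) = ∫ y, k y • g (x - y) := fun k =>
    integral_congr_ae (hx.mono fun y hy => by simp only [hy])
  simp only [block, hk]

theorem shell_congr_ae {F : Type*} [NormedAddCommGroup F] [NormedSpace ℝ F] {f g : E3 → F}
    (h : f =ᵐ[volume] g) (Q₀ Q₁ : ℤ) : shell χ Q₀ Q₁ f = shell χ Q₀ Q₁ g := by
  ext x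
  simp only [shell, block_congr_ae h]

theorem fluxDensity_congr_ae {u v : E3 → E3} (h : u =ᵐ[volume] v) (Q₀ Q₁ : ℤ) :
    fluxDensity χ Q₀ Q₁ u = fluxDensity χ Q₀ Q₁ v := by
  have ht : ∀ i j, shell χ Q₀ Q₁ (fun z => u z i * u z j)
      = shell χ Q₀ Q₁ fun z => v z i * v z j := fun i j =>
    shell_congr_ae (h.mono fun z hz => by simp only [hz]) Q₀ Q₁
  ext x
  simp only [fluxDensity, shellTensor, shell_congr_ae h, ht]

theorem locSum_congr_ae {u v : E3 → E3} (h : u =ᵐ[volume] v) (Q : ℤ) :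
    locSum χ u Q = locSum χ v Q := by
  simp only [locSum, amp, block_congr_ae h]

theorem DivergenceFree.congr_ae {u v : E3 → E3} (hu : DivergenceFree u) (h : u =ᵐ[volume] v) :
    DivergenceFree v := fun ψ hψ hc => by
  rw [← hu ψ hψ hc]
  exact integral_congr_ae (h.mono fun x hx => by simp only [hx])

end Congr

/-! ### Assembly of the main estimate. -/

theorem scale_cube (c X : ℝ≥0∞) (Q : ℤ) :
    (c * ENNReal.ofReal (lam Q ^ (-1 / 3 : ℝ)) * X ^ (1 / 2 : ℝ)) ^ 3 * ENNReal.ofReal (lam Q)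
      = c ^ 3 * X ^ (3 / 2 : ℝ) := by
  have hQ := lam_pos Q
  have h1 : ENNReal.ofReal (lam Q ^ (-1 / 3 : ℝ)) ^ 3 * ENNReal.ofReal (lam Q) = 1 := by
    rw [← ENNReal.ofReal_pow (by positivity), ← ENNReal.ofReal_mul (by positivity),
      ← Real.rpow_natCast, ← Real.rpow_mul hQ.le]
    norm_num
    rw [Real.rpow_neg_one, inv_mul_cancel₀ hQ.ne']
  have h2 : (X ^ (1 / 2 : ℝ)) ^ 3 = X ^ (3 / 2 : ℝ) := by
    rw [← ENNReal.rpow_natCast, ← ENNReal.rpow_mul]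
    norm_num
  rw [mul_pow, mul_pow, h2]
  calc _ = c ^ 3 * X ^ (3 / 2 : ℝ) *
        (ENNReal.ofReal (lam Q ^ (-1 / 3 : ℝ)) ^ 3 * ENNReal.ofReal (lam Q)) := by ring
    _ = _ := by rw [h1, mul_one]

end LittlewoodPaley

theorem mainTheorem4 (χ : LittlewoodPaley.E3 → ℝ) (hχ : LittlewoodPaley.IsCutoff χ) :
    ∃ C : ℝ, 0 < C ∧
      ∀ u : LittlewoodPaley.E3 → LittlewoodPaley.E3,
        MemLp u 2 volume → LittlewoodPaley.DivergenceFree u →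
        ∀ Q₀ Q₁ : ℤ, -1 ≤ Q₀ → Q₀ < Q₁ →
          Integrable (LittlewoodPaley.fluxDensity χ Q₀ Q₁ u) volume ∧
          ENNReal.ofReal |LittlewoodPaley.flux χ Q₀ Q₁ u| ≤
            ENNReal.ofReal C * LittlewoodPaley.locSum χ u Q₀ ^ (3 / 2 : ℝ) +
            ENNReal.ofReal C * LittlewoodPaley.locSum χ u Q₁ ^ (3 / 2 : ℝ) := by
  obtain ⟨M, hM⟩ := LittlewoodPaley.exists_lowBounds hχ
  obtain ⟨c, hc, hW⟩ := hM.exists_scaleBounds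
  have hMt := hM.ne_top
  set A : ℝ≥0∞ := 3 * (486 * M + 72) * c ^ 3 with hA
  have hAt : A ≠ ⊤ := by finiteness
  -- A depends only on bounds for the filters, hence on χ; adding 1 makes the constant strictly
  -- positive.
  refine ⟨A.toReal + 1, by positivity, fun u hu hdiv Q₀ Q₁ h0 h => ?_⟩
  -- Every quantity in the statement depends only on the almost-everywhere class of u, so a Borel
  -- representative may be used.
  obtain ⟨v, hv, huv⟩ := hu.1
  have hv2 : MemLp v 2 volume := hu.ae_eq huv
  have hvm : Measurable v := hv.measurable
  have hflux : LittlewoodPaley.flux χ Q₀ Q₁ u = LittlewoodPaley.flux χ Q₀ Q₁ v := by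
    simp only [LittlewoodPaley.flux, LittlewoodPaley.fluxDensity_congr_ae huv]
  rw [LittlewoodPaley.fluxDensity_congr_ae huv, LittlewoodPaley.locSum_congr_ae huv,
    LittlewoodPaley.locSum_congr_ae huv, hflux]
  refine ⟨LittlewoodPaley.integrable_fluxDensity hχ hvm hv2 Q₀ Q₁, ?_⟩
  have hCA : A ≤ ENNReal.ofReal (A.toReal + 1) := by
    rw [← ENNReal.ofReal_toReal hAt]
    exact ENNReal.ofReal_le_ofReal (by simp [ENNReal.toReal_nonneg])
  have key := hM.enorm_flux_le hvm hv2 (hdiv.congr_ae huv) h0 h (hW v hvm hv2 Q₀ h0)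
    (hW v hvm hv2 Q₁ (by omega))
  rw [LittlewoodPaley.scale_cube, LittlewoodPaley.scale_cube, ← mul_assoc, ← mul_assoc,
    ← hA] at key
  rw [← Real.enorm_eq_ofReal_abs]
  exact key.trans (by gcongr)
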